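/- All signals are functions of time $t\in[0,\infty)$; for square matrices, $X\succeq \mu I$ means that $X-\mu I$ is symmetric positive semidefinite. For $\Omega\in\mathbb{R}^3$, $\Omega_\times$ denotes the skew-symmetric matrix of $v\mapsto\Omega\times v$, and for a unit vector $y\in\mathbb{R}^3$, $\pi_y:=I_3-yy^\top$. Let $\Omega,\omega_T,a_T:[0,\infty)\to\mathbb{R}^3$, let $y:[0,\infty)\to S^2$ be continuous (the measured bearing), let $Q_B:[0,\infty)\to\mathbf{SO}(3)$ satisfy $\dot Q_B=Q_B\Omega_\times$, and let $Z:[0,\infty)\to\mathbf{SO}(3)$ satisfy $\dot Z=Z\,\omega_{T\times}$, $Z(0)=I_3$. Put $a_T^z:=Za_T$, $y_0:=Q_By$ and $$A(t):=\bar A(t)\otimes I_3-I_5\otimes\Omega(t)_\times,\qquad \bar A(t):=\begin{bmatrix}0&1&0_{1\times3}\\0&0&-a_T^{z\top}(t)\\0_{3\times1}&0_{3\times1}&0_{3\times3}\end{bmatrix},\qquad C(t):=[\,1\;\;0_{1\times4}\,]\otimes\pi_{y(t)}.$$ Let $D$ and $V$ be continuous, bounded, symmetric matrix-valued functions of sizes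 $3\times3$ and $15\times15$ that are uniformly positive definite ($D(t)\succeq c\,I_3$ and $V(t)\succeq c\,I_{15}$ for all $t\ge0$, for some $c>0$). Consider the error system in $\mathbb{R}^{15}$ $$\dot{\boldsymbol x}=A(t)\boldsymbol x-P(t)C(t)^\top D(t)\,\boldsymbol y,\qquad \boldsymbol y=C(t)\boldsymbol x,$$ where $P$ solves the Riccati equation $$\dot P=AP+PA^\top-PC^\top DCP+V,\qquad P(0)\ \text{symmetric positive definite}.$$ For $\delta>0$ define $$\Lambda_T(s,t):=\int_t^s(\tau-s)\,a_T^{z\top}(\tau)\,d\tau\otimes I_3,\qquad \Lambda_\pi(t,\delta):=\int_t^{t+\delta}\begin{bmatrix}1&s-t\\s-t&(s-t)^2\end{bmatrix}\otimes\pi_{y_0(s)}\,ds,$$ $$B(t,\delta):=\int_t^{t+\delta}\begin{bmatrix}1\\s-t\end{bmatrix}\otimes\pi_{y_0(s)}\Lambda_T(s,t)\,ds,\qquad \rho(t,\delta):=\Lambda_\pi^{-1}(t,\delta)B(t,\delta),$$ $$M(s,t):=\pi_{y_0(s)}\bigl(\Lambda_T(s,t)-[\,I_3\;\;(s-t)I_3\,]\,\rho(t,\delta)\bigr)$$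 (with the convention $\rho(t,\delta):=0$ at those $t$, if any, at which $\Lambda_\pi(t,\delta)$ is singular). Suppose that $a_T$ is continuous and bounded and that there exist $\mu,\delta>0$ such that for all $t\ge0$ $$\frac1\delta\int_t^{t+\delta}\pi_{y_0(s)}\,ds\succeq\mu I_3,\qquad \frac1\delta\int_t^{t+\delta}M^\top(s,t)M(s,t)\,ds\succeq\mu I_9 .$$ Then: 1. The pair $(A,C)$ is uniformly observable: there exist $\delta',\mu'>0$ such that for all $t\ge0$ $$\frac1{\delta'}\int_t^{t+\delta'}\Phi^\top(s,t)C^\top(s)C(s)\Phi(s,t)\,ds\succeq\mu' I_{15},$$ where $\Phi$ is the state transition matrix of $A$ ($\tfrac{\partial}{\partial s}\Phi(s,t)=A(s)\Phi(s,t)$, $\Phi(t,t)=I_{15}$). 2. For every symmetric positive definite $P(0)$ the Riccati equation has a solution on $[0,\infty)$, and for every such solution $P$ the equilibrium $\boldsymbol x=0$ of the error system is globally exponentially stable: there exist $k,\lambda>0$ such that for all $t_0\ge0$ every solution on $[t_0,\infty)$ satisfies $|\boldsymbol x(t)|\le k\,e^{-\lambda(t-t_0)}\,|\boldsymbol x(t_0)|$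 for all $t\ge t_0$. -/

import Mathlib

open scoped Matrix Kronecker

noncomputable section

namespace BearingObserver

/-- The Euclidean space `ℝ³`. -/
abbrev R3 : Type := EuclideanSpace ℝ (Fin 3)

/-- The index set of the error state `x = (ξ̃, ν̃, γ̃) ∈ ℝ¹⁵`: five blocks of three coordinates.
The last three blocks are the columns of the matrix `vec⁻¹(γ̃)`. -/
abbrev Ix : Type := Fin 5 × Fin 3

/-! ### Matrix-valued functions of time -/

/-- The matrix-valued function `X` has derivative `X'` at `t` within `s` (entry by entry). -/
def HasMatDerivWithinAt {m n : Type*} (X : ℝ → Matrix m n ℝ) (X' : Matrix m n ℝ)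
    (s : Set ℝ) (t : ℝ) : Prop :=
  ∀ i j, HasDerivWithinAt (fun τ => X τ i j) (X' i j) s t

/-- The integral `∫ₐᵇ F(s) ds` of a matrix-valued function (entry by entry). -/
def matIntegral {m n : Type*} (a b : ℝ) (F : ℝ → Matrix m n ℝ) : Matrix m n ℝ :=
  Matrix.of fun i j => ∫ s in a..b, F s i j

/-- The matrix inequality `X ⪰ μ I`. -/
def GeScalar {n : Type*} [DecidableEq n] (X : Matrix n n ℝ) (μ : ℝ) : Prop :=
  (X - μ • (1 : Matrix n n ℝ)).PosSemidef

/-- `X` is continuous and bounded on `[0, ∞)` and takes symmetric values there, with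
`X(t) ⪰ c I` for all `t ≥ 0`, for some constant `c > 0`. -/
structure IsWeight {n : Type*} [DecidableEq n] (X : ℝ → Matrix n n ℝ) : Prop where
  continuousOn : ContinuousOn X (Set.Ici 0)
  bounded : ∃ K : ℝ, ∀ t, 0 ≤ t → ∀ i j, |X t i j| ≤ K
  uniformlyPosDef : ∃ c : ℝ, 0 < c ∧ ∀ t, 0 ≤ t → GeScalar (X t) c

/-- `rᵀ ⊗ X` for a row `rᵀ`, the row index set `{*} × l` being identified with `l`. -/
def rowKron {l m n : Type*} (r : n → ℝ) (X : Matrix l m ℝ) : Matrix l (n × m) ℝ :=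
  (Matrix.replicateRow Unit r ⊗ₖ X).submatrix (fun i => ((), i)) id

/-- `c ⊗ X` for a column `c`, the column index set `{*} × m` being identified with `m`. -/
def colKron {l m n : Type*} (c : n → ℝ) (X : Matrix l m ℝ) : Matrix (n × l) m ℝ :=
  (Matrix.replicateCol Unit c ⊗ₖ X).submatrix id (fun j => ((), j))

/-! ### Linear time-varying systems on `[0, ∞)` -/

section LTV

variable {n m : Type*} [Fintype n] [DecidableEq n] [Fintype m] [DecidableEq m]

/-- `Φ(s, t)` is the state transition matrix of `A`:
`d/ds Φ(s, t) = A(s) Φ(s, t)` and `Φ(t, t) = I`. -/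
def IsStateTransition (A : ℝ → Matrix n n ℝ) (Φ : ℝ → ℝ → Matrix n n ℝ) : Prop :=
  ∀ t, 0 ≤ t → Φ t t = 1 ∧
    ∀ s, 0 ≤ s → HasMatDerivWithinAt (fun σ => Φ σ t) (A s * Φ s t) (Set.Ici 0) s

/-- The observability Gramian `W(t, t + δ)`. -/
def gramian (Φ : ℝ → ℝ → Matrix n n ℝ) (C : ℝ → Matrix m n ℝ) (t δ : ℝ) : Matrix n n ℝ :=
  (1 / δ) • matIntegral t (t + δ) fun s => (Φ s t)ᵀ * (C s)ᵀ * C s * Φ s t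

/-- Uniform observability of the pair `(A, C)`. -/
def UniformlyObservable (A : ℝ → Matrix n n ℝ) (C : ℝ → Matrix m n ℝ) : Prop :=
  ∃ Φ, IsStateTransition A Φ ∧
    ∃ δ μ : ℝ, 0 < δ ∧ 0 < μ ∧ ∀ t, 0 ≤ t → GeScalar (gramian Φ C t δ) μ

/-- `P` solves `Ṗ = A P + P Aᵀ - P Cᵀ D C P + V` on `[0, ∞)`. -/
def IsRiccatiSolution (A : ℝ → Matrix n n ℝ) (C : ℝ → Matrix m n ℝ) (D : ℝ → Matrix m m ℝ)
    (V P : ℝ → Matrix n n ℝ) : Prop :=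
  ∀ t, 0 ≤ t → HasMatDerivWithinAt P
    (A t * P t + P t * (A t)ᵀ - P t * (C t)ᵀ * D t * C t * P t + V t) (Set.Ici 0) t

/-- The vector field of the error system: `ẋ = A x - σ`, with innovation `σ = P Cᵀ D 𝐲` and
output `𝐲 = C x`. -/
def errorField (A : ℝ → Matrix n n ℝ) (C : ℝ → Matrix m n ℝ) (D : ℝ → Matrix m m ℝ)
    (P : ℝ → Matrix n n ℝ) (t : ℝ) (x : EuclideanSpace ℝ n) : EuclideanSpace ℝ n :=
  WithLp.toLp 2 (A t *ᵥ x.ofLp - (P t * (C t)ᵀ * D t) *ᵥ (C t *ᵥ x.ofLp))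

/-- The origin is a globally exponentially stable equilibrium of `ẋ = f(t, x)`, `t ≥ 0`
(uniformly in the initial time). -/
def GloballyExponentiallyStable (f : ℝ → EuclideanSpace ℝ n → EuclideanSpace ℝ n) : Prop :=
  (∀ t, 0 ≤ t → f t 0 = 0) ∧
  ∃ k c : ℝ, 0 < k ∧ 0 < c ∧ ∀ t₀, 0 ≤ t₀ → ∀ x : ℝ → EuclideanSpace ℝ n,
    (∀ t, t₀ ≤ t → HasDerivWithinAt x (f t (x t)) (Set.Ici t₀) t) →
    ∀ t, t₀ ≤ t → ‖x t‖ ≤ k * Real.exp (-c * (t - t₀)) * ‖x t₀‖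

end LTV

/-! ### Attitude kinematics and the matrices of the error system -/

/-- The skew-symmetric matrix `Ω×` of the cross product. -/
def skew (Ω : R3) : Matrix (Fin 3) (Fin 3) ℝ :=
  !![0, -Ω 2, Ω 1; Ω 2, 0, -Ω 0; -Ω 1, Ω 0, 0]

/-- `Q` takes values in `SO(3)` and `Q̇ = Q Ω×` on `[0, ∞)`. -/
def IsAttitude (Q : ℝ → Matrix (Fin 3) (Fin 3) ℝ) (Ω : ℝ → R3) : Prop :=
  ∀ t, 0 ≤ t → Q t ∈ Matrix.specialOrthogonalGroup (Fin 3) ℝ ∧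
    HasMatDerivWithinAt Q (Q t * skew (Ω t)) (Set.Ici 0) t

/-- The vector `t ↦ Q(t) v(t)`. -/
def rotate (Q : ℝ → Matrix (Fin 3) (Fin 3) ℝ) (v : ℝ → R3) (t : ℝ) : R3 :=
  WithLp.toLp 2 (Q t *ᵥ (v t).ofLp)

/-- `π_y = I₃ - y yᵀ`. -/
def proj (y : R3) : Matrix (Fin 3) (Fin 3) ℝ :=
  1 - Matrix.vecMulVec y.ofLp y.ofLp

/-- The matrix `Ā`, for the value `a` of the rotated target acceleration. -/
def Abar (a : R3) : Matrix (Fin 5) (Fin 5) ℝ :=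
  !![0, 1, 0, 0, 0;
     0, 0, -a 0, -a 1, -a 2;
     0, 0, 0, 0, 0;
     0, 0, 0, 0, 0;
     0, 0, 0, 0, 0]

/-- `A(t) = Ā(t) ⊗ I₃ - I₅ ⊗ Ω(t)×`. -/
def stateMatrix (az Ω : ℝ → R3) (t : ℝ) : Matrix Ix Ix ℝ :=
  Abar (az t) ⊗ₖ (1 : Matrix (Fin 3) (Fin 3) ℝ)
    - (1 : Matrix (Fin 5) (Fin 5) ℝ) ⊗ₖ skew (Ω t)

/-- `C(t) = [1 0 0 0 0] ⊗ π_{y(t)}`. -/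
def outputMatrix (y : ℝ → R3) (t : ℝ) : Matrix (Fin 3) Ix ℝ :=
  rowKron ![1, 0, 0, 0, 0] (proj (y t))

/-! ### The matrices of the excitation condition -/

/-- `Λ_T(s, t) = (∫ₜˢ (τ - s) az(τ)ᵀ dτ) ⊗ I₃`. -/
def LambdaT (az : ℝ → R3) (s t : ℝ) : Matrix (Fin 3) (Fin 3 × Fin 3) ℝ :=
  rowKron (fun j => ∫ τ in t..s, (τ - s) * az τ j) (1 : Matrix (Fin 3) (Fin 3) ℝ)

/-- `Λ_π(t, δ)`. -/
def LambdaPi (y₀ : ℝ → R3) (t δ : ℝ) : Matrix (Fin 2 × Fin 3) (Fin 2 × Fin 3) ℝ :=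
  matIntegral t (t + δ) fun s =>
    !![1, s - t; s - t, (s - t) ^ 2] ⊗ₖ proj (y₀ s)

/-- `B(t, δ)`. -/
def crossBlock (az y₀ : ℝ → R3) (t δ : ℝ) : Matrix (Fin 2 × Fin 3) (Fin 3 × Fin 3) ℝ :=
  matIntegral t (t + δ) fun s => colKron ![1, s - t] (proj (y₀ s) * LambdaT az s t)

/-- `ρ(t, δ) = Λ_π(t, δ)⁻¹ B(t, δ)`. -/
def rho (az y₀ : ℝ → R3) (t δ : ℝ) : Matrix (Fin 2 × Fin 3) (Fin 3 × Fin 3) ℝ :=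
  (LambdaPi y₀ t δ)⁻¹ * crossBlock az y₀ t δ

/-- `M(s, t) = π_{y₀(s)} (Λ_T(s, t) - [I₃  (s - t) I₃] ρ(t, δ))`. -/
def excitation (az y₀ : ℝ → R3) (δ s t : ℝ) : Matrix (Fin 3) (Fin 3 × Fin 3) ℝ :=
  proj (y₀ s) * (LambdaT az s t
    - rowKron ![1, s - t] (1 : Matrix (Fin 3) (Fin 3) ℝ) * rho az y₀ t δ)

end BearingObserver

end

open BearingObserver

/-!
The proof rests on a change of coordinates. The orthogonal matrix `T(t) = I₅ ⊗ Q_B(t)` (`frame`)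
removes the angular velocity: `T x` obeys the same kind of error system with state matrix
`F = Ā ⊗ I₃`, output direction `y₀ = Q_B y`, and the Riccati solution `T P Tᵀ`
(`IsRiccatiSolutionOn.conj`). Nothing is assumed about the regularity of `Ω`, but `F` is continuous
and bounded, and its transition matrix is explicit (`isTransition_rotated`): a state with blocks
`a`, `b`, `w` moves to the displacement `a + (s - t) b + Λ_T(s, t) w`, so that the quadratic form of
the observability Gramian is the integral of the square of the part of this displacement orthogonal
to `y₀`.

*Observability* (`exists_energy_lower`). The mean of `π_{y₀}` being bounded below does not bound
`Λ_π(t, δ)` below, since the bearing can follow a line `a + s b` during a whole window of length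
`δ`.
Two facts make up for this.
* Over a sufficiently long window, of length independent of `t`, the form of `Λ_π` is uniformly
  positive definite: at the beginning or at the end of it, a moving point on a line is so far from
  the origin that it looks almost fixed for a time `δ`, and fixed points are seen by the hypothesis
  (`BearingExcited.exists_line_lower`).
* Some subwindow of length `δ` has `Λ_π` nonsingular. Otherwise overlapping subwindows would each
  carry a line along the bearing; two such lines agree on the overlap and hence everywhere, so a
  single line would be along the bearing on the long window (`BearingExcited.exists_common_line`),
  against the first fact.

On the nonsingular subwindow `∫ MᵀM` is the Schur complement, the least energy over all lines for
given `w` (`excitation_le_energy`), so the energy controls `w`; the first fact then controls `a` and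
`b`.

*The Riccati equation.* Its solutions stay above a multiple of the identity, because `V` is positive
where the least eigenvalue would cross a small level (`IsRiccatiData.exists_lower_bound`). For upper
bounds, `ψᵀ P ψ` grows no faster than the running cost along every trajectory of the dual control
system `ψ' = -Fᵀ ψ + Cᵀ q` (`quadForm_le_add_cost`). The uncontrolled trajectories bound `P` on
bounded intervals, which gives global existence (`IsRiccatiData.exists_solution`); by observability
any vector is reached from `0` in bounded time at bounded cost, which bounds `P` uniformly
(`IsRiccatiData.exists_upper_bound`). With `p₁ I ≤ P ≤ p₂ I`, the function `xᵀ P⁻¹ x` is a Lyapunov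
function with exponential decay (`IsRiccatiData.exists_exponential_decay`), and `T` preserves the
Euclidean norm.
-/

/-! ### Global solutions of differential equations with an a priori bound -/

section GlobalODE

open Set Metric
open scoped NNReal

variable {E : Type*} [NormedAddCommGroup E] [NormedSpace ℝ E]

/-- The radial retraction of a normed space onto the closed ball of radius `R` about `0`. -/
noncomputable def radialRetraction (R : ℝ) (x : E) : E := (R / max R ‖x‖) • x

theorem radialRetraction_of_norm_le {R : ℝ} (hR : 0 < R) {x : E} (hx : ‖x‖ ≤ R) :
    radialRetraction R x = x := by
  simp [radialRetraction, max_eq_left hx, div_self hR.ne']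

theorem norm_radialRetraction_le {R : ℝ} (hR : 0 < R) (x : E) : ‖radialRetraction R x‖ ≤ R := by
  have h : 0 < max R ‖x‖ := lt_max_of_lt_left hR
  rw [radialRetraction, norm_smul, Real.norm_of_nonneg (by positivity), div_mul_eq_mul_div,
    div_le_iff₀ h]
  exact mul_le_mul_of_nonneg_left (le_max_right _ _) hR.le

/-- In a general normed space the radial retraction is only `2`-Lipschitz. -/
theorem norm_radialRetraction_sub_le {R : ℝ} (hR : 0 < R) (x y : E) :
    ‖radialRetraction R x - radialRetraction R y‖ ≤ 2 * ‖x - y‖ := by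
  have hx : 0 < max R ‖x‖ := lt_max_of_lt_left hR
  have hy : 0 < max R ‖y‖ := lt_max_of_lt_left hR
  have e : radialRetraction R x - radialRetraction R y
      = (R / max R ‖x‖) • (x - y) + (R / max R ‖x‖ - R / max R ‖y‖) • y := by
    simp only [radialRetraction, smul_sub, sub_smul]; abel
  have h1 : ‖(R / max R ‖x‖) • (x - y)‖ ≤ ‖x - y‖ := by
    rw [norm_smul, Real.norm_of_nonneg (by positivity)]
    exact mul_le_of_le_one_left (norm_nonneg _) ((div_le_one hx).2 (le_max_left _ _))
  have h2 : ‖(R / max R ‖x‖ - R / max R ‖y‖) • y‖ ≤ ‖x - y‖ := by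
    have e2 : R / max R ‖x‖ - R / max R ‖y‖
        = (R / max R ‖x‖) * ((max R ‖y‖ - max R ‖x‖) / max R ‖y‖) := by
      field_simp
    have h3 : |max R ‖y‖ - max R ‖x‖| ≤ ‖x - y‖ := by
      refine (abs_max_sub_max_le_max _ _ _ _).trans ?_
      simp only [sub_self, abs_zero, abs_nonneg, sup_of_le_right]
      rw [norm_sub_rev]; exact abs_norm_sub_norm_le _ _
    rw [norm_smul, e2, norm_mul, norm_div (_ - _),
      Real.norm_of_nonneg (by positivity : 0 ≤ R / max R ‖x‖),
      Real.norm_of_nonneg hy.le, Real.norm_eq_abs]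
    calc R / max R ‖x‖ * (|max R ‖y‖ - max R ‖x‖| / max R ‖y‖) * ‖y‖
        = (R / max R ‖x‖) * (‖y‖ / max R ‖y‖) * |max R ‖y‖ - max R ‖x‖| := by ring
      _ ≤ 1 * |max R ‖y‖ - max R ‖x‖| := by
          refine mul_le_mul_of_nonneg_right ?_ (abs_nonneg _)
          exact mul_le_one₀ ((div_le_one hx).2 (le_max_left _ _)) (by positivity)
            ((div_le_one hy).2 (le_max_right _ _))
      _ ≤ ‖x - y‖ := by rw [one_mul]; exact h3
  rw [e]
  linarith [norm_add_le ((R / max R ‖x‖) • (x - y)) ((R / max R ‖x‖ - R / max R ‖y‖) • y)]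

variable {f : ℝ → E → E}

/-- Two solutions of `ẋ = f(t, x)` on `[0, T]` with the same initial value agree, when `f` is
Lipschitz on bounded sets uniformly over bounded time. -/
theorem eqOn_Icc_of_locallyLipschitz
    (hlip : ∀ T R : ℝ, ∃ K : ℝ≥0, ∀ t ∈ Icc 0 T, LipschitzOnWith K (f t) (closedBall 0 R))
    {T : ℝ} {x y : ℝ → E}
    (hx : ∀ t ∈ Icc 0 T, HasDerivWithinAt x (f t (x t)) (Icc 0 T) t)
    (hy : ∀ t ∈ Icc 0 T, HasDerivWithinAt y (f t (y t)) (Icc 0 T) t)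
    (h0 : x 0 = y 0) : EqOn x y (Icc 0 T) := by
  have cx : ContinuousOn x (Icc 0 T) := fun t ht => (hx t ht).continuousWithinAt
  have cy : ContinuousOn y (Icc 0 T) := fun t ht => (hy t ht).continuousWithinAt
  obtain ⟨Rx, hRx⟩ := isCompact_Icc.exists_bound_of_continuousOn cx
  obtain ⟨Ry, hRy⟩ := isCompact_Icc.exists_bound_of_continuousOn cy
  obtain ⟨K, hK⟩ := hlip T (max Rx Ry)
  refine ODE_solution_unique_of_mem_Icc_right (v := f) (s := fun _ => closedBall 0 (max Rx Ry))
    (K := K) (fun t ht => hK t (Ico_subset_Icc_self ht)) cx (fun t ht => ?_) (fun t ht => ?_)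
    cy (fun t ht => ?_) (fun t ht => ?_) h0
  · exact (hx t (Ico_subset_Icc_self ht)).mono_of_mem_nhdsWithin
      (Icc_mem_nhdsGE_of_mem ht)
  · simpa using Or.inl (hRx t (Ico_subset_Icc_self ht))
  · exact (hy t (Ico_subset_Icc_self ht)).mono_of_mem_nhdsWithin
      (Icc_mem_nhdsGE_of_mem ht)
  · simpa using Or.inr (hRy t (Ico_subset_Icc_self ht))

/-- A solution on `[0, T]` exists if every solution on a shorter interval `[0, τ]` with the given
initial value ends in the ball of radius `R`. The Picard–Lindelöf theorem is applied to the
field truncated outside this ball, whose solution never leaves the ball. -/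
theorem exists_solution_Icc_of_bound [CompleteSpace E]
    (hlip : ∀ T R : ℝ, ∃ K : ℝ≥0, ∀ t ∈ Icc 0 T, LipschitzOnWith K (f t) (closedBall 0 R))
    (hcont : ∀ x, ContinuousOn (fun t => f t x) (Ici 0)) {T : ℝ} (hT : 0 ≤ T) (x₀ : E) {R : ℝ}
    (hbound : ∀ τ ∈ Icc 0 T, ∀ x : ℝ → E, x 0 = x₀ →
      (∀ t ∈ Icc 0 τ, HasDerivWithinAt x (f t (x t)) (Icc 0 τ) t) → ‖x τ‖ < R) :
    ∃ x : ℝ → E, x 0 = x₀ ∧ ∀ t ∈ Icc 0 T, HasDerivWithinAt x (f t (x t)) (Icc 0 T) t := by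
  have hx₀ : ‖x₀‖ < R := by
    refine hbound 0 ⟨le_rfl, hT⟩ (fun _ => x₀) rfl fun t _ => ?_
    rw [Icc_self]
    exact hasDerivWithinAt_iff_hasFDerivWithinAt.2
      (HasFDerivWithinAt.of_finite (finite_singleton (0 : ℝ)))
  have hR : 0 < R := (norm_nonneg _).trans_lt hx₀
  obtain ⟨K, hK⟩ := hlip T R
  obtain ⟨M, hM⟩ := isCompact_Icc.exists_bound_of_continuousOn
    ((hcont 0).mono (Icc_subset_Ici_self : Icc 0 T ⊆ Ici 0))
  have hM0 : 0 ≤ M := (norm_nonneg _).trans (hM 0 ⟨le_rfl, hT⟩)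
  have hmem : ∀ x : E, radialRetraction R x ∈ closedBall (0 : E) R := fun x => by
    simpa using norm_radialRetraction_le hR x
  have hL : ∀ t ∈ Icc 0 T, ∀ x, ‖f t (radialRetraction R x)‖ ≤ M + K * R := fun t ht x => by
    have h1 := (hK t ht).norm_sub_le (hmem x) (mem_closedBall_self hR.le)
    rw [sub_zero] at h1
    have h2 := norm_radialRetraction_le hR x
    have h3 : (K : ℝ) * ‖radialRetraction R x‖ ≤ K * R := by gcongr
    have h4 := norm_le_norm_sub_add (f t (radialRetraction R x)) (f t 0)
    linarith [hM t ht]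
  have hPL : IsPicardLindelof (fun t x => f t (radialRetraction R x))
      (⟨0, le_rfl, hT⟩ : Icc (0 : ℝ) T) x₀ (Real.toNNReal ((M + K * R) * T)) 0
      (Real.toNNReal (M + K * R)) (K * 2) := by
    refine ⟨fun t ht => ?_, fun x _ => ?_, fun t ht x _ => ?_, ?_⟩
    · refine LipschitzOnWith.of_dist_le_mul fun x _ y _ => ?_
      rw [dist_eq_norm, dist_eq_norm]
      have h1 := (hK t ht).norm_sub_le (hmem x) (hmem y)
      have h2 := mul_le_mul_of_nonneg_left (norm_radialRetraction_sub_le hR x y) K.coe_nonneg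
      push_cast
      exact h1.trans (h2.trans (le_of_eq (by ring)))
    · exact (hcont _).mono Icc_subset_Ici_self
    · exact (hL t ht x).trans (Real.le_coe_toNNReal _)
    · rw [Real.coe_toNNReal _ (by positivity), Real.coe_toNNReal _ (by positivity)]
      simp [hT]
  obtain ⟨x, hx0, hx⟩ := hPL.exists_eq_forall_mem_Icc_hasDerivWithinAt₀
  simp only at hx0
  have cx : ContinuousOn x (Icc 0 T) := fun t ht => (hx t ht).continuousWithinAt
  have hin : ∀ t ∈ Icc 0 T, ‖x t‖ < R := by
    by_contra! hcon
    -- the first time `τ` at which the truncated solution reaches the sphere of radius `R`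
    have hclosed : IsClosed (Icc 0 T ∩ (fun t => ‖x t‖) ⁻¹' Ici R) :=
      cx.norm.preimage_isClosed_of_isClosed isClosed_Icc isClosed_Ici
    have hcomp : IsCompact (Icc 0 T ∩ (fun t => ‖x t‖) ⁻¹' Ici R) :=
      isCompact_Icc.of_isClosed_subset hclosed inter_subset_left
    obtain ⟨t₁, ht₁, ht₁'⟩ := hcon
    obtain ⟨τ, ⟨hτ, hτR⟩, hτmin⟩ := hcomp.exists_isLeast ⟨t₁, ht₁, ht₁'⟩
    have hsub : Icc 0 τ ⊆ Icc 0 T := Icc_subset_Icc_right hτ.2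
    have hlt : ∀ t ∈ Ico 0 τ, ‖x t‖ ≤ R := fun t ht => by
      by_contra! h
      exact absurd (hτmin ⟨⟨ht.1, ht.2.le.trans hτ.2⟩, h.le⟩) (not_le.2 ht.2)
    have hτ0 : 0 < τ := by
      rcases hτ.1.eq_or_lt with h | h
      · rw [← h] at hτR
        simp only [mem_preimage, mem_Ici, hx0] at hτR
        linarith
      · exact h
    have hle : ∀ t ∈ Icc 0 τ, ‖x t‖ ≤ R := fun t ht => by
      have h1 : t ∈ closure (Ico 0 τ) := by rwa [closure_Ico hτ0.ne]
      have h2 : ContinuousOn (fun t => ‖x t‖) (closure (Ico 0 τ)) := by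
        rw [closure_Ico hτ0.ne]; exact (cx.mono hsub).norm
      exact (isClosed_Iic (a := R)).closure_subset_iff.2 (image_subset_iff.2 hlt)
        (h2.image_closure ⟨t, h1, rfl⟩)
    have := hbound τ hτ x hx0 fun t ht => by
      have := (hx t (hsub ht)).mono hsub
      rwa [radialRetraction_of_norm_le hR (hle t ht)] at this
    exact absurd hτR (not_le.2 this)
  refine ⟨x, hx0, fun t ht => ?_⟩
  have := hx t ht
  rwa [radialRetraction_of_norm_le hR (hin t ht).le] at this

/-- **Global existence from an a priori bound.** -/
theorem exists_solution_Ici_of_bound [CompleteSpace E]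
    (hlip : ∀ T R : ℝ, ∃ K : ℝ≥0, ∀ t ∈ Icc 0 T, LipschitzOnWith K (f t) (closedBall 0 R))
    (hcont : ∀ x, ContinuousOn (fun t => f t x) (Ici 0)) (x₀ : E)
    (hbound : ∀ T, 0 ≤ T → ∃ R : ℝ, ∀ τ ∈ Icc 0 T, ∀ x : ℝ → E, x 0 = x₀ →
      (∀ t ∈ Icc 0 τ, HasDerivWithinAt x (f t (x t)) (Icc 0 τ) t) → ‖x τ‖ < R) :
    ∃ x : ℝ → E, x 0 = x₀ ∧ ∀ t ∈ Ici (0 : ℝ), HasDerivWithinAt x (f t (x t)) (Ici 0) t := by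
  have hex : ∀ N : ℕ, ∃ x : ℝ → E, x 0 = x₀ ∧
      ∀ t ∈ Icc 0 (N : ℝ), HasDerivWithinAt x (f t (x t)) (Icc 0 (N : ℝ)) t := fun N => by
    obtain ⟨R, hR⟩ := hbound N N.cast_nonneg
    exact exists_solution_Icc_of_bound hlip hcont N.cast_nonneg x₀ hR
  choose X hX0 hX using hex
  have hagree : ∀ {N N' : ℕ}, N ≤ N' → ∀ t ∈ Icc 0 (N : ℝ), X N t = X N' t := fun {N N'} h => by
    have hsub : Icc 0 (N : ℝ) ⊆ Icc 0 (N' : ℝ) := Icc_subset_Icc_right (by exact_mod_cast h)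
    exact eqOn_Icc_of_locallyLipschitz hlip (hX N) (fun t ht => (hX N' t (hsub ht)).mono hsub)
      ((hX0 N).trans (hX0 N').symm)
  have hval : ∀ (N : ℕ), ∀ t ∈ Icc 0 (N : ℝ), X ⌈t⌉₊ t = X N t := fun N t ht =>
    hagree (Nat.ceil_le.2 ht.2) t ⟨ht.1, Nat.le_ceil t⟩
  refine ⟨fun t => X ⌈t⌉₊ t, by simp [hX0], fun t ht => ?_⟩
  obtain ⟨N, hN⟩ := exists_nat_gt t
  have h1 := hX N t ⟨ht, hN.le⟩
  rw [← hval N t ⟨ht, hN.le⟩] at h1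
  refine (h1.congr (hval N) (hval N t ⟨ht, hN.le⟩)).mono_of_mem_nhdsWithin ?_
  rw [← Ici_inter_Iic]
  exact inter_mem_nhdsWithin _ (Iic_mem_nhds hN)

end GlobalODE

/-! ### Entrywise calculus of matrix functions -/

namespace BearingObserver

open Set

section MatrixCalculus

variable {l m n : Type*} {s : Set ℝ} {t : ℝ}

theorem HasMatDerivWithinAt.congr_deriv {X : ℝ → Matrix m n ℝ} {X' X'' : Matrix m n ℝ}
    (hX : HasMatDerivWithinAt X X' s t) (h : X' = X'') : HasMatDerivWithinAt X X'' s t := h ▸ hX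

theorem HasMatDerivWithinAt.mono {X : ℝ → Matrix m n ℝ} {X' : Matrix m n ℝ} {s' : Set ℝ}
    (hX : HasMatDerivWithinAt X X' s t) (h : s' ⊆ s) : HasMatDerivWithinAt X X' s' t :=
  fun i j => (hX i j).mono h

theorem HasMatDerivWithinAt.transpose {X : ℝ → Matrix m n ℝ} {X' : Matrix m n ℝ}
    (hX : HasMatDerivWithinAt X X' s t) : HasMatDerivWithinAt (fun τ => (X τ)ᵀ) X'ᵀ s t :=
  fun i j => hX j i

theorem HasMatDerivWithinAt.mul [Fintype m] {X : ℝ → Matrix l m ℝ} {Y : ℝ → Matrix m n ℝ}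
    {X' : Matrix l m ℝ} {Y' : Matrix m n ℝ} (hX : HasMatDerivWithinAt X X' s t)
    (hY : HasMatDerivWithinAt Y Y' s t) :
    HasMatDerivWithinAt (fun τ => X τ * Y τ) (X' * Y t + X t * Y') s t := fun i j => by
  simp only [Matrix.mul_apply, Matrix.add_apply, ← Finset.sum_add_distrib]
  exact HasDerivWithinAt.fun_sum fun k _ => (hX i k).mul (hY k j)

theorem HasMatDerivWithinAt.mul_const [Fintype m] {X : ℝ → Matrix l m ℝ} {X' : Matrix l m ℝ}
    (hX : HasMatDerivWithinAt X X' s t) (Y : Matrix m n ℝ) :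
    HasMatDerivWithinAt (fun τ => X τ * Y) (X' * Y) s t := fun i j => by
  simp only [Matrix.mul_apply]
  exact HasDerivWithinAt.fun_sum fun k _ => (hX i k).mul_const _

theorem HasMatDerivWithinAt.mulVec [Fintype m] [Fintype l] {X : ℝ → Matrix l m ℝ} {v : ℝ → m → ℝ}
    {X' : Matrix l m ℝ} {v' : m → ℝ} (hX : HasMatDerivWithinAt X X' s t)
    (hv : HasDerivWithinAt v v' s t) :
    HasDerivWithinAt (fun τ => X τ *ᵥ v τ) (X' *ᵥ v t + X t *ᵥ v') s t := by
  rw [hasDerivWithinAt_pi] at hv ⊢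
  intro i
  simp only [Matrix.mulVec, dotProduct, Pi.add_apply, ← Finset.sum_add_distrib]
  exact HasDerivWithinAt.fun_sum fun k _ => (hX i k).mul (hv k)

theorem _root_.HasDerivWithinAt.dotProduct [Fintype m] {u v : ℝ → m → ℝ} {u' v' : m → ℝ}
    (hu : HasDerivWithinAt u u' s t) (hv : HasDerivWithinAt v v' s t) :
    HasDerivWithinAt (fun τ => u τ ⬝ᵥ v τ) (u' ⬝ᵥ v t + u t ⬝ᵥ v') s t := by
  rw [hasDerivWithinAt_pi] at hu hv
  simp only [_root_.dotProduct, ← Finset.sum_add_distrib]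
  exact HasDerivWithinAt.fun_sum fun k _ => (hu k).mul (hv k)

theorem continuousOn_of_hasMatDerivWithinAt {X X' : ℝ → Matrix m n ℝ}
    (h : ∀ t ∈ s, HasMatDerivWithinAt X (X' t) s t) : ContinuousOn X s :=
  (continuousOn_pi (f := X)).2 fun i => continuousOn_pi.2 fun j t ht =>
    (h t ht i j).continuousWithinAt

end MatrixCalculus

section MatrixContinuity

variable {l m n α : Type*} [TopologicalSpace α] {s : Set α}

theorem continuousOn_matrix {X : α → Matrix m n ℝ} :
    ContinuousOn X s ↔ ∀ i j, ContinuousOn (fun t => X t i j) s := by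
  exact (continuousOn_pi (f := fun t i j => X t i j)).trans
    (forall_congr' fun i => continuousOn_pi (f := fun t j => X t i j))

theorem _root_.ContinuousOn.matrix_mul [Fintype m] {X : α → Matrix l m ℝ} {Y : α → Matrix m n ℝ}
    (hX : ContinuousOn X s) (hY : ContinuousOn Y s) : ContinuousOn (fun t => X t * Y t) s := by
  rw [continuousOn_iff_continuous_domRestrict] at *
  exact hX.matrix_mul hY

theorem _root_.ContinuousOn.matrix_transpose {X : α → Matrix l m ℝ}
    (hX : ContinuousOn X s) : ContinuousOn (fun t => (X t)ᵀ) s := by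
  rw [continuousOn_iff_continuous_domRestrict] at *
  exact hX.matrix_transpose

theorem _root_.ContinuousOn.matrix_mulVec [Fintype m] {X : α → Matrix l m ℝ} {v : α → m → ℝ}
    (hX : ContinuousOn X s) (hv : ContinuousOn v s) : ContinuousOn (fun t => X t *ᵥ v t) s := by
  rw [continuousOn_iff_continuous_domRestrict] at *
  exact hX.matrix_mulVec hv

theorem _root_.ContinuousOn.dotProduct [Fintype m] {u v : α → m → ℝ}
    (hu : ContinuousOn u s) (hv : ContinuousOn v s) : ContinuousOn (fun t => u t ⬝ᵥ v t) s := by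
  rw [continuousOn_iff_continuous_domRestrict] at *
  exact hu.dotProduct hv

end MatrixContinuity

/-! ### Quadratic forms -/

section QuadraticForms

variable {l m n : Type*} [Fintype l] [Fintype m] [Fintype n]

/-- The entries of `X(t)`, `t ≥ 0`, are bounded uniformly in `t`. -/
def EntriesBounded {m n : Type*} (X : ℝ → Matrix m n ℝ) : Prop :=
  ∃ K : ℝ, ∀ t, 0 ≤ t → ∀ i j, |X t i j| ≤ K

theorem EntriesBounded.transpose {m n : Type*} {X : ℝ → Matrix m n ℝ} (hX : EntriesBounded X) :
    EntriesBounded fun t => (X t)ᵀ := hX.imp fun _ h t ht i j => h t ht j i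

theorem abs_mul_apply_le {l m n : Type*} [Fintype m] {X : Matrix l m ℝ} {Y : Matrix m n ℝ}
    {K K' : ℝ}
    (hX : ∀ i j, |X i j| ≤ K) (hY : ∀ i j, |Y i j| ≤ K') (i : l) (j : n) :
    |(X * Y) i j| ≤ Fintype.card m * (|K| * |K'|) := by
  rw [Matrix.mul_apply]
  refine (Finset.abs_sum_le_sum_abs _ _).trans ?_
  refine (Finset.sum_le_sum fun k _ => ?_ : _ ≤ ∑ _k : m, |K| * |K'|).trans (by simp)
  rw [abs_mul]
  exact mul_le_mul ((hX i k).trans (le_abs_self _)) ((hY k j).trans (le_abs_self _))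
    (abs_nonneg _) (abs_nonneg _)

theorem EntriesBounded.mul {l m n : Type*} [Fintype m] {X : ℝ → Matrix l m ℝ}
    {Y : ℝ → Matrix m n ℝ} (hX : EntriesBounded X)
    (hY : EntriesBounded Y) : EntriesBounded fun t => X t * Y t := by
  obtain ⟨K, hK⟩ := hX
  obtain ⟨K', hK'⟩ := hY
  exact ⟨_, fun t ht => abs_mul_apply_le (hK t ht) (hK' t ht)⟩

theorem dotProduct_self_nonneg' (v : n → ℝ) : 0 ≤ v ⬝ᵥ v :=
  Finset.sum_nonneg fun i _ => mul_self_nonneg (v i)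

theorem dotProduct_self_pos {v : n → ℝ} (hv : v ≠ 0) : 0 < v ⬝ᵥ v :=
  (dotProduct_self_nonneg' v).lt_of_ne fun h => hv (dotProduct_self_eq_zero.1 h.symm)

theorem dotProduct_sq_le (u v : n → ℝ) : (u ⬝ᵥ v) ^ 2 ≤ (u ⬝ᵥ u) * (v ⬝ᵥ v) := by
  simpa only [dotProduct, pow_two] using Finset.sum_mul_sq_le_sq_mul_sq Finset.univ u v

theorem two_mul_dotProduct_le {a : ℝ} (ha : 0 < a) (u v : n → ℝ) :
    2 * (u ⬝ᵥ v) ≤ a * (u ⬝ᵥ u) + (v ⬝ᵥ v) / a := by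
  have h := dotProduct_self_nonneg' (a • u - v)
  simp only [sub_dotProduct, dotProduct_sub, smul_dotProduct, dotProduct_smul, smul_eq_mul,
    dotProduct_comm v u] at h
  rw [← sub_nonneg]
  have : a * (u ⬝ᵥ u) + v ⬝ᵥ v / a - 2 * u ⬝ᵥ v
      = (a * (a * u ⬝ᵥ u) - a * u ⬝ᵥ v - (a * u ⬝ᵥ v - v ⬝ᵥ v)) / a := by
    field_simp; ring
  rw [this]; exact div_nonneg (by linarith) ha.le

theorem dotProduct_add_self_le (u v : n → ℝ) :
    (u + v) ⬝ᵥ (u + v) ≤ 2 * (u ⬝ᵥ u) + 2 * (v ⬝ᵥ v) := by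
  have h := dotProduct_self_nonneg' (u - v)
  simp only [sub_dotProduct, dotProduct_sub, add_dotProduct, dotProduct_add,
    dotProduct_comm v u] at h ⊢
  linarith

/-- A matrix with bounded entries is a bounded operator. -/
theorem mulVec_dotProduct_self_le {X : Matrix m n ℝ} {K : ℝ} (hX : ∀ i j, |X i j| ≤ K)
    (v : n → ℝ) :
    (X *ᵥ v) ⬝ᵥ (X *ᵥ v) ≤ (Fintype.card m * Fintype.card n * K ^ 2) * (v ⬝ᵥ v) := by
  have h : ∀ i, (X *ᵥ v) i * (X *ᵥ v) i ≤ Fintype.card n * K ^ 2 * (v ⬝ᵥ v) := fun i => by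
    have h1 := dotProduct_sq_le (X i) v
    have h2 : X i ⬝ᵥ X i ≤ Fintype.card n * K ^ 2 := by
      refine (Finset.sum_le_sum fun k _ => ?_ : _ ≤ ∑ _k : n, K ^ 2).trans (by simp)
      rw [← pow_two]
      exact sq_le_sq' (by linarith [neg_abs_le (X i k), hX i k]) ((le_abs_self _).trans (hX i k))
    rw [← pow_two]
    exact h1.trans (mul_le_mul_of_nonneg_right h2 (dotProduct_self_nonneg' v))
  refine (Finset.sum_le_sum fun i _ => h i : _ ≤ ∑ _i : m, _).trans (le_of_eq ?_)
  simp only [Finset.sum_const, Finset.card_univ, nsmul_eq_mul]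
  ring

theorem EntriesBounded.mulVec_le {X : ℝ → Matrix m n ℝ} (hX : EntriesBounded X) :
    ∃ K : ℝ, 0 < K ∧ ∀ t, 0 ≤ t → ∀ v, (X t *ᵥ v) ⬝ᵥ (X t *ᵥ v) ≤ K * (v ⬝ᵥ v) := by
  obtain ⟨K, hK⟩ := hX
  refine ⟨Fintype.card m * Fintype.card n * K ^ 2 + 1, by positivity, fun t ht v => ?_⟩
  refine (mulVec_dotProduct_self_le (hK t ht) v).trans ?_
  exact mul_le_mul_of_nonneg_right (by linarith) (dotProduct_self_nonneg' v)

theorem EntriesBounded.abs_quadForm_le {X : ℝ → Matrix n n ℝ} (hX : EntriesBounded X) :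
    ∃ K : ℝ, 0 < K ∧ ∀ t, 0 ≤ t → ∀ v, |v ⬝ᵥ X t *ᵥ v| ≤ K * (v ⬝ᵥ v) := by
  obtain ⟨K, hK, h⟩ := hX.mulVec_le
  refine ⟨K + 1, by positivity, fun t ht v => ?_⟩
  have h1 := two_mul_dotProduct_le one_pos v (X t *ᵥ v)
  have h2 := two_mul_dotProduct_le one_pos (-v) (X t *ᵥ v)
  simp only [neg_dotProduct, dotProduct_neg, neg_neg] at h2
  have h3 := h t ht v
  have h4 := dotProduct_self_nonneg' v
  have h5 : 0 ≤ K * (v ⬝ᵥ v) := by positivity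
  rw [abs_le]
  constructor <;> linarith

theorem geScalar_iff [DecidableEq n] {X : Matrix n n ℝ} {c : ℝ} :
    GeScalar X c ↔ X.IsSymm ∧ ∀ v, c * (v ⬝ᵥ v) ≤ v ⬝ᵥ X *ᵥ v := by
  rw [GeScalar, Matrix.posSemidef_iff_dotProduct_mulVec]
  refine and_congr ?_ (forall_congr' fun v => ?_)
  · rw [Matrix.isHermitian_iff_isSymm]
    constructor
    · intro h
      have := h.add (Matrix.isSymm_one.smul c)
      rwa [sub_add_cancel] at this
    · intro h
      exact h.sub (Matrix.isSymm_one.smul c)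
  · simp [Matrix.sub_mulVec, Matrix.smul_mulVec, dotProduct_sub]

theorem dotProduct_mulVec_comm_of_isSymm {X : Matrix n n ℝ} (hX : X.IsSymm) (u v : n → ℝ) :
    u ⬝ᵥ X *ᵥ v = v ⬝ᵥ X *ᵥ u := by
  rw [Matrix.dotProduct_mulVec, ← Matrix.mulVec_transpose, hX.eq, dotProduct_comm]

theorem dotProduct_mulVec_of_isSymm {X : Matrix n n ℝ} (hX : X.IsSymm) (u v : n → ℝ) :
    u ⬝ᵥ X *ᵥ v = (X *ᵥ u) ⬝ᵥ v := by
  rw [dotProduct_mulVec_comm_of_isSymm hX, dotProduct_comm]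

theorem dotProduct_transpose_mulVec (X : Matrix m n ℝ) (u : n → ℝ) (v : m → ℝ) :
    u ⬝ᵥ Xᵀ *ᵥ v = (X *ᵥ u) ⬝ᵥ v := by
  rw [Matrix.dotProduct_mulVec, Matrix.vecMul_transpose]

theorem isCompact_unitSphere : IsCompact {v : n → ℝ | v ⬝ᵥ v = 1} := by
  refine Metric.isCompact_of_isClosed_isBounded
    (isClosed_eq (continuous_id.dotProduct continuous_id) continuous_const) ?_
  refine (Metric.isBounded_closedBall (x := (0 : n → ℝ)) (r := 1)).subset fun v hv => ?_
  rw [mem_closedBall_zero_iff, pi_norm_le_iff_of_nonneg zero_le_one]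
  intro i
  rw [Real.norm_eq_abs, ← sq_le_one_iff_abs_le_one, ← (hv : v ⬝ᵥ v = 1), pow_two]
  exact Finset.single_le_sum (f := fun i => v i * v i) (fun i _ => mul_self_nonneg _)
    (Finset.mem_univ i)

/-- A quadratic form bounded below on the unit sphere is bounded below by homogeneity. -/
theorem le_quadForm_of_unitSphere {X : Matrix n n ℝ} {c : ℝ}
    (h : ∀ v, v ⬝ᵥ v = 1 → c ≤ v ⬝ᵥ X *ᵥ v) (v : n → ℝ) : c * (v ⬝ᵥ v) ≤ v ⬝ᵥ X *ᵥ v := by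
  rcases eq_or_ne v 0 with rfl | hv
  · simp
  have hpos := dotProduct_self_pos hv
  have hr : √(v ⬝ᵥ v) ^ 2 = v ⬝ᵥ v := Real.sq_sqrt hpos.le
  have hr0 : 0 < √(v ⬝ᵥ v) := Real.sqrt_pos.2 hpos
  have h1 := h ((√(v ⬝ᵥ v))⁻¹ • v) (by
    simp only [smul_dotProduct, dotProduct_smul, smul_eq_mul]
    rw [← mul_assoc, ← mul_inv, ← pow_two, hr, inv_mul_cancel₀ hpos.ne'])
  simp only [Matrix.mulVec_smul, smul_dotProduct, dotProduct_smul, smul_eq_mul] at h1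
  rw [← mul_assoc, ← mul_inv, ← pow_two, hr] at h1
  calc c * (v ⬝ᵥ v) ≤ ((v ⬝ᵥ v)⁻¹ * (v ⬝ᵥ X *ᵥ v)) * (v ⬝ᵥ v) := by gcongr
    _ = v ⬝ᵥ X *ᵥ v := by field_simp

theorem exists_pos_le_of_forall_pos {X : Matrix n n ℝ} (hX : ∀ v, v ≠ 0 → 0 < v ⬝ᵥ X *ᵥ v) :
    ∃ c : ℝ, 0 < c ∧ ∀ v, c * (v ⬝ᵥ v) ≤ v ⬝ᵥ X *ᵥ v := by
  rcases ({v : n → ℝ | v ⬝ᵥ v = 1}).eq_empty_or_nonempty with h | h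
  · exact ⟨1, one_pos, le_quadForm_of_unitSphere fun v hv => absurd hv (by
      simpa using (Set.eq_empty_iff_forall_notMem.1 h v))⟩
  · have hc : Continuous fun v : n → ℝ => v ⬝ᵥ X *ᵥ v :=
      continuous_id.dotProduct (continuous_const.matrix_mulVec continuous_id)
    obtain ⟨u, hu, hmin⟩ := isCompact_unitSphere.exists_isMinOn h hc.continuousOn
    refine ⟨u ⬝ᵥ X *ᵥ u, hX u ?_, le_quadForm_of_unitSphere fun v hv => hmin hv⟩
    rintro rfl
    simp at hu

theorem exists_pos_le_of_posDef {X : Matrix n n ℝ} (hX : X.PosDef) :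
    ∃ c : ℝ, 0 < c ∧ ∀ v, c * (v ⬝ᵥ v) ≤ v ⬝ᵥ X *ᵥ v :=
  exists_pos_le_of_forall_pos fun v hv => by simpa using hX.dotProduct_mulVec_pos hv

/-- If `0 ≤ X ≤ p I` then `X² ≤ p X`. -/
theorem mulVec_dotProduct_self_le_of_quadForm_le {X : Matrix n n ℝ} (hX : X.IsSymm) {p : ℝ}
    (h0 : ∀ v, 0 ≤ v ⬝ᵥ X *ᵥ v) (hp : ∀ v, v ⬝ᵥ X *ᵥ v ≤ p * (v ⬝ᵥ v)) (v : n → ℝ) :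
    (X *ᵥ v) ⬝ᵥ (X *ᵥ v) ≤ p * (v ⬝ᵥ X *ᵥ v) := by
  set w := X *ᵥ v with hw
  -- nonnegativity of the form at `a v - b w`
  have key : ∀ a b : ℝ, 0 ≤ a ^ 2 * (v ⬝ᵥ w) - 2 * a * b * (w ⬝ᵥ w) + b ^ 2 * (p * (w ⬝ᵥ w)) :=
    fun a b => by
      have h1 := h0 (a • v - b • w)
      simp only [Matrix.mulVec_sub, Matrix.mulVec_smul, sub_dotProduct, dotProduct_sub,
        smul_dotProduct, dotProduct_smul, smul_eq_mul, ← hw] at h1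
      rw [dotProduct_mulVec_comm_of_isSymm hX v w, ← hw] at h1
      nlinarith [mul_le_mul_of_nonneg_left (hp w) (sq_nonneg b)]
  have hww := dotProduct_self_nonneg' w
  rcases hww.eq_or_lt with h | h
  · have : w = 0 := dotProduct_self_eq_zero.1 h.symm
    simp [this]
  have h2 := key p 1
  have hp0 : 0 ≤ p := by
    by_contra hneg
    push Not at hneg
    nlinarith [h0 w, hp w, mul_neg_of_neg_of_pos hneg h]
  rcases hp0.eq_or_lt with h3 | h3
  · have h4 := key 1 (v ⬝ᵥ w + 1)
    have h5 := h0 v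
    rw [← hw] at h5
    rw [← h3] at h4 ⊢
    have h6 := hp v
    rw [← hw, ← h3] at h6
    nlinarith
  · nlinarith

end QuadraticForms

open scoped NNReal

/-! ### The Riccati equation: well-posedness and symmetry -/

section RiccatiWellPosed

variable {n : Type*} [Fintype n]

/-- The right-hand side `F P + P Fᵀ - P S P + W` of the Riccati equation. -/
def riccatiField (F S W : ℝ → Matrix n n ℝ) (t : ℝ) (P : Matrix n n ℝ) : Matrix n n ℝ :=
  F t * P + P * (F t)ᵀ - P * S t * P + W t

/-- The coefficients of the Riccati equation are continuous and bounded on `[0, ∞)`, `S` and `W`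
are symmetric, `S` is positive semidefinite and `W` uniformly positive definite. -/
structure IsRiccatiData (F S W : ℝ → Matrix n n ℝ) : Prop where
  continuousOn_F : ContinuousOn F (Ici 0)
  continuousOn_S : ContinuousOn S (Ici 0)
  continuousOn_W : ContinuousOn W (Ici 0)
  bounded_F : EntriesBounded F
  bounded_S : EntriesBounded S
  bounded_W : EntriesBounded W
  isSymm_S : ∀ t, 0 ≤ t → (S t).IsSymm
  isSymm_W : ∀ t, 0 ≤ t → (W t).IsSymm
  nonneg_S : ∀ t, 0 ≤ t → ∀ v, 0 ≤ v ⬝ᵥ S t *ᵥ v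
  pos_W : ∃ w : ℝ, 0 < w ∧ ∀ t, 0 ≤ t → ∀ v, w * (v ⬝ᵥ v) ≤ v ⬝ᵥ W t *ᵥ v

/-- `P` solves the Riccati equation on the set `s`, with one-sided derivatives at its boundary. -/
def IsRiccatiSolutionOn (F S W P : ℝ → Matrix n n ℝ) (s : Set ℝ) : Prop :=
  ∀ t ∈ s, HasMatDerivWithinAt P (riccatiField F S W t (P t)) s t

variable {F S W P : ℝ → Matrix n n ℝ}

theorem IsRiccatiSolutionOn.mono {s s' : Set ℝ} (h : IsRiccatiSolutionOn F S W P s)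
    (hs : s' ⊆ s) : IsRiccatiSolutionOn F S W P s' := fun t ht => (h t (hs ht)).mono hs

theorem IsRiccatiSolutionOn.continuousOn {s : Set ℝ} (h : IsRiccatiSolutionOn F S W P s) :
    ContinuousOn P s := continuousOn_of_hasMatDerivWithinAt h

theorem IsRiccatiData.continuousOn_field (hD : IsRiccatiData F S W) (P : Matrix n n ℝ) :
    ContinuousOn (fun t => riccatiField F S W t P) (Ici 0) := by
  have hP : ContinuousOn (fun _ : ℝ => P) (Ici 0) := continuousOn_const
  exact (((hD.continuousOn_F.matrix_mul hP).add
    (hP.matrix_mul hD.continuousOn_F.matrix_transpose)).sub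
      ((hP.matrix_mul hD.continuousOn_S).matrix_mul hP)).add hD.continuousOn_W

variable [DecidableEq n]

open scoped Matrix.Norms.Operator

theorem hasMatDerivWithinAt_iff {X : ℝ → Matrix n n ℝ} {X' : Matrix n n ℝ} {s : Set ℝ} {t : ℝ} :
    HasMatDerivWithinAt X X' s t ↔ HasDerivWithinAt X X' s t := by
  constructor
  · intro h
    have h1 : HasDerivWithinAt (fun τ => ∑ i, ∑ j, X τ i j • Matrix.single i j (1 : ℝ))
        (∑ i, ∑ j, X' i j • Matrix.single i j (1 : ℝ)) s t :=
      HasDerivWithinAt.fun_sum fun i _ => HasDerivWithinAt.fun_sum fun j _ =>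
        (h i j).smul_const _
    simpa [Matrix.smul_single, ← Matrix.matrix_eq_sum_single] using h1
  · intro h i j
    exact (LinearMap.toContinuousLinearMap
      (Matrix.entryLinearMap ℝ ℝ i j)).hasFDerivAt.comp_hasDerivWithinAt t h

/-- The Riccati field is Lipschitz on bounded sets, uniformly over bounded time. -/
theorem IsRiccatiData.lipschitzOnWith (hD : IsRiccatiData F S W) (T R : ℝ) :
    ∃ K : ℝ≥0, ∀ t ∈ Icc 0 T,
      LipschitzOnWith K (riccatiField F S W t) (Metric.closedBall 0 R) := by
  have hsub : Icc 0 T ⊆ Ici (0 : ℝ) := Icc_subset_Ici_self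
  obtain ⟨a, ha⟩ := isCompact_Icc.exists_bound_of_continuousOn (hD.continuousOn_F.mono hsub)
  obtain ⟨b, hb⟩ := isCompact_Icc.exists_bound_of_continuousOn
    (hD.continuousOn_F.matrix_transpose.mono hsub)
  obtain ⟨c, hc⟩ := isCompact_Icc.exists_bound_of_continuousOn (hD.continuousOn_S.mono hsub)
  refine ⟨Real.toNNReal (a + b + 2 * (R * c)), fun t ht =>
    LipschitzOnWith.of_dist_le_mul fun X hX Y hY => ?_⟩
  rw [mem_closedBall_zero_iff] at hX hY
  rw [dist_eq_norm, dist_eq_norm]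
  have e : riccatiField F S W t X - riccatiField F S W t Y
      = F t * (X - Y) + (X - Y) * (F t)ᵀ - (X * S t * (X - Y) + (X - Y) * S t * Y) := by
    simp only [riccatiField]; noncomm_ring
  have hXY := norm_nonneg (X - Y)
  have hR : 0 ≤ R := (norm_nonneg _).trans hX
  have hc0 : 0 ≤ c := (norm_nonneg _).trans (hc t ht)
  have h1 : ‖F t * (X - Y)‖ ≤ a * ‖X - Y‖ :=
    (norm_mul_le _ _).trans (mul_le_mul_of_nonneg_right (ha t ht) hXY)
  have h2 : ‖(X - Y) * (F t)ᵀ‖ ≤ ‖X - Y‖ * b :=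
    (norm_mul_le _ _).trans (mul_le_mul_of_nonneg_left (hb t ht) hXY)
  have h3 : ‖X * S t * (X - Y)‖ ≤ R * c * ‖X - Y‖ :=
    (norm_mul_le _ _).trans (mul_le_mul_of_nonneg_right
      ((norm_mul_le _ _).trans (mul_le_mul hX (hc t ht) (norm_nonneg _) hR)) hXY)
  have h4 : ‖(X - Y) * S t * Y‖ ≤ ‖X - Y‖ * c * R :=
    (norm_mul_le _ _).trans (mul_le_mul ((norm_mul_le _ _).trans
      (mul_le_mul_of_nonneg_left (hc t ht) hXY)) hY (norm_nonneg _) (by positivity))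
  have h5 := norm_sub_le (F t * (X - Y) + (X - Y) * (F t)ᵀ)
    (X * S t * (X - Y) + (X - Y) * S t * Y)
  have h6 := norm_add_le (F t * (X - Y)) ((X - Y) * (F t)ᵀ)
  have h7 := norm_add_le (X * S t * (X - Y)) ((X - Y) * S t * Y)
  rw [e]
  refine (le_trans ?_ (mul_le_mul_of_nonneg_right (Real.le_coe_toNNReal _) hXY))
  linarith

theorem IsRiccatiData.eqOn (hD : IsRiccatiData F S W) {P' : ℝ → Matrix n n ℝ} {T : ℝ}
    (hP : IsRiccatiSolutionOn F S W P (Icc 0 T)) (hP' : IsRiccatiSolutionOn F S W P' (Icc 0 T))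
    (h0 : P 0 = P' 0) : EqOn P P' (Icc 0 T) :=
  eqOn_Icc_of_locallyLipschitz hD.lipschitzOnWith
    (fun t ht => hasMatDerivWithinAt_iff.1 (hP t ht))
    (fun t ht => hasMatDerivWithinAt_iff.1 (hP' t ht)) h0

/-- A solution with symmetric initial value is symmetric, as its transpose solves the same
initial value problem. -/
theorem IsRiccatiData.isSymm (hD : IsRiccatiData F S W) {T : ℝ}
    (hP : IsRiccatiSolutionOn F S W P (Icc 0 T)) (h0 : (P 0).IsSymm) :
    ∀ t ∈ Icc 0 T, (P t).IsSymm := by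
  refine hD.eqOn (fun t ht => (hP t ht).transpose.congr_deriv ?_) hP h0
  simp only [riccatiField, Matrix.transpose_add, Matrix.transpose_sub, Matrix.transpose_mul,
    Matrix.transpose_transpose, (hD.isSymm_S t ht.1).eq, (hD.isSymm_W t ht.1).eq,
    Matrix.mul_assoc, add_comm]

theorem norm_le_of_quadForm_le {X : Matrix n n ℝ} (hX : X.IsSymm) {c : ℝ}
    (h0 : ∀ v, 0 ≤ v ⬝ᵥ X *ᵥ v) (hc : ∀ v, v ⬝ᵥ X *ᵥ v ≤ c * (v ⬝ᵥ v)) :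
    ‖X‖ ≤ ∑ i : n, ∑ j : n, c * ‖Matrix.single i j (1 : ℝ)‖ := by
  have hq : ∀ i j, X i j = Pi.single i 1 ⬝ᵥ X *ᵥ Pi.single j 1 := fun i j => by simp
  have hij : ∀ i j, |X i j| ≤ c := fun i j => by
    -- polarization
    have h1 := h0 (Pi.single i 1 + Pi.single j 1)
    have h2 := h0 (Pi.single i 1 - Pi.single j 1)
    simp only [Matrix.mulVec_add, Matrix.mulVec_sub, add_dotProduct, sub_dotProduct,
      dotProduct_add, dotProduct_sub, ← hq, hX.apply i j] at h1 h2
    have h3 := hc (Pi.single i 1)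
    have h4 := hc (Pi.single j 1)
    rw [← hq] at h3 h4
    simp at h3 h4
    rw [abs_le]
    constructor <;> linarith
  calc ‖X‖ = ‖∑ i, ∑ j, X i j • Matrix.single i j (1 : ℝ)‖ := by
        simp [Matrix.smul_single, ← Matrix.matrix_eq_sum_single]
    _ ≤ ∑ i, ‖∑ j, X i j • Matrix.single i j (1 : ℝ)‖ := norm_sum_le _ _
    _ ≤ _ := Finset.sum_le_sum fun i _ => (norm_sum_le _ _).trans
        (Finset.sum_le_sum fun j _ => by
          rw [norm_smul]; exact mul_le_mul_of_nonneg_right (hij i j) (norm_nonneg _))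

/-- Global existence for the Riccati equation, once solutions on bounded intervals are known to be
nonnegative and bounded. -/
theorem IsRiccatiData.exists_solution_of_bound (hD : IsRiccatiData F S W) (P₀ : Matrix n n ℝ)
    (hP₀ : P₀.IsSymm)
    (hbound : ∀ T, 0 ≤ T → ∃ c : ℝ, ∀ τ ∈ Icc 0 T, ∀ P : ℝ → Matrix n n ℝ, P 0 = P₀ →
      IsRiccatiSolutionOn F S W P (Icc 0 τ) →
        ∀ v, 0 ≤ v ⬝ᵥ P τ *ᵥ v ∧ v ⬝ᵥ P τ *ᵥ v ≤ c * (v ⬝ᵥ v)) :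
    ∃ P, P 0 = P₀ ∧ IsRiccatiSolutionOn F S W P (Ici 0) := by
  obtain ⟨P, h0, hP⟩ := exists_solution_Ici_of_bound hD.lipschitzOnWith hD.continuousOn_field P₀
    fun T hT => by
      obtain ⟨c, hc⟩ := hbound T hT
      refine ⟨(∑ i : n, ∑ j : n, c * ‖Matrix.single i j (1 : ℝ)‖) + 1,
        fun τ hτ P h0 hP => ?_⟩
      have hP' : IsRiccatiSolutionOn F S W P (Icc 0 τ) :=
        fun t ht => hasMatDerivWithinAt_iff.2 (hP t ht)
      have h1 := hc τ hτ P h0 hP'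
      have h2 := hD.isSymm hP' (h0 ▸ hP₀) τ ⟨hτ.1, le_rfl⟩
      exact (norm_le_of_quadForm_le h2 (fun v => (h1 v).1) fun v => (h1 v).2).trans_lt
        (lt_add_one _)
  exact ⟨P, h0, fun t ht => hasMatDerivWithinAt_iff.2 (hP t ht)⟩

end RiccatiWellPosed

/-! ### Bounds on the solutions of the Riccati equation -/

section RiccatiBounds

theorem le_add_mul_of_deriv_le {g g' : ℝ → ℝ} {a b K : ℝ} (hab : a ≤ b)
    (hg : ∀ t ∈ Icc a b, HasDerivWithinAt g (g' t) (Icc a b) t)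
    (hK : ∀ t ∈ Icc a b, g' t ≤ K) : g b ≤ g a + K * (b - a) := by
  have hB : ∀ t, HasDerivAt (fun t => g a + K * (t - a)) K t := fun t => by
    simpa using (((hasDerivAt_id t).sub_const a).const_mul K).const_add (g a)
  exact image_le_of_deriv_right_le_deriv_boundary (f := g) (f' := g')
    (B := fun t => g a + K * (t - a)) (B' := fun _ => K)
    (fun t ht => (hg t ht).continuousWithinAt)
    (fun t ht => (hg t (Ico_subset_Icc_self ht)).mono_of_mem_nhdsWithin (Icc_mem_nhdsGE_of_mem ht))
    (by simp) (fun t _ => (hB t).continuousAt.continuousWithinAt)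
    (fun t _ => (hB t).hasDerivWithinAt) (fun t ht => hK t (Ico_subset_Icc_self ht))
    ⟨hab, le_rfl⟩

theorem deriv_nonpos_of_le_left {g : ℝ → ℝ} {g' T τ : ℝ} (hτ : 0 < τ) (hτT : τ ≤ T)
    (hg : HasDerivWithinAt g g' (Icc 0 T) τ) (hle : ∀ t ∈ Ico 0 τ, g τ ≤ g t) : g' ≤ 0 := by
  have h1 : HasDerivWithinAt g g' (Ico 0 τ) τ :=
    hg.mono fun t ht => ⟨ht.1, ht.2.le.trans hτT⟩
  rw [hasDerivWithinAt_iff_tendsto_slope' (by simp)] at h1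
  have : (nhdsWithin τ (Ico 0 τ)).NeBot := by
    rw [← mem_closure_iff_nhdsWithin_neBot, closure_Ico hτ.ne]
    exact ⟨hτ.le, le_rfl⟩
  refine le_of_tendsto h1 ?_
  filter_upwards [self_mem_nhdsWithin] with t ht
  rw [slope_def_field]
  exact div_nonpos_of_nonneg_of_nonpos (sub_nonneg.2 (hle t ht)) (sub_nonpos.2 ht.2.le)

variable {m n : Type*} [Fintype m] [Fintype n]

theorem HasMatDerivWithinAt.quadForm {X : ℝ → Matrix n n ℝ} {X' : Matrix n n ℝ} {s : Set ℝ}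
    {t : ℝ} (hX : HasMatDerivWithinAt X X' s t) (v : n → ℝ) :
    HasDerivWithinAt (fun τ => v ⬝ᵥ X τ *ᵥ v) (v ⬝ᵥ X' *ᵥ v) s t := by
  simpa using (hasDerivWithinAt_const t s v).dotProduct
    (hX.mulVec (hasDerivWithinAt_const t s v))

variable {F S W P : ℝ → Matrix n n ℝ}

/-- The quadratic form of the Riccati field at `ψ`, in terms of `ψ` and `z = P ψ`. -/
theorem quadForm_riccatiField {t : ℝ} {P : Matrix n n ℝ} (hP : P.IsSymm) (ψ : n → ℝ) :
    ψ ⬝ᵥ riccatiField F S W t P *ᵥ ψ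
      = 2 * (ψ ⬝ᵥ F t *ᵥ (P *ᵥ ψ)) - (P *ᵥ ψ) ⬝ᵥ S t *ᵥ (P *ᵥ ψ) + ψ ⬝ᵥ W t *ᵥ ψ := by
  have h1 : ψ ⬝ᵥ P *ᵥ ((F t)ᵀ *ᵥ ψ) = ψ ⬝ᵥ F t *ᵥ (P *ᵥ ψ) := by
    rw [dotProduct_mulVec_of_isSymm hP, dotProduct_transpose_mulVec, dotProduct_comm]
  have h2 : ψ ⬝ᵥ P *ᵥ (S t *ᵥ (P *ᵥ ψ)) = (P *ᵥ ψ) ⬝ᵥ S t *ᵥ (P *ᵥ ψ) :=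
    dotProduct_mulVec_of_isSymm hP _ _
  simp only [riccatiField, Matrix.add_mulVec, Matrix.sub_mulVec, dotProduct_add, dotProduct_sub,
    ← Matrix.mulVec_mulVec, h1, h2]
  ring

/-- **The cost bound.** Along a trajectory of the dual control system `ψ' = -Fᵀ ψ + Cᵀ q` the form
`ψ ⬝ᵥ P ψ` grows no faster than the running cost `ψ ⬝ᵥ W ψ + |q|² / d`, by completing the square.
No positivity of `P` is needed. -/
theorem quadForm_le_add_cost {C : ℝ → Matrix m n ℝ} {d : ℝ} (hd : 0 < d)
    (hS : ∀ t, 0 ≤ t → ∀ v, d * ((C t *ᵥ v) ⬝ᵥ (C t *ᵥ v)) ≤ v ⬝ᵥ S t *ᵥ v)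
    {a b : ℝ} (ha : 0 ≤ a) (hab : a ≤ b) (hP : IsRiccatiSolutionOn F S W P (Icc a b))
    (hsymm : ∀ t ∈ Icc a b, (P t).IsSymm) {ψ : ℝ → n → ℝ} {q : ℝ → m → ℝ}
    (hψ : ∀ t ∈ Icc a b,
      HasDerivWithinAt ψ (-((F t)ᵀ *ᵥ ψ t) + (C t)ᵀ *ᵥ q t) (Icc a b) t)
    {K : ℝ} (hK : ∀ t ∈ Icc a b, ψ t ⬝ᵥ W t *ᵥ ψ t + (q t ⬝ᵥ q t) / d ≤ K) :
    ψ b ⬝ᵥ P b *ᵥ ψ b ≤ ψ a ⬝ᵥ P a *ᵥ ψ a + K * (b - a) := by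
  refine le_add_mul_of_deriv_le hab
    (fun t ht => (hψ t ht).dotProduct ((hP t ht).mulVec (hψ t ht))) fun t ht => ?_
  set z := P t *ᵥ ψ t with hz
  have h1 : ∀ u, ψ t ⬝ᵥ P t *ᵥ u = u ⬝ᵥ z := fun u => by
    rw [dotProduct_mulVec_of_isSymm (hsymm t ht), dotProduct_comm]
  have h2 : (-((F t)ᵀ *ᵥ ψ t) + (C t)ᵀ *ᵥ q t) ⬝ᵥ z
      = -(ψ t ⬝ᵥ F t *ᵥ z) + (C t *ᵥ z) ⬝ᵥ q t := by
    rw [add_dotProduct, neg_dotProduct, dotProduct_comm _ z, dotProduct_comm _ z,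
      dotProduct_transpose_mulVec, dotProduct_transpose_mulVec, dotProduct_comm (ψ t)]
  rw [dotProduct_add, h1, h2, quadForm_riccatiField (hsymm t ht), ← hz]
  have h3 := two_mul_dotProduct_le hd (C t *ᵥ z) (q t)
  have h4 := hS t (ha.trans ht.1) z
  linarith [hK t ht]

variable [DecidableEq n]

/-- **Uniform lower bound.** A solution of the Riccati equation stays above a small multiple `ε` of
the identity: where its least eigenvalue first equals `ε`, with eigenvector `v`, the derivative of
`v ⬝ᵥ P v` is positive because `W` dominates. -/
theorem IsRiccatiData.exists_lower_bound (hD : IsRiccatiData F S W) {P₀ : Matrix n n ℝ}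
    (hP₀ : P₀.PosDef) :
    ∃ p : ℝ, 0 < p ∧ ∀ T : ℝ, ∀ P : ℝ → Matrix n n ℝ, P 0 = P₀ →
      IsRiccatiSolutionOn F S W P (Icc 0 T) →
        ∀ t ∈ Icc 0 T, ∀ v, p * (v ⬝ᵥ v) ≤ v ⬝ᵥ P t *ᵥ v := by
  obtain ⟨m₀, hm₀, hP₀m⟩ := exists_pos_le_of_posDef hP₀
  obtain ⟨kF, hkF, hF⟩ := hD.bounded_F.abs_quadForm_le
  obtain ⟨kS, hkS, hS⟩ := hD.bounded_S.abs_quadForm_le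
  obtain ⟨w, hw, hW⟩ := hD.pos_W
  obtain ⟨ε, hε, hεm, hεw⟩ : ∃ ε : ℝ, 0 < ε ∧ ε < m₀ ∧ 2 * ε * kF + ε ^ 2 * kS < w := by
    refine ⟨min (m₀ / 2) (min 1 (w / (2 * (2 * kF + kS)))), by positivity, ?_, ?_⟩
    · exact (min_le_left _ _).trans_lt (by linarith)
    · set ε := min (m₀ / 2) (min 1 (w / (2 * (2 * kF + kS))))
      have h0 : 0 < ε := by positivity
      have h1 : ε ≤ 1 := (min_le_right _ _).trans (min_le_left _ _)
      have h2 : ε ≤ w / (2 * (2 * kF + kS)) := (min_le_right _ _).trans (min_le_right _ _)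
      rw [le_div_iff₀ (by positivity)] at h2
      have h3 : ε ^ 2 * kS ≤ ε * kS := by
        have : ε ^ 2 ≤ ε := by nlinarith
        gcongr
      linarith
  refine ⟨ε, hε, fun T P h0 hP => ?_⟩
  by_contra! hcon
  obtain ⟨t₁, ht₁, v₁, hv₁⟩ := hcon
  have hsymm := hD.isSymm hP (h0 ▸ Matrix.isHermitian_iff_isSymm.1 hP₀.isHermitian)
  set A : Set (ℝ × (n → ℝ)) := (Icc 0 T ×ˢ {v | v ⬝ᵥ v = 1}) ∩
    (fun p => p.2 ⬝ᵥ P p.1 *ᵥ p.2) ⁻¹' Iic ε with hA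
  have hc : ContinuousOn (fun p : ℝ × (n → ℝ) => p.2 ⬝ᵥ P p.1 *ᵥ p.2)
      (Icc 0 T ×ˢ {v | v ⬝ᵥ v = 1}) := by
    have h1 : ContinuousOn (fun p : ℝ × (n → ℝ) => P p.1) (Icc 0 T ×ˢ {v | v ⬝ᵥ v = 1}) :=
      hP.continuousOn.comp continuousOn_fst fun p hp => hp.1
    exact continuousOn_snd.dotProduct (h1.matrix_mulVec continuousOn_snd)
  have hcomp : IsCompact A := by
    refine (isCompact_Icc.prod isCompact_unitSphere).of_isClosed_subset ?_ inter_subset_left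
    exact hc.preimage_isClosed_of_isClosed
      (isCompact_Icc.prod isCompact_unitSphere).isClosed isClosed_Iic
  have hne : (Prod.fst '' A).Nonempty := by
    by_contra hemp
    rw [not_nonempty_iff_eq_empty, image_eq_empty] at hemp
    refine absurd hv₁ (not_lt.2 (le_quadForm_of_unitSphere (fun v hv => ?_) v₁))
    by_contra! hlt
    have : (t₁, v) ∈ A := ⟨⟨ht₁, hv⟩, hlt.le⟩
    rw [hemp] at this
    exact this
  -- `τ` is the first time at which the least eigenvalue of `P` is at most `ε`
  obtain ⟨τ, ⟨⟨τ', v⟩, ⟨⟨hτ, hv⟩, hvε⟩, rfl⟩, hmin⟩ :=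
    (hcomp.image continuous_fst).exists_isLeast hne
  simp only [mem_preimage, mem_Iic, mem_ofPred_eq] at hτ hv hvε hmin
  have hbefore : ∀ t ∈ Ico 0 τ', ∀ u, u ⬝ᵥ u = 1 → ε < u ⬝ᵥ P t *ᵥ u := fun t ht u hu => by
    by_contra! hle
    exact absurd (hmin ⟨(t, u), ⟨⟨⟨ht.1, ht.2.le.trans hτ.2⟩, hu⟩, hle⟩, rfl⟩) (not_le.2 ht.2)
  have hτ0 : 0 < τ' := by
    rcases hτ.1.eq_or_lt with h | h
    · have h1 := hP₀m v
      rw [hv, ← h0, h] at h1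
      linarith
    · exact h
  have hge : ∀ u, u ⬝ᵥ u = 1 → ε ≤ u ⬝ᵥ P τ' *ᵥ u := fun u hu => by
    have hcu : ContinuousOn (fun t => u ⬝ᵥ P t *ᵥ u) (Icc 0 τ') :=
      continuousOn_const.dotProduct ((hP.continuousOn.mono
        (Icc_subset_Icc_right hτ.2)).matrix_mulVec continuousOn_const)
    have h1 : τ' ∈ closure (Ico 0 τ') := by
      rw [closure_Ico hτ0.ne]; exact ⟨hτ0.le, le_rfl⟩
    rw [← closure_Ico hτ0.ne] at hcu
    exact (isClosed_Ici (a := ε)).closure_subset_iff.2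
      (image_subset_iff.2 fun t ht => (hbefore t ht u hu).le) (hcu.image_closure ⟨τ', h1, rfl⟩)
  have hveq : v ⬝ᵥ P τ' *ᵥ v = ε := le_antisymm hvε (hge v hv)
  have hsym := hsymm τ' hτ
  -- a minimizer of the quadratic form is an eigenvector
  have hPv : P τ' *ᵥ v = ε • v := by
    have hpsd : GeScalar (P τ') ε := geScalar_iff.2 ⟨hsym, le_quadForm_of_unitSphere hge⟩
    have := (Matrix.PosSemidef.dotProduct_mulVec_zero_iff hpsd v).1 (by
      simp [Matrix.sub_mulVec, Matrix.smul_mulVec, dotProduct_sub, hveq, hv])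
    rwa [Matrix.sub_mulVec, Matrix.smul_mulVec, Matrix.one_mulVec, sub_eq_zero] at this
  have hle := deriv_nonpos_of_le_left hτ0 hτ.2 ((hP τ' hτ).quadForm v) fun t ht =>
    hveq.le.trans (hbefore t ht v hv).le
  rw [quadForm_riccatiField hsym, hPv] at hle
  simp only [Matrix.mulVec_smul, dotProduct_smul, smul_dotProduct, smul_eq_mul] at hle
  have h1 := (abs_le.1 (hF τ' hτ.1 v)).1
  have h2 := (abs_le.1 (hS τ' hτ.1 v)).2
  have h3 := hW τ' hτ.1 v
  rw [hv] at h1 h2 h3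
  nlinarith [mul_le_mul_of_nonneg_left h1 hε.le, mul_le_mul_of_nonneg_left h2 (sq_nonneg ε)]

/-- The transition matrix of `ẋ = F x`, together with the properties of its inverse and a bound
over bounded time intervals. -/
structure IsTransition (F : ℝ → Matrix n n ℝ) (Φ : ℝ → ℝ → Matrix n n ℝ) : Prop where
  self : ∀ t, 0 ≤ t → Φ t t = 1
  mul_eq_one : ∀ s t, 0 ≤ s → 0 ≤ t → Φ s t * Φ t s = 1
  hasDeriv_left : ∀ s t, 0 ≤ s → 0 ≤ t →
    HasMatDerivWithinAt (fun σ => Φ σ t) (F s * Φ s t) (Ici 0) s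
  hasDeriv_right : ∀ s t, 0 ≤ s → 0 ≤ t →
    HasMatDerivWithinAt (fun σ => Φ t σ) (-(Φ t s * F s)) (Ici 0) s
  bounded : ∀ L : ℝ, ∃ K : ℝ, ∀ s t, 0 ≤ s → 0 ≤ t → |s - t| ≤ L → ∀ i j, |Φ s t i j| ≤ K

variable {Φ : ℝ → ℝ → Matrix n n ℝ}

/-- Solutions are bounded on bounded intervals: the cost bound along the uncontrolled dual
trajectory. -/
theorem IsRiccatiData.exists_upper_bound_Icc (hD : IsRiccatiData F S W) (hΦ : IsTransition F Φ)
    {P₀ : Matrix n n ℝ} (hP₀ : P₀.IsSymm) (T : ℝ) :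
    ∃ c : ℝ, ∀ τ ∈ Icc 0 T, ∀ P : ℝ → Matrix n n ℝ, P 0 = P₀ →
      IsRiccatiSolutionOn F S W P (Icc 0 τ) → ∀ v, v ⬝ᵥ P τ *ᵥ v ≤ c * (v ⬝ᵥ v) := by
  obtain ⟨K, hK⟩ := hΦ.bounded T
  obtain ⟨kW, hkW, hW⟩ := hD.bounded_W.abs_quadForm_le
  obtain ⟨kP, hkP, hkP₀⟩ : ∃ k : ℝ, 0 < k ∧ ∀ v, v ⬝ᵥ P₀ *ᵥ v ≤ k * (v ⬝ᵥ v) := by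
    have : EntriesBounded fun _ : ℝ => P₀ :=
      ⟨∑ i, ∑ j, |P₀ i j|, fun _ _ i j =>
        (Finset.single_le_sum (f := fun j => |P₀ i j|) (fun _ _ => abs_nonneg _)
          (Finset.mem_univ j)).trans (Finset.single_le_sum (f := fun i => ∑ j, |P₀ i j|)
            (fun _ _ => Finset.sum_nonneg fun _ _ => abs_nonneg _) (Finset.mem_univ i))⟩
    obtain ⟨k, hk, h⟩ := this.abs_quadForm_le
    exact ⟨k, hk, fun v => (le_abs_self _).trans (h 0 le_rfl v)⟩
  set k : ℝ := Fintype.card n * Fintype.card n * K ^ 2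
  have hk : 0 ≤ k := by positivity
  refine ⟨kP * k + kW * k * T, fun τ hτ P h0 hP v => ?_⟩
  have hvv := dotProduct_self_nonneg' v
  have hψ : ∀ t ∈ Icc 0 τ, ((Φ τ t)ᵀ *ᵥ v) ⬝ᵥ ((Φ τ t)ᵀ *ᵥ v) ≤ k * (v ⬝ᵥ v) := fun t ht =>
    mulVec_dotProduct_self_le (fun i j => hK τ t hτ.1 ht.1
      (by rw [abs_of_nonneg (sub_nonneg.2 ht.2)]; linarith [ht.1, hτ.2]) j i) v
  have h := quadForm_le_add_cost (C := fun _ => (0 : Matrix n n ℝ)) (q := fun _ => 0)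
    (ψ := fun t => (Φ τ t)ᵀ *ᵥ v) one_pos (fun t ht v => by simpa using hD.nonneg_S t ht v)
    le_rfl hτ.1 hP (hD.isSymm hP (h0 ▸ hP₀)) (K := kW * (k * (v ⬝ᵥ v)))
    (fun t ht => by
      have h1 := ((hΦ.hasDeriv_right t τ ht.1 hτ.1).mono
        (Icc_subset_Ici_self : Icc 0 τ ⊆ Ici 0)).transpose.mulVec (hasDerivWithinAt_const t _ v)
      simpa [Matrix.transpose_mul, Matrix.neg_mulVec, Matrix.mulVec_mulVec] using h1)
    (fun t ht => by
      have h1 := (le_abs_self _).trans (hW t ht.1 ((Φ τ t)ᵀ *ᵥ v))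
      simpa using h1.trans (mul_le_mul_of_nonneg_left (hψ t ht) hkW.le))
  simp only [hΦ.self τ hτ.1, Matrix.transpose_one, Matrix.one_mulVec, h0] at h
  have h1 := hkP₀ ((Φ τ 0)ᵀ *ᵥ v)
  have h2 := mul_le_mul_of_nonneg_left (hψ 0 ⟨le_rfl, hτ.1⟩) hkP.le
  have h3 : kW * (k * (v ⬝ᵥ v)) * (τ - 0) ≤ kW * (k * (v ⬝ᵥ v)) * T := by
    have := hτ.2
    gcongr
    linarith
  linarith

theorem IsRiccatiData.exists_solution (hD : IsRiccatiData F S W) (hΦ : IsTransition F Φ)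
    {P₀ : Matrix n n ℝ} (hP₀ : P₀.PosDef) :
    ∃ P, P 0 = P₀ ∧ IsRiccatiSolutionOn F S W P (Ici 0) := by
  have hs : P₀.IsSymm := Matrix.isHermitian_iff_isSymm.1 hP₀.isHermitian
  refine hD.exists_solution_of_bound P₀ hs fun T hT => ?_
  obtain ⟨c, hc⟩ := hD.exists_upper_bound_Icc hΦ hs T
  obtain ⟨p, hp, hlow⟩ := hD.exists_lower_bound hP₀
  exact ⟨c, fun τ hτ P h0 hP v => ⟨(mul_nonneg hp.le (dotProduct_self_nonneg' v)).trans
    (hlow τ P h0 hP τ ⟨hτ.1, le_rfl⟩ v), hc τ hτ P h0 hP v⟩⟩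

end RiccatiBounds

/-! ### The uniform upper bound under observability -/

section UpperBound

theorem hasDerivWithinAt_integral_Ici {g : ℝ → ℝ} (hg : ContinuousOn g (Ici 0)) {a t : ℝ}
    (ha : 0 ≤ a) (ht : 0 ≤ t) :
    HasDerivWithinAt (fun s => ∫ τ in a..s, g τ) (g t) (Ici 0) t := by
  -- `g` is replaced by a continuous extension to the whole line
  have hc : Continuous fun τ => g (max τ 0) :=
    hg.comp_continuous (by fun_prop) fun τ => mem_Ici.2 (le_max_right _ _)
  have h1 : HasDerivAt (fun s => ∫ τ in a..s, g (max τ 0)) (g (max t 0)) t :=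
    intervalIntegral.integral_hasDerivAt_right (hc.intervalIntegrable _ _)
      (hc.stronglyMeasurableAtFilter _ _) hc.continuousAt
  have h2 : ∀ s ∈ Ici (0 : ℝ), ∫ τ in a..s, g τ = ∫ τ in a..s, g (max τ 0) := fun s hs =>
    intervalIntegral.integral_congr fun τ hτ => by
      have : 0 ≤ τ := (le_min ha hs).trans hτ.1
      simp [max_eq_left this]
  rw [max_eq_left ht] at h1
  exact h1.hasDerivWithinAt.congr h2 (h2 t ht)

theorem hasMatDerivWithinAt_matIntegral {m n : Type*} {X : ℝ → Matrix m n ℝ}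
    (hX : ContinuousOn X (Ici 0)) {a t : ℝ} (ha : 0 ≤ a) (ht : 0 ≤ t) :
    HasMatDerivWithinAt (fun s => matIntegral a s X) (X t) (Ici 0) t := fun i j =>
  hasDerivWithinAt_integral_Ici (continuousOn_matrix.1 hX i j) ha ht

theorem matIntegral_apply_abs_le {m n : Type*} {X : ℝ → Matrix m n ℝ} {a b K : ℝ} (hab : a ≤ b)
    (hX : ∀ s ∈ Icc a b, ∀ i j, |X s i j| ≤ K) (i : m) (j : n) :
    |matIntegral a b X i j| ≤ K * (b - a) := by
  have := intervalIntegral.norm_integral_le_of_norm_le_const (f := fun s => X s i j) (a := a)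
    (b := b) (C := K) fun s hs => by
      rw [uIoc_of_le hab] at hs
      exact hX s ⟨hs.1.le, hs.2⟩ i j
  rwa [abs_of_nonneg (sub_nonneg.2 hab)] at this

variable {m n : Type*} [Fintype m] [Fintype n] [DecidableEq n] {F S W P : ℝ → Matrix n n ℝ}
  {Φ : ℝ → ℝ → Matrix n n ℝ} {C : ℝ → Matrix m n ℝ}

/-- The integrand of the observability Gramian. -/
def gramIntegrand (Φ : ℝ → ℝ → Matrix n n ℝ) (C : ℝ → Matrix m n ℝ) (t s : ℝ) : Matrix n n ℝ :=
  (Φ s t)ᵀ * (C s)ᵀ * C s * Φ s t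

theorem IsTransition.continuousOn_left (hΦ : IsTransition F Φ) {t : ℝ} (ht : 0 ≤ t) :
    ContinuousOn (fun s => Φ s t) (Ici 0) :=
  continuousOn_of_hasMatDerivWithinAt fun s hs => hΦ.hasDeriv_left s t hs ht

theorem IsTransition.continuousOn_gramIntegrand (hΦ : IsTransition F Φ)
    (hC : ContinuousOn C (Ici 0)) {t : ℝ} (ht : 0 ≤ t) :
    ContinuousOn (gramIntegrand Φ C t) (Ici 0) := by
  have h := hΦ.continuousOn_left ht
  exact ((h.matrix_transpose.matrix_mul hC.matrix_transpose).matrix_mul hC).matrix_mul h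

/-- **Uniform upper bound.** If the Gramians over windows of length `L` are uniformly positive
definite, every vector `z` at time `t + L` is reached from `0` at time `t` by the dual control
system, with the control `q(s) = C(s) Φ(s, t) η` of size proportional to `|z|`; the cost bound along
this trajectory does not involve `P(t)`. -/
theorem IsRiccatiData.exists_upper_bound (hD : IsRiccatiData F S W) (hΦ : IsTransition F Φ)
    (hC : ContinuousOn C (Ici 0)) (hCb : EntriesBounded C) {d : ℝ} (hd : 0 < d)
    (hS : ∀ t, 0 ≤ t → ∀ v, d * ((C t *ᵥ v) ⬝ᵥ (C t *ᵥ v)) ≤ v ⬝ᵥ S t *ᵥ v)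
    {L g : ℝ} (hL : 0 < L) (hg : 0 < g)
    (hobs : ∀ t, 0 ≤ t → ∀ v,
      g * (v ⬝ᵥ v) ≤ v ⬝ᵥ matIntegral t (t + L) (gramIntegrand Φ C t) *ᵥ v)
    {P₀ : Matrix n n ℝ} (hP₀ : P₀.IsSymm) :
    ∃ p : ℝ, 0 < p ∧ ∀ P : ℝ → Matrix n n ℝ, P 0 = P₀ → IsRiccatiSolutionOn F S W P (Ici 0) →
      ∀ t, 0 ≤ t → ∀ v, v ⬝ᵥ P t *ᵥ v ≤ p * (v ⬝ᵥ v) := by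
  obtain ⟨K, hK⟩ := hΦ.bounded L
  obtain ⟨KC, hKC⟩ := hCb
  obtain ⟨kC, hkC, hC2⟩ := EntriesBounded.mulVec_le (X := C) ⟨KC, hKC⟩
  obtain ⟨kW, hkW, hW⟩ := hD.bounded_W.abs_quadForm_le
  obtain ⟨c₀, hc₀⟩ := hD.exists_upper_bound_Icc hΦ hP₀ L
  set k : ℝ := Fintype.card n * Fintype.card n * K ^ 2 with hkdef
  have hk : 0 ≤ k := by positivity
  -- a bound on the entries of the integrand
  obtain ⟨KN, hKN⟩ : ∃ KN : ℝ, ∀ t, 0 ≤ t → ∀ s ∈ Icc t (t + L), ∀ i j,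
      |gramIntegrand Φ C t s i j| ≤ KN := by
    refine ⟨Fintype.card n * (|Fintype.card m * (|Fintype.card n * (|K| * |KC|)| * |KC|)| * |K|),
      fun t ht s hs => ?_⟩
    have hs0 : 0 ≤ s := ht.trans hs.1
    have h1 : ∀ i j, |Φ s t i j| ≤ K := hK s t hs0 ht
      (by rw [abs_of_nonneg (sub_nonneg.2 hs.1)]; linarith [hs.2])
    exact abs_mul_apply_le (abs_mul_apply_le (abs_mul_apply_le (K := K) (K' := KC)
      (fun i j => h1 j i) fun i j => hKC s hs0 j i) (hKC s hs0)) h1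
  set kI : ℝ := Fintype.card n * Fintype.card n * (|KN| * L) ^ 2 with hkI
  have hkI0 : 0 ≤ kI := by positivity
  set c₁ : ℝ := (kW * (k * kI) + kC * k / d) * (k / g ^ 2) * L with hc₁
  refine ⟨max c₀ c₁ + 1 + |c₀|, ?_, fun P h0 hP => ?_⟩
  · linarith [neg_abs_le c₀, le_max_left c₀ c₁]
  have hbig : ∀ c, c ≤ max c₀ c₁ → ∀ v : n → ℝ,
      c * (v ⬝ᵥ v) ≤ (max c₀ c₁ + 1 + |c₀|) * (v ⬝ᵥ v) := fun c hc v =>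
    mul_le_mul_of_nonneg_right (by linarith [abs_nonneg c₀]) (dotProduct_self_nonneg' v)
  intro t ht v
  rcases le_total t L with htL | htL
  · exact (hc₀ t ⟨ht, htL⟩ P h0 (hP.mono Icc_subset_Ici_self) v).trans
      (hbig _ (le_max_left _ _) v)
  refine le_trans ?_ (hbig _ (le_max_right _ _) v)
  obtain ⟨a, rfl⟩ : ∃ a, t = a + L := ⟨t - L, by ring⟩
  have ha : 0 ≤ a := by linarith
  have hsub : Icc a (a + L) ⊆ Ici 0 := fun s hs => ha.trans hs.1
  set G := matIntegral a (a + L) (gramIntegrand Φ C a) with hG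
  have hGunit : IsUnit G.det := by
    rw [← Matrix.isUnit_iff_isUnit_det, ← Matrix.mulVec_injective_iff_isUnit]
    refine (injective_iff_map_eq_zero G.mulVecLin).2 fun u hu => ?_
    rw [Matrix.mulVecLin_apply] at hu
    have h1 := hobs a ha u
    rw [← hG, hu, dotProduct_zero] at h1
    have h2 := dotProduct_self_nonneg' u
    exact dotProduct_self_eq_zero.1 (le_antisymm (by nlinarith) h2)
  set u := (Φ (a + L) a)ᵀ *ᵥ v with hu
  set η := G⁻¹ *ᵥ u with hη
  have hGη : G *ᵥ η = u := by
    rw [hη, Matrix.mulVec_mulVec, Matrix.mul_nonsing_inv _ hGunit, Matrix.one_mulVec]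
  have hΦb : ∀ s ∈ Icc a (a + L), ∀ i j, |Φ s a i j| ≤ K := fun s hs => hK s a (hsub hs) ha
    (by rw [abs_of_nonneg (sub_nonneg.2 hs.1)]; linarith [hs.2])
  have hΦb' : ∀ s ∈ Icc a (a + L), ∀ i j, |Φ a s i j| ≤ K := fun s hs => hK a s ha (hsub hs)
    (by rw [abs_of_nonpos (sub_nonpos.2 hs.1)]; linarith [hs.2])
  have hηbound : η ⬝ᵥ η ≤ k / g ^ 2 * (v ⬝ᵥ v) := by
    have h1 := hobs a ha η
    rw [← hG, hGη] at h1
    have h2 := two_mul_dotProduct_le hg η u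
    have h3 : u ⬝ᵥ u ≤ k * (v ⬝ᵥ v) := mulVec_dotProduct_self_le
      (fun i j => hΦb (a + L) ⟨by linarith, le_rfl⟩ j i) v
    have h4 : g * (η ⬝ᵥ η) ≤ (u ⬝ᵥ u) / g := by linarith
    rw [le_div_iff₀ hg] at h4
    rw [div_mul_eq_mul_div, le_div_iff₀ (by positivity)]
    linarith
  have hηη := dotProduct_self_nonneg' η
  set I : ℝ → n → ℝ := fun s => matIntegral a s (gramIntegrand Φ C a) *ᵥ η with hI
  have hIb : ∀ s ∈ Icc a (a + L), I s ⬝ᵥ I s ≤ kI * (η ⬝ᵥ η) := fun s hs => by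
    refine mulVec_dotProduct_self_le (fun i j => ?_) η
    refine (matIntegral_apply_abs_le hs.1 (fun σ hσ i j =>
      (hKN a ha σ ⟨hσ.1, hσ.2.trans hs.2⟩ i j).trans (le_abs_self KN)) i j).trans ?_
    have := hs.2
    gcongr
    linarith
  have hcost := quadForm_le_add_cost hd hS ha (by linarith : a ≤ a + L) (hP.mono hsub)
    (fun s hs => hD.isSymm (hP.mono Icc_subset_Ici_self) (h0 ▸ hP₀) s ⟨hsub hs, hs.2⟩)
    (ψ := fun s => (Φ a s)ᵀ *ᵥ I s) (q := fun s => C s *ᵥ (Φ s a *ᵥ η))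
    (K := (kW * (k * kI) + kC * k / d) * (η ⬝ᵥ η)) (fun s hs => by
      have h1 := (hΦ.hasDeriv_right s a (hsub hs) ha).transpose.mulVec
        ((hasMatDerivWithinAt_matIntegral (hΦ.continuousOn_gramIntegrand hC ha) ha
          (hsub hs)).mulVec (hasDerivWithinAt_const s _ η))
      refine (h1.mono hsub).congr_deriv ?_
      have h2 : (Φ a s)ᵀ * (Φ s a)ᵀ = 1 := by
        rw [← Matrix.transpose_mul, hΦ.mul_eq_one s a (hsub hs) ha, Matrix.transpose_one]
      have h3 : (Φ a s)ᵀ *ᵥ (gramIntegrand Φ C a s *ᵥ η) = (C s)ᵀ *ᵥ (C s *ᵥ (Φ s a *ᵥ η)) := by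
        simp only [gramIntegrand, Matrix.mulVec_mulVec]
        rw [← Matrix.mul_assoc, ← Matrix.mul_assoc, ← Matrix.mul_assoc, h2, Matrix.one_mul]
        simp only [Matrix.mul_assoc]
      rw [Matrix.mulVec_zero, add_zero, h3, Matrix.transpose_neg, Matrix.transpose_mul,
        Matrix.neg_mulVec]
      simp only [hI, Matrix.mulVec_mulVec, Matrix.mul_assoc])
    (fun s hs => by
      have h1 := (le_abs_self _).trans (hW s (hsub hs) ((Φ a s)ᵀ *ᵥ I s))
      have h2 : ((Φ a s)ᵀ *ᵥ I s) ⬝ᵥ ((Φ a s)ᵀ *ᵥ I s) ≤ k * (kI * (η ⬝ᵥ η)) :=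
        (mulVec_dotProduct_self_le (fun i j => hΦb' s hs j i) _).trans
          (mul_le_mul_of_nonneg_left (hIb s hs) hk)
      have h3 := mul_le_mul_of_nonneg_left h2 hkW.le
      have h4 : (C s *ᵥ (Φ s a *ᵥ η)) ⬝ᵥ (C s *ᵥ (Φ s a *ᵥ η)) ≤ kC * (k * (η ⬝ᵥ η)) :=
        (hC2 s (hsub hs) _).trans (mul_le_mul_of_nonneg_left
          (mulVec_dotProduct_self_le (hΦb s hs) η) hkC.le)
      have h5 := div_le_div_of_nonneg_right h4 hd.le
      calc _ ≤ kW * (k * (kI * (η ⬝ᵥ η))) + kC * (k * (η ⬝ᵥ η)) / d :=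
            add_le_add (h1.trans h3) h5
        _ = _ := by ring)
  have hstart : (Φ a a)ᵀ *ᵥ I a = 0 := by
    have : matIntegral a a (gramIntegrand Φ C a) = 0 := by ext i j; simp [matIntegral]
    simp [hI, this]
  have hend : (Φ a (a + L))ᵀ *ᵥ I (a + L) = v := by
    simp only [hI, ← hG, hGη, hu]
    rw [Matrix.mulVec_mulVec, ← Matrix.transpose_mul, hΦ.mul_eq_one _ _ ht ha,
      Matrix.transpose_one, Matrix.one_mulVec]
  simp only [hstart, hend] at hcost
  rw [zero_dotProduct, zero_add, add_sub_cancel_left] at hcost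
  refine hcost.trans ?_
  calc (kW * (k * kI) + kC * k / d) * (η ⬝ᵥ η) * L
      ≤ (kW * (k * kI) + kC * k / d) * (k / g ^ 2 * (v ⬝ᵥ v)) * L := by gcongr
    _ = c₁ * (v ⬝ᵥ v) := by rw [hc₁]; ring

end UpperBound

/-! ### Exponential stability of the error system -/

section Stability

variable {n : Type*} [Fintype n] [DecidableEq n] {F S W P : ℝ → Matrix n n ℝ}

open scoped Matrix.Norms.Operator in
theorem HasMatDerivWithinAt.inv {X : ℝ → Matrix n n ℝ} {X' : Matrix n n ℝ} {s : Set ℝ} {t : ℝ}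
    (hX : HasMatDerivWithinAt X X' s t) (h : IsUnit (X t)) :
    HasMatDerivWithinAt (fun τ => (X τ)⁻¹) (-((X t)⁻¹ * X' * (X t)⁻¹)) s t := by
  rw [hasMatDerivWithinAt_iff] at hX ⊢
  obtain ⟨x, hx⟩ := h
  have h1 : HasFDerivAt Ring.inverse
      (-ContinuousLinearMap.mulLeftRight ℝ (Matrix n n ℝ) ↑x⁻¹ ↑x⁻¹) (X t) :=
    hx ▸ hasFDerivAt_ringInverse x
  simp only [Matrix.nonsing_inv_eq_ringInverse]
  refine (h1.comp_hasDerivWithinAt t hX).congr_deriv ?_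
  rw [← hx, Ring.inverse_unit]
  simp [ContinuousLinearMap.mulLeftRight_apply]

/-- **Lyapunov's method.** When `p₁ I ≤ P ≤ p₂ I`, the function `x ⬝ᵥ P⁻¹ x` decays exponentially
along the solutions of `ẋ = (F - P S) x`. -/
theorem IsRiccatiData.exists_exponential_decay (hD : IsRiccatiData F S W)
    (hP : IsRiccatiSolutionOn F S W P (Ici 0)) (hsymm : ∀ t, 0 ≤ t → (P t).IsSymm)
    {p₁ p₂ : ℝ} (hp₁ : 0 < p₁) (hp₂ : 0 < p₂)
    (hlow : ∀ t, 0 ≤ t → ∀ v, p₁ * (v ⬝ᵥ v) ≤ v ⬝ᵥ P t *ᵥ v)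
    (hup : ∀ t, 0 ≤ t → ∀ v, v ⬝ᵥ P t *ᵥ v ≤ p₂ * (v ⬝ᵥ v)) :
    ∃ c : ℝ, 0 < c ∧ ∀ t₀, 0 ≤ t₀ → ∀ x : ℝ → n → ℝ,
      (∀ t, t₀ ≤ t → HasDerivWithinAt x (F t *ᵥ x t - P t *ᵥ (S t *ᵥ x t)) (Ici t₀) t) →
      ∀ t, t₀ ≤ t →
        x t ⬝ᵥ x t ≤ p₂ / p₁ * Real.exp (-(c * (t - t₀))) * (x t₀ ⬝ᵥ x t₀) := by
  obtain ⟨w, hw, hW⟩ := hD.pos_W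
  refine ⟨w / p₂, by positivity, fun t₀ ht₀ x hx t ht => ?_⟩
  have hunit : ∀ t, 0 ≤ t → IsUnit (P t) := fun t ht => by
    rw [← Matrix.mulVec_injective_iff_isUnit]
    refine (injective_iff_map_eq_zero (P t).mulVecLin).2 fun u hu => ?_
    rw [Matrix.mulVecLin_apply] at hu
    have h1 := hlow t ht u
    rw [hu, dotProduct_zero] at h1
    exact dotProduct_self_eq_zero.1 (le_antisymm (by nlinarith) (dotProduct_self_nonneg' u))
  have hdet : ∀ t, 0 ≤ t → IsUnit (P t).det := fun t ht =>
    (Matrix.isUnit_iff_isUnit_det _).1 (hunit t ht)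
  have hPz : ∀ t, 0 ≤ t → P t *ᵥ ((P t)⁻¹ *ᵥ x t) = x t := fun t ht => by
    rw [Matrix.mulVec_mulVec, Matrix.mul_nonsing_inv _ (hdet t ht), Matrix.one_mulVec]
  set V : ℝ → ℝ := fun t => x t ⬝ᵥ (P t)⁻¹ *ᵥ x t with hV
  have hVeq : ∀ t, 0 ≤ t → V t = ((P t)⁻¹ *ᵥ x t) ⬝ᵥ P t *ᵥ ((P t)⁻¹ *ᵥ x t) := fun t ht => by
    rw [hPz t ht, dotProduct_comm]
  have hlower : ∀ t, 0 ≤ t → x t ⬝ᵥ x t ≤ p₂ * V t := fun t ht => by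
    have h1 := mulVec_dotProduct_self_le_of_quadForm_le (hsymm t ht)
      (fun v => (mul_nonneg hp₁.le (dotProduct_self_nonneg' v)).trans (hlow t ht v))
      (hup t ht) ((P t)⁻¹ *ᵥ x t)
    rwa [← hVeq t ht, hPz t ht] at h1
  have hupper : ∀ t, 0 ≤ t → V t ≤ (x t ⬝ᵥ x t) / p₁ := fun t ht => by
    have h1 := hlow t ht ((P t)⁻¹ *ᵥ x t)
    rw [← hVeq t ht] at h1
    have h2 := two_mul_dotProduct_le hp₁ ((P t)⁻¹ *ᵥ x t) (x t)
    rw [dotProduct_comm] at h2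
    simp only [hV] at h1 ⊢
    linarith
  have hsub : Icc t₀ t ⊆ Ici 0 := fun s hs => ht₀.trans hs.1
  have hderiv : ∀ s ∈ Icc t₀ t, HasDerivWithinAt V
      (-(((P s)⁻¹ *ᵥ x s) ⬝ᵥ (W s *ᵥ ((P s)⁻¹ *ᵥ x s))) - x s ⬝ᵥ S s *ᵥ x s) (Icc t₀ t) s :=
    fun s hs => by
      have hs0 := hsub hs
      have hxs := (hx s hs.1).mono (Icc_subset_Ici_self : Icc t₀ t ⊆ Ici t₀)
      have h1 := hxs.dotProduct (((hP s hs0).inv (hunit s hs0)).mono hsub |>.mulVec hxs)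
      refine h1.congr_deriv ?_
      have hYsymm : ((P s)⁻¹).IsSymm := by
        rw [Matrix.IsSymm, Matrix.transpose_nonsing_inv, (hsymm s hs0).eq]
      set z := (P s)⁻¹ *ᵥ x s with hz
      have hxz : x s = P s *ᵥ z := (hPz s hs0).symm
      have h2 : x s ⬝ᵥ (-((P s)⁻¹ * riccatiField F S W s (P s) * (P s)⁻¹)) *ᵥ x s
          = -(z ⬝ᵥ riccatiField F S W s (P s) *ᵥ z) := by
        rw [Matrix.neg_mulVec, dotProduct_neg, ← Matrix.mulVec_mulVec, ← Matrix.mulVec_mulVec,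
          ← hz, dotProduct_mulVec_of_isSymm hYsymm, ← hz]
      have h3 : ∀ u, x s ⬝ᵥ (P s)⁻¹ *ᵥ u = z ⬝ᵥ u := fun u => by
        rw [dotProduct_mulVec_of_isSymm hYsymm, ← hz]
      have h4 : ∀ u, z ⬝ᵥ P s *ᵥ u = x s ⬝ᵥ u := fun u => by
        rw [dotProduct_mulVec_of_isSymm (hsymm s hs0), ← hxz]
      rw [dotProduct_add, h2, h3, quadForm_riccatiField (hsymm s hs0), ← hxz,
        dotProduct_comm _ z, dotProduct_sub, h4]
      ring
  -- the exponentially weighted Lyapunov function is nonincreasing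
  have hexp : ∀ s, HasDerivAt (fun s => Real.exp (w / p₂ * (s - t₀)))
      (Real.exp (w / p₂ * (s - t₀)) * (w / p₂)) s := fun s => by
    simpa using (((hasDerivAt_id s).sub_const t₀).const_mul (w / p₂)).exp
  have hmono := le_add_mul_of_deriv_le ht (K := 0)
    (fun s hs => (hexp s).hasDerivWithinAt.mul (hderiv s hs)) fun s hs => by
      have hs0 := hsub hs
      have h1 := hW s hs0 ((P s)⁻¹ *ᵥ x s)
      have h2 := hup s hs0 ((P s)⁻¹ *ᵥ x s)
      rw [← hVeq s hs0] at h2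
      have h3 : w / p₂ * V s ≤ w * (((P s)⁻¹ *ᵥ x s) ⬝ᵥ ((P s)⁻¹ *ᵥ x s)) := by
        rw [div_mul_eq_mul_div, div_le_iff₀ hp₂]
        calc w * V s ≤ w * (p₂ * (((P s)⁻¹ *ᵥ x s) ⬝ᵥ ((P s)⁻¹ *ᵥ x s))) := by gcongr
          _ = _ := by ring
      have h4 := hD.nonneg_S s hs0 (x s)
      have h5 := Real.exp_pos (w / p₂ * (s - t₀))
      nlinarith
  simp only [Pi.mul_apply, sub_self, mul_zero, Real.exp_zero, one_mul, zero_mul, add_zero] at hmono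
  have hVt : V t ≤ Real.exp (-(w / p₂ * (t - t₀))) * V t₀ := by
    rw [Real.exp_neg, ← div_eq_inv_mul, le_div_iff₀' (Real.exp_pos _)]
    exact hmono
  calc x t ⬝ᵥ x t ≤ p₂ * V t := hlower t (ht₀.trans ht)
    _ ≤ p₂ * (Real.exp (-(w / p₂ * (t - t₀))) * ((x t₀ ⬝ᵥ x t₀) / p₁)) := by
        gcongr
        exact hVt.trans (mul_le_mul_of_nonneg_left (hupper t₀ ht₀) (Real.exp_pos _).le)
    _ = _ := by ring

end Stability

/-! ### Lines seen along the bearing -/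

section BearingLines

theorem proj_mulVec (y : R3) (v : Fin 3 → ℝ) : proj y *ᵥ v = v - (y.ofLp ⬝ᵥ v) • y.ofLp := by
  rw [proj, Matrix.sub_mulVec, Matrix.one_mulVec, Matrix.vecMulVec_mulVec]
  simp

theorem isSymm_proj (y : R3) : (proj y).IsSymm := by
  refine Matrix.isSymm_one.sub ?_
  rw [Matrix.IsSymm, Matrix.transpose_vecMulVec]

theorem dotProduct_self_of_norm_eq_one {y : R3} (hy : ‖y‖ = 1) : y.ofLp ⬝ᵥ y.ofLp = 1 := by
  have h := EuclideanSpace.real_norm_sq_eq y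
  rw [hy] at h
  simp only [dotProduct, ← pow_two]
  linarith

theorem proj_mul_self {y : R3} (hy : ‖y‖ = 1) : proj y * proj y = proj y := by
  have h : Matrix.vecMulVec y.ofLp y.ofLp * Matrix.vecMulVec y.ofLp y.ofLp
      = Matrix.vecMulVec y.ofLp y.ofLp := by
    rw [Matrix.vecMulVec_mul_vecMulVec, dotProduct_self_of_norm_eq_one hy, one_smul]
  simp [proj, sub_mul, mul_sub, h]

theorem dotProduct_proj_mulVec {y : R3} (hy : ‖y‖ = 1) (u v : Fin 3 → ℝ) :
    (proj y *ᵥ u) ⬝ᵥ (proj y *ᵥ v) = u ⬝ᵥ proj y *ᵥ v := by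
  rw [← dotProduct_mulVec_of_isSymm (isSymm_proj y), Matrix.mulVec_mulVec, proj_mul_self hy]

theorem proj_mulVec_self_le {y : R3} (hy : ‖y‖ = 1) (v : Fin 3 → ℝ) :
    (proj y *ᵥ v) ⬝ᵥ (proj y *ᵥ v) ≤ v ⬝ᵥ v := by
  rw [dotProduct_proj_mulVec hy, proj_mulVec, dotProduct_sub, dotProduct_smul, smul_eq_mul,
    dotProduct_comm v y.ofLp]
  nlinarith [mul_self_nonneg (y.ofLp ⬝ᵥ v)]

theorem abs_proj_apply_le {y : R3} (hy : ‖y‖ = 1) (i j : Fin 3) : |proj y i j| ≤ 2 := by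
  have h : ∀ k, |y k| ≤ 1 := fun k => by
    rw [← hy]; simpa using PiLp.norm_apply_le y k
  have h1 : |(1 : Matrix (Fin 3) (Fin 3) ℝ) i j| ≤ 1 := by
    rw [Matrix.one_apply]; split_ifs <;> simp
  have h2 : |y i * y j| ≤ 1 := by
    rw [abs_mul]; exact mul_le_one₀ (h i) (abs_nonneg _) (h j)
  rw [proj, Matrix.sub_apply, Matrix.vecMulVec_apply]
  exact (abs_sub _ _).trans (by linarith)

theorem continuousOn_proj {y : ℝ → R3} {s : Set ℝ} (hy : ContinuousOn y s) :
    ContinuousOn (fun t => proj (y t)) s := by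
  refine continuousOn_matrix.2 fun i j => ?_
  have h : ∀ k, ContinuousOn (fun t => (y t) k) s := fun k =>
    (PiLp.continuous_apply 2 (fun _ : Fin 3 => ℝ) k).comp_continuousOn hy
  simp only [proj, Matrix.sub_apply, Matrix.vecMulVec_apply]
  exact continuousOn_const.sub ((h i).mul (h j))

theorem intervalIntegrable_of_continuousOn_Ici {g : ℝ → ℝ} (hg : ContinuousOn g (Ici 0)) {a b : ℝ}
    (ha : 0 ≤ a) (hb : 0 ≤ b) : IntervalIntegrable g MeasureTheory.volume a b :=
  (hg.mono fun _ hs => mem_Ici.2 ((le_min ha hb).trans hs.1)).intervalIntegrable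

theorem dotProduct_matIntegral_mulVec {m n : Type*} [Fintype m] [Fintype n] {X : ℝ → Matrix m n ℝ}
    (hX : ContinuousOn X (Ici 0)) {a b : ℝ} (ha : 0 ≤ a) (hb : 0 ≤ b) (u : m → ℝ) (v : n → ℝ) :
    u ⬝ᵥ matIntegral a b X *ᵥ v = ∫ s in a..b, u ⬝ᵥ X s *ᵥ v := by
  have hc : ∀ i j, ContinuousOn (fun s => X s i j * v j) (Ici 0) := fun i j =>
    (continuousOn_matrix.1 hX i j).mul continuousOn_const
  have hint : ∀ i j, IntervalIntegrable (fun s => X s i j * v j) MeasureTheory.volume a b :=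
    fun i j => intervalIntegrable_of_continuousOn_Ici (hc i j) ha hb
  have hint' : ∀ i, IntervalIntegrable (fun s => u i * ∑ j, X s i j * v j)
      MeasureTheory.volume a b := fun i => intervalIntegrable_of_continuousOn_Ici
    (continuousOn_const.mul (continuousOn_finsetSum _ fun j _ => hc i j)) ha hb
  simp only [dotProduct, Matrix.mulVec, matIntegral, Matrix.of_apply]
  rw [intervalIntegral.integral_finsetSum fun i _ => hint' i]
  refine Finset.sum_congr rfl fun i _ => ?_
  rw [intervalIntegral.integral_const_mul, intervalIntegral.integral_finsetSum fun j _ => hint i j]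
  simp only [intervalIntegral.integral_mul_const]

/-- `|π_y v|²`. -/
def projSq (y : R3) (v : Fin 3 → ℝ) : ℝ := (proj y *ᵥ v) ⬝ᵥ (proj y *ᵥ v)

theorem projSq_nonneg (y : R3) (v : Fin 3 → ℝ) : 0 ≤ projSq y v := dotProduct_self_nonneg' _

theorem half_projSq_sub_le {y : R3} (hy : ‖y‖ = 1) (u v : Fin 3 → ℝ) :
    1 / 2 * projSq y u - v ⬝ᵥ v ≤ projSq y (u + v) := by
  have h1 := dotProduct_add_self_le (proj y *ᵥ (u + v)) (-(proj y *ᵥ v))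
  rw [← Matrix.mulVec_neg, ← Matrix.mulVec_add, add_neg_cancel_right, Matrix.mulVec_neg,
    neg_dotProduct_neg] at h1
  have h2 := proj_mulVec_self_le hy v
  simp only [projSq]
  linarith

variable {y₀ : ℝ → R3}

theorem continuousOn_projSq (hy : ContinuousOn y₀ (Ici 0)) {v : ℝ → Fin 3 → ℝ}
    (hv : ContinuousOn v (Ici 0)) : ContinuousOn (fun s => projSq (y₀ s) (v s)) (Ici 0) :=
  ((continuousOn_proj hy).matrix_mulVec hv).dotProduct ((continuousOn_proj hy).matrix_mulVec hv)

theorem integral_le_of_subinterval {g : ℝ → ℝ} (hg : ContinuousOn g (Ici 0))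
    (h0 : ∀ s, 0 ≤ g s) {a b c d : ℝ} (ha : 0 ≤ a) (hac : a ≤ c) (hcd : c ≤ d) (hdb : d ≤ b) :
    ∫ s in c..d, g s ≤ ∫ s in a..b, g s :=
  intervalIntegral.integral_mono_interval hac hcd hdb (Filter.Eventually.of_forall h0)
    (intervalIntegrable_of_continuousOn_Ici hg ha (ha.trans (hac.trans (hcd.trans hdb))))

theorem continuousOn_line (a b : Fin 3 → ℝ) (t : ℝ) (s : Set ℝ) :
    ContinuousOn (fun σ : ℝ => a + (σ - t) • b) s := by fun_prop

/-- Persistent excitation of the bearing, as a bound on `∫ |π_{y₀} v|²`. -/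
def BearingExcited (y₀ : ℝ → R3) (δ κ : ℝ) : Prop :=
  ∀ t, 0 ≤ t → ∀ v : Fin 3 → ℝ, κ * (v ⬝ᵥ v) ≤ ∫ s in t..t + δ, projSq (y₀ s) v

/-- On one window, a line moving with velocity `b` is nearly as visible as its initial point. -/
theorem BearingExcited.line_lower {δ κ : ℝ} (hPE : BearingExcited y₀ δ κ) (hδ : 0 < δ)
    (hy : ContinuousOn y₀ (Ici 0)) (hy1 : ∀ t, 0 ≤ t → ‖y₀ t‖ = 1) {t : ℝ} (ht : 0 ≤ t)
    (a b : Fin 3 → ℝ) :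
    κ / 2 * (a ⬝ᵥ a) - δ ^ 3 * (b ⬝ᵥ b)
      ≤ ∫ s in t..t + δ, projSq (y₀ s) (a + (s - t) • b) := by
  have htδ : 0 ≤ t + δ := by linarith
  have i1 := intervalIntegrable_of_continuousOn_Ici
    (continuousOn_projSq hy (continuousOn_const (c := a))) ht htδ
  have i2 := intervalIntegrable_of_continuousOn_Ici
    (continuousOn_projSq hy (continuousOn_line a b t _)) ht htδ
  have h := intervalIntegral.integral_mono_on (by linarith : t ≤ t + δ)
    ((i1.const_mul (1 / 2)).sub (intervalIntegrable_const (c := δ ^ 2 * (b ⬝ᵥ b)))) i2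
    fun s hs => by
      refine le_trans ?_ (half_projSq_sub_le (hy1 s (ht.trans hs.1)) a ((s - t) • b))
      have h1 : (s - t) ^ 2 ≤ δ ^ 2 :=
        pow_le_pow_left₀ (sub_nonneg.2 hs.1) (by linarith [hs.2]) 2
      have h2 := mul_le_mul_of_nonneg_right h1 (dotProduct_self_nonneg' b)
      simp only [smul_dotProduct, dotProduct_smul, smul_eq_mul]
      linarith
  rw [intervalIntegral.integral_sub (i1.const_mul _) intervalIntegrable_const,
    intervalIntegral.integral_const_mul, intervalIntegral.integral_const, smul_eq_mul] at h
  have h3 := hPE t ht a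
  refine le_trans ?_ h
  have : (t + δ - t) * (δ ^ 2 * (b ⬝ᵥ b)) = δ ^ 3 * (b ⬝ᵥ b) := by ring
  linarith

/-- On a window long enough, no nonzero line `a + (s - t) b` stays along the bearing. On a single
window of length `δ` this fails for the bearing of a uniform motion; but over `N` windows a line
with `b ≠ 0` is far from the origin, compared to its displacement during one window, at the beginning
or at the end. -/
theorem BearingExcited.exists_line_lower {δ κ : ℝ} (hPE : BearingExcited y₀ δ κ) (hδ : 0 < δ)
    (hκ : 0 < κ) (hy : ContinuousOn y₀ (Ici 0)) (hy1 : ∀ t, 0 ≤ t → ‖y₀ t‖ = 1) :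
    ∃ N : ℕ, ∃ c : ℝ, 0 < c ∧ ∀ t, 0 ≤ t → ∀ a b : Fin 3 → ℝ,
      c * (a ⬝ᵥ a + b ⬝ᵥ b) ≤ ∫ s in t..t + (N * δ + δ), projSq (y₀ s) (a + (s - t) • b) := by
  obtain ⟨N, hN⟩ := exists_nat_gt (max 1 (16 * δ / κ))
  have hN1 : (1 : ℝ) < N := (le_max_left _ _).trans_lt hN
  have hNκ : 16 * δ / κ < N := (le_max_right _ _).trans_lt hN
  rw [div_lt_iff₀ hκ] at hNκ
  have hN2 : 16 * δ ≤ N ^ 2 * κ := by nlinarith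
  refine ⟨N, min (κ / 8) (κ / 16 * (N * δ) ^ 2), by positivity, fun t ht a b => ?_⟩
  set a' := a + (N * δ) • b with ha'
  have hcont := continuousOn_projSq hy (continuousOn_line a b t (Ici 0))
  have hNδ : 0 < N * δ := by positivity
  have h0 := hPE.line_lower hδ hy hy1 ht a b
  have h1 := hPE.line_lower hδ hy hy1 (by positivity : 0 ≤ t + N * δ) a' b
  have e : ∀ s : ℝ, a' + (s - (t + N * δ)) • b = a + (s - t) • b := fun s => by
    rw [ha', add_assoc, ← add_smul]; congr 2; ring
  simp only [e] at h1
  have hsplit : (∫ s in t..t + δ, projSq (y₀ s) (a + (s - t) • b)) +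
      (∫ s in t + N * δ..t + N * δ + δ, projSq (y₀ s) (a + (s - t) • b))
      ≤ ∫ s in t..t + (N * δ + δ), projSq (y₀ s) (a + (s - t) • b) := by
    have hδN : t + δ ≤ t + N * δ := by nlinarith
    have i := fun {p q : ℝ} (hp : 0 ≤ p) (hq : 0 ≤ q) =>
      intervalIntegrable_of_continuousOn_Ici hcont hp hq
    rw [← intervalIntegral.integral_add_adjacent_intervals (a := t) (b := t + δ)
      (c := t + (N * δ + δ)) (i (by linarith)
      (by linarith)) (i (by linarith) (by linarith))]
    have := integral_le_of_subinterval hcont (fun s => projSq_nonneg _ _) (a := t + δ)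
      (b := t + (N * δ + δ)) (c := t + N * δ) (d := t + N * δ + δ) (by linarith) hδN (by linarith)
      (by linarith)
    linarith
  have hb : (N * δ) ^ 2 * (b ⬝ᵥ b) ≤ 2 * (a ⬝ᵥ a) + 2 * (a' ⬝ᵥ a') := by
    have h := dotProduct_add_self_le a' (-a)
    rw [ha', add_neg_cancel_comm, neg_dotProduct_neg, smul_dotProduct, dotProduct_smul] at h
    simp only [smul_eq_mul] at h
    rw [← ha'] at h
    linarith
  have haa := dotProduct_self_nonneg' a
  have haa' := dotProduct_self_nonneg' a'
  have hbb := dotProduct_self_nonneg' b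
  have hb2 : 2 * (δ ^ 3 * (b ⬝ᵥ b)) ≤ κ / 4 * (a ⬝ᵥ a + a' ⬝ᵥ a') := by
    have h2 : 16 * δ * (δ ^ 2 * (b ⬝ᵥ b)) ≤ N ^ 2 * κ * (δ ^ 2 * (b ⬝ᵥ b)) := by gcongr
    have h3 := mul_le_mul_of_nonneg_left hb hκ.le
    nlinarith
  have hm1 : min (κ / 8) (κ / 16 * (N * δ) ^ 2) * (a ⬝ᵥ a) ≤ κ / 8 * (a ⬝ᵥ a) := by
    gcongr; exact min_le_left _ _
  have hm2 : min (κ / 8) (κ / 16 * (N * δ) ^ 2) * (b ⬝ᵥ b) ≤ κ / 16 * (N * δ) ^ 2 * (b ⬝ᵥ b) := by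
    gcongr; exact min_le_right _ _
  nlinarith

/-- The point `a + s b` of the line is a multiple of `y₀(s)`, possibly zero, for all `s ∈ I`. -/
def AlongBearing (y₀ : ℝ → R3) (a b : Fin 3 → ℝ) (I : Set ℝ) : Prop :=
  ∀ s ∈ I, proj (y₀ s) *ᵥ (a + s • b) = 0

theorem projSq_eq_zero_iff {y : R3} {v : Fin 3 → ℝ} : projSq y v = 0 ↔ proj y *ᵥ v = 0 :=
  dotProduct_self_eq_zero

theorem exists_smul_of_cross_eq_zero {a b : Fin 3 → ℝ} (ha : a ≠ 0) (h : a ⨯₃ b = 0) :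
    ∃ k : ℝ, b = k • a := by
  have h1 : ¬ LinearIndependent ℝ ![a, b] := fun h2 =>
    crossProduct_ne_zero_iff_linearIndependent.2 h2 h
  rw [LinearIndependent.pair_iff' ha] at h1
  push Not at h1
  obtain ⟨k, hk⟩ := h1
  exact ⟨k, hk.symm⟩

/-- A nonzero line along an excited bearing does not pass through the origin: otherwise the bearing
would be constant. -/
theorem BearingExcited.cross_ne_zero {δ κ : ℝ} (hPE : BearingExcited y₀ δ κ) (hκ : 0 < κ) {t : ℝ}
    (hδ : 0 < δ) (ht : 0 ≤ t) {a b : Fin 3 → ℝ} (hab : a ≠ 0 ∨ b ≠ 0)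
    (h : AlongBearing y₀ a b (Icc t (t + δ))) : a ⨯₃ b ≠ 0 := by
  -- a direction along the bearing at almost all times contradicts excitation
  have key : ∀ (v : Fin 3 → ℝ) (σ : ℝ), v ≠ 0 →
      (∀ s ∈ Icc t (t + δ), s ≠ σ → proj (y₀ s) *ᵥ v = 0) → False := fun v σ hv hs => by
    have h1 := hPE t ht v
    have h2 : ∫ s in t..t + δ, projSq (y₀ s) v = ∫ s in t..t + δ, (0 : ℝ) := by
      refine intervalIntegral.integral_congr_ae ?_
      filter_upwards [MeasureTheory.compl_mem_ae_iff.2 (MeasureTheory.measure_singleton σ)] with s hsσ hsI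
      rw [uIoc_of_le (by linarith)] at hsI
      exact projSq_eq_zero_iff.2 (hs s ⟨hsI.1.le, hsI.2⟩ hsσ)
    rw [h2, intervalIntegral.integral_zero] at h1
    nlinarith [dotProduct_self_pos hv]
  intro hc
  by_cases hb : b = 0
  · subst hb
    refine key a 0 (by simpa using hab) fun s hs _ => ?_
    simpa using h s hs
  · rw [← cross_anticomm, neg_eq_zero] at hc
    obtain ⟨k, rfl⟩ := exists_smul_of_cross_eq_zero hb hc
    refine key b (-k) hb fun s hs hsk => ?_
    have h1 := h s hs
    rw [← add_smul, Matrix.mulVec_smul, smul_eq_zero] at h1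
    exact h1.resolve_left fun h2 => hsk (by linarith)

theorem quadratic_coeffs_eq_zero {p q k s h : ℝ} (hh : h ≠ 0)
    (h0 : p + s * q + s ^ 2 * k = 0) (h1 : p + (s + h) * q + (s + h) ^ 2 * k = 0)
    (h2 : p + (s + 2 * h) * q + (s + 2 * h) ^ 2 * k = 0) : p = 0 ∧ q = 0 ∧ k = 0 := by
  have hk : k = 0 := by
    have : 2 * h ^ 2 * k = 0 := by linear_combination h0 - 2 * h1 + h2
    simpa [hh] using this
  subst hk
  have hq : q = 0 := by
    have : h * q = 0 := by linear_combination h1 - h0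
    simpa [hh] using this
  subst hq
  exact ⟨by linarith, rfl, rfl⟩

theorem cross_eq_zero_of_proj_eq_zero {y : R3} {u v : Fin 3 → ℝ} (hu : proj y *ᵥ u = 0)
    (hv : proj y *ᵥ v = 0) : u ⨯₃ v = 0 := by
  rw [proj_mulVec, sub_eq_zero] at hu hv
  rw [hu, hv]
  simp

/-- Two lines not through the origin, both along the bearing during a common interval, agree up to
scaling: the cross product of their points is a polynomial in time that vanishes on that
interval. -/
theorem AlongBearing.exists_smul {a b c d : Fin 3 → ℝ} {r h : ℝ} (hh : 0 < h)
    (hab : a ⨯₃ b ≠ 0) (hcd : c ⨯₃ d ≠ 0) (h1 : AlongBearing y₀ a b (Icc r (r + 2 * h)))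
    (h2 : AlongBearing y₀ c d (Icc r (r + 2 * h))) : ∃ k : ℝ, k ≠ 0 ∧ c = k • a ∧ d = k • b := by
  have hpoly : ∀ s ∈ Icc r (r + 2 * h), ∀ i,
      (a ⨯₃ c) i + s * (a ⨯₃ d + b ⨯₃ c) i + s ^ 2 * (b ⨯₃ d) i = 0 := fun s hs i => by
    have := congrFun (cross_eq_zero_of_proj_eq_zero (h1 s hs) (h2 s hs)) i
    simp only [map_add, map_smul, LinearMap.add_apply, LinearMap.smul_apply, Pi.add_apply,
      Pi.smul_apply, smul_eq_mul, Pi.zero_apply] at this ⊢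
    linear_combination this
  have hco := fun i => quadratic_coeffs_eq_zero hh.ne' (hpoly r ⟨le_rfl, by linarith⟩ i)
    (hpoly (r + h) ⟨by linarith, by linarith⟩ i) (hpoly (r + 2 * h) ⟨by linarith, le_rfl⟩ i)
  have ha : a ≠ 0 := by rintro rfl; simp at hab
  have hb : b ≠ 0 := by rintro rfl; simp at hab
  obtain ⟨k, rfl⟩ := exists_smul_of_cross_eq_zero ha (funext fun i => (hco i).1)
  obtain ⟨k', rfl⟩ := exists_smul_of_cross_eq_zero hb (funext fun i => (hco i).2.2)
  have hkk : k' = k := by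
    have h3 : a ⨯₃ (k' • b) + b ⨯₃ (k • a) = 0 := funext fun i => (hco i).2.1
    rw [map_smul, map_smul, ← cross_anticomm a b, smul_neg, ← sub_eq_add_neg, ← sub_smul,
      smul_eq_zero] at h3
    exact sub_eq_zero.1 (h3.resolve_right hab)
  subst hkk
  refine ⟨k', ?_, rfl, rfl⟩
  rintro rfl
  simp at hcd

/-- If every window starting at `t + j δ / 2` carries a nonzero line along the bearing, then one and
the same line is along the bearing during the union of the windows. -/
theorem BearingExcited.exists_common_line {δ κ : ℝ} (hPE : BearingExcited y₀ δ κ) (hκ : 0 < κ)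
    (hδ : 0 < δ) {t : ℝ} (ht : 0 ≤ t) (k : ℕ)
    (h : ∀ j : ℕ, j ≤ k → ∃ a b : Fin 3 → ℝ, (a ≠ 0 ∨ b ≠ 0) ∧
      AlongBearing y₀ a b (Icc (t + j * (δ / 2)) (t + j * (δ / 2) + δ))) :
    ∃ a b : Fin 3 → ℝ, a ⨯₃ b ≠ 0 ∧ AlongBearing y₀ a b (Icc t (t + k * (δ / 2) + δ)) := by
  induction k with
  | zero =>
    obtain ⟨a, b, hab, hl⟩ := h 0 le_rfl
    simp only [Nat.cast_zero, zero_mul, add_zero] at hl ⊢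
    exact ⟨a, b, hPE.cross_ne_zero hκ hδ ht hab hl, hl⟩
  | succ k ih =>
    obtain ⟨a, b, hab, hl⟩ := ih fun j hj => h j (hj.trans k.le_succ)
    obtain ⟨c, d, hcd, hl'⟩ := h (k + 1) le_rfl
    have hk0 : (0 : ℝ) ≤ k * (δ / 2) := by positivity
    push_cast at hl' ⊢
    have hcd' := hPE.cross_ne_zero hκ hδ (by nlinarith : 0 ≤ t + (k + 1) * (δ / 2)) hcd hl'
    have e : t + (k + 1) * (δ / 2) + 2 * (δ / 4) = t + k * (δ / 2) + δ := by ring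
    obtain ⟨l, hl0, rfl, rfl⟩ := AlongBearing.exists_smul (r := t + (k + 1) * (δ / 2))
      (h := δ / 4) (by positivity) hab hcd'
      (fun s hs => hl s ⟨by nlinarith [hs.1], by rw [← e]; exact hs.2⟩)
      (fun s hs => hl' s ⟨hs.1, by linarith [hs.2]⟩)
    refine ⟨a, b, hab, fun s hs => ?_⟩
    rcases le_total s (t + k * (δ / 2) + δ) with h1 | h1
    · exact hl s ⟨hs.1, h1⟩
    · have h2 := hl' s ⟨by linarith, hs.2⟩
      rw [smul_comm s l b, ← smul_add, Matrix.mulVec_smul, smul_eq_zero] at h2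
      exact h2.resolve_left hl0

end BearingLines

/-! ### Kronecker products with rows and columns -/

section RowCol

variable {l m n : Type*}

theorem rowKron_mulVec [Fintype m] [Fintype n] (r : n → ℝ) (X : Matrix l m ℝ) (v : n × m → ℝ) :
    rowKron r X *ᵥ v = X *ᵥ fun i => ∑ j, r j * v (j, i) := by
  ext i
  simp only [rowKron, Matrix.mulVec, dotProduct, Matrix.submatrix_apply, Matrix.kroneckerMap_apply,
    Matrix.replicateRow_apply, Fintype.sum_prod_type, id, Finset.mul_sum]
  rw [Finset.sum_comm]
  exact Finset.sum_congr rfl fun _ _ => Finset.sum_congr rfl fun _ _ => by ring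

theorem rowKron_one_mulVec [Fintype m] [Fintype n] [DecidableEq m] (r : n → ℝ) (v : n × m → ℝ) :
    rowKron r (1 : Matrix m m ℝ) *ᵥ v = fun i => ∑ j, r j * v (j, i) := by
  rw [rowKron_mulVec, Matrix.one_mulVec]

theorem dotProduct_colKron_mulVec [Fintype l] [Fintype m] [Fintype n] [DecidableEq m]
    (c : n → ℝ) (X : Matrix m l ℝ) (u : n × m → ℝ) (w : l → ℝ) :
    u ⬝ᵥ colKron c X *ᵥ w = (rowKron c (1 : Matrix m m ℝ) *ᵥ u) ⬝ᵥ (X *ᵥ w) := by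
  rw [rowKron_one_mulVec]
  simp only [colKron, Matrix.mulVec, dotProduct, Matrix.submatrix_apply, Matrix.kroneckerMap_apply,
    Matrix.replicateCol_apply, Fintype.sum_prod_type, id, Finset.mul_sum, Finset.sum_mul]
  rw [Finset.sum_comm]
  refine Finset.sum_congr rfl fun i _ => ?_
  rw [Finset.sum_comm]
  exact Finset.sum_congr rfl fun _ _ => Finset.sum_congr rfl fun _ _ => by ring

theorem colKron_mul_rowKron_one [Fintype m] [DecidableEq m] (c c' : n → ℝ) (X : Matrix m m ℝ) :
    colKron c (X * rowKron c' (1 : Matrix m m ℝ)) = Matrix.vecMulVec c c' ⊗ₖ X := by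
  ext ⟨i, j⟩ ⟨i', j'⟩
  simp [colKron, rowKron, Matrix.mul_apply, Matrix.vecMulVec_apply, Matrix.one_apply]
  ring

theorem continuousOn_rowKron {α : Type*} [TopologicalSpace α] {s : Set α} {r : α → n → ℝ}
    (hr : ContinuousOn r s) (X : Matrix l m ℝ) : ContinuousOn (fun t => rowKron (r t) X) s :=
  continuousOn_matrix.2 fun _ j => (continuousOn_pi.1 hr j.1).mul continuousOn_const

theorem continuousOn_colKron {α : Type*} [TopologicalSpace α] {s : Set α} {c : α → n → ℝ}
    {X : α → Matrix l m ℝ} (hc : ContinuousOn c s) (hX : ContinuousOn X s) :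
    ContinuousOn (fun t => colKron (c t) (X t)) s :=
  continuousOn_matrix.2 fun i j => (continuousOn_pi.1 hc i.1).mul (continuousOn_matrix.1 hX i.2 j)

end RowCol

/-! ### The displacement caused by the target acceleration -/

section Displacement

/-- The velocity `-∫ₜˢ az(τ) dτ` gained from time `t` to time `s`. -/
noncomputable def targetVelocity (az : ℝ → R3) (s t : ℝ) : Fin 3 → ℝ :=
  fun j => -∫ τ in t..s, az τ j

/-- The displacement `∫ₜˢ (τ - s) az(τ) dτ` from time `t` to time `s`, the row of `Λ_T`. -/
noncomputable def targetDisplacement (az : ℝ → R3) (s t : ℝ) : Fin 3 → ℝ :=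
  fun j => ∫ τ in t..s, (τ - s) * az τ j

variable {az : ℝ → R3}

theorem LambdaT_eq (s t : ℝ) : LambdaT az s t = rowKron (targetDisplacement az s t) 1 := rfl

theorem continuousOn_coord (hz : ContinuousOn az (Ici 0)) (j : Fin 3) :
    ContinuousOn (fun τ => az τ j) (Ici 0) :=
  (PiLp.continuous_apply 2 (fun _ : Fin 3 => ℝ) j).comp_continuousOn hz

theorem continuousOn_mul_coord (hz : ContinuousOn az (Ici 0)) (j : Fin 3) :
    ContinuousOn (fun τ => τ * az τ j) (Ici 0) := continuousOn_id.mul (continuousOn_coord hz j)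

theorem targetVelocity_eq (hz : ContinuousOn az (Ici 0)) {s t : ℝ} (hs : 0 ≤ s) (ht : 0 ≤ t)
    (j : Fin 3) :
    targetVelocity az s t j = -((∫ τ in (0 : ℝ)..s, az τ j) - ∫ τ in (0 : ℝ)..t, az τ j) := by
  have i := fun {p q : ℝ} (hp : 0 ≤ p) (hq : 0 ≤ q) =>
    intervalIntegrable_of_continuousOn_Ici (continuousOn_coord hz j) hp hq
  rw [targetVelocity, intervalIntegral.integral_interval_sub_left (i le_rfl hs) (i le_rfl ht)]

theorem targetDisplacement_eq (hz : ContinuousOn az (Ici 0)) {s t : ℝ} (hs : 0 ≤ s) (ht : 0 ≤ t)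
    (j : Fin 3) :
    targetDisplacement az s t j
      = ((∫ τ in (0 : ℝ)..s, τ * az τ j) - ∫ τ in (0 : ℝ)..t, τ * az τ j)
        - s * ((∫ τ in (0 : ℝ)..s, az τ j) - ∫ τ in (0 : ℝ)..t, az τ j) := by
  have i := fun {p q : ℝ} (hp : 0 ≤ p) (hq : 0 ≤ q) =>
    intervalIntegrable_of_continuousOn_Ici (continuousOn_coord hz j) hp hq
  have i' := fun {p q : ℝ} (hp : 0 ≤ p) (hq : 0 ≤ q) =>
    intervalIntegrable_of_continuousOn_Ici (continuousOn_mul_coord hz j) hp hq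
  rw [intervalIntegral.integral_interval_sub_left (i le_rfl hs) (i le_rfl ht),
    intervalIntegral.integral_interval_sub_left (i' le_rfl hs) (i' le_rfl ht),
    ← intervalIntegral.integral_const_mul,
    ← intervalIntegral.integral_sub (i' ht hs) ((i ht hs).const_mul s)]
  simp only [targetDisplacement, sub_mul]

/-- Restarting the motion at time `r`. -/
theorem targetDisplacement_add (hz : ContinuousOn az (Ici 0)) {r s t : ℝ} (hr : 0 ≤ r)
    (hs : 0 ≤ s) (ht : 0 ≤ t) :
    targetDisplacement az s t = targetDisplacement az r t + (s - r) • targetVelocity az r t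
      + targetDisplacement az s r := by
  ext j
  simp only [Pi.add_apply, Pi.smul_apply, smul_eq_mul, targetDisplacement_eq hz hs ht,
    targetDisplacement_eq hz hr ht, targetDisplacement_eq hz hs hr, targetVelocity_eq hz hr ht]
  ring

theorem targetDisplacement_self (t : ℝ) : targetDisplacement az t t = 0 := by
  ext j; simp [targetDisplacement]

theorem targetVelocity_self (t : ℝ) : targetVelocity az t t = 0 := by
  ext j; simp [targetVelocity]

theorem targetVelocity_swap (s t : ℝ) : targetVelocity az s t = -targetVelocity az t s := by
  ext j
  simp only [targetVelocity, Pi.neg_apply, neg_neg]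
  rw [intervalIntegral.integral_symm, neg_neg]

theorem targetVelocity_hasDeriv_left (hz : ContinuousOn az (Ici 0)) {s t : ℝ} (hs : 0 ≤ s)
    (ht : 0 ≤ t) (j : Fin 3) :
    HasDerivWithinAt (fun σ => targetVelocity az σ t j) (-az s j) (Ici 0) s :=
  (hasDerivWithinAt_integral_Ici (continuousOn_coord hz j) ht hs).neg

theorem targetVelocity_hasDeriv_right (hz : ContinuousOn az (Ici 0)) {s t : ℝ} (hs : 0 ≤ s)
    (ht : 0 ≤ t) (j : Fin 3) :
    HasDerivWithinAt (fun σ => targetVelocity az t σ j) (az s j) (Ici 0) s := by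
  have h := (targetVelocity_hasDeriv_left hz hs ht j).neg
  simp only [neg_neg] at h
  refine h.congr (fun σ _ => ?_) ?_ <;> rw [targetVelocity_swap] <;> rfl

theorem targetDisplacement_hasDeriv_left (hz : ContinuousOn az (Ici 0)) {s t : ℝ} (hs : 0 ≤ s)
    (ht : 0 ≤ t) (j : Fin 3) :
    HasDerivWithinAt (fun σ => targetDisplacement az σ t j) (targetVelocity az s t j)
      (Ici 0) s := by
  have h0 := hasDerivWithinAt_integral_Ici (continuousOn_coord hz j) le_rfl hs
  have h1 := hasDerivWithinAt_integral_Ici (continuousOn_mul_coord hz j) le_rfl hs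
  have h := (h1.sub_const (∫ τ in (0 : ℝ)..t, τ * az τ j)).sub
    ((hasDerivWithinAt_id s (Ici 0)).mul (h0.sub_const (∫ τ in (0 : ℝ)..t, az τ j)))
  refine (h.congr_deriv ?_).congr (fun σ hσ => targetDisplacement_eq hz hσ ht j)
    (targetDisplacement_eq hz hs ht j)
  rw [targetVelocity_eq hz hs ht]
  simp only [id]
  ring

theorem targetDisplacement_hasDeriv_right (hz : ContinuousOn az (Ici 0)) {s t : ℝ} (hs : 0 ≤ s)
    (ht : 0 ≤ t) (j : Fin 3) :
    HasDerivWithinAt (fun σ => targetDisplacement az t σ j) ((t - s) * az s j) (Ici 0) s := by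
  have h0 := hasDerivWithinAt_integral_Ici (continuousOn_coord hz j) le_rfl hs
  have h1 := hasDerivWithinAt_integral_Ici (continuousOn_mul_coord hz j) le_rfl hs
  have h := (h1.const_sub (∫ τ in (0 : ℝ)..t, τ * az τ j)).sub
    ((h0.const_sub (∫ τ in (0 : ℝ)..t, az τ j)).const_mul t)
  refine (h.congr_deriv (by ring)).congr (fun σ hσ => targetDisplacement_eq hz ht hσ j)
    (targetDisplacement_eq hz ht hs j)

theorem abs_coord_le {K : ℝ} {v : R3} (hv : ‖v‖ ≤ K) (j : Fin 3) : |v j| ≤ K :=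
  (by simpa using PiLp.norm_apply_le v j : |v j| ≤ ‖v‖).trans hv

theorem abs_targetVelocity_le {K L : ℝ} (hK : ∀ t, 0 ≤ t → ‖az t‖ ≤ K) {s t : ℝ} (hs : 0 ≤ s)
    (ht : 0 ≤ t) (hst : |s - t| ≤ L) (j : Fin 3) : |targetVelocity az s t j| ≤ K * L := by
  have hK0 : 0 ≤ K := (norm_nonneg _).trans (hK 0 le_rfl)
  have h := intervalIntegral.norm_integral_le_of_norm_le_const (f := fun τ => az τ j) (a := t)
    (b := s) (C := K) fun τ hτ => abs_coord_le (hK τ ((le_min ht hs).trans hτ.1.le)) j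
  rw [targetVelocity, abs_neg]
  exact h.trans (by gcongr)

theorem abs_targetDisplacement_le {K L : ℝ} (hK : ∀ t, 0 ≤ t → ‖az t‖ ≤ K) {s t : ℝ}
    (hs : 0 ≤ s) (ht : 0 ≤ t) (hst : |s - t| ≤ L) (j : Fin 3) :
    |targetDisplacement az s t j| ≤ L * K * L := by
  have hK0 : 0 ≤ K := (norm_nonneg _).trans (hK 0 le_rfl)
  have hL0 : 0 ≤ L := (abs_nonneg _).trans hst
  have h := intervalIntegral.norm_integral_le_of_norm_le_const (f := fun τ => (τ - s) * az τ j)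
    (a := t) (b := s) (C := L * K) fun τ hτ => by
      rw [norm_mul]
      refine mul_le_mul ?_ (abs_coord_le (hK τ ((le_min ht hs).trans hτ.1.le)) j)
        (norm_nonneg _) hL0
      rw [Real.norm_eq_abs, abs_sub_comm]
      refine le_trans ?_ hst
      have h1 := uIoc_subset_uIcc hτ
      rw [uIcc_comm] at h1
      rw [abs_sub_comm, abs_sub_comm s t]
      exact abs_sub_left_of_mem_uIcc h1
  exact h.trans (by gcongr)

theorem continuousOn_LambdaT (hz : ContinuousOn az (Ici 0)) {t : ℝ} (ht : 0 ≤ t) :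
    ContinuousOn (fun s => LambdaT az s t) (Ici 0) :=
  continuousOn_rowKron (continuousOn_pi.2 fun j _ hs =>
    (targetDisplacement_hasDeriv_left hz hs ht j).continuousWithinAt) 1

theorem abs_LambdaT_le {K L : ℝ} (hK : ∀ t, 0 ≤ t → ‖az t‖ ≤ K) {s t : ℝ} (hs : 0 ≤ s)
    (ht : 0 ≤ t) (hst : |s - t| ≤ L) (i : Fin 3) (j : Fin 3 × Fin 3) :
    |LambdaT az s t i j| ≤ L * K * L := by
  have e : LambdaT az s t i j
      = targetDisplacement az s t j.1 * (1 : Matrix (Fin 3) (Fin 3) ℝ) i j.2 := rfl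
  have h := abs_targetDisplacement_le hK hs ht hst j.1
  rw [e, abs_mul, Matrix.one_apply]
  split_ifs
  · simpa using h
  · simpa using (abs_nonneg _).trans h

end Displacement

/-! ### Uniform observability of the displacement -/

section Energy

variable {az y₀ : ℝ → R3} {δ : ℝ}

/-- `[I₃  (s - t) I₃] u`. -/
theorem rowKron_one_sub_mulVec (r : ℝ) (u : Fin 2 × Fin 3 → ℝ) :
    rowKron ![1, r] (1 : Matrix (Fin 3) (Fin 3) ℝ) *ᵥ u
      = (fun i => u (0, i)) + r • fun i => u (1, i) := by
  rw [rowKron_one_mulVec]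
  ext i
  simp [Fin.sum_univ_two]

theorem continuousOn_one_sub (t : ℝ) (S : Set ℝ) :
    ContinuousOn (fun s : ℝ => ![1, s - t]) S := by
  refine continuousOn_pi.2 fun k => ?_
  fin_cases k
  · exact continuousOn_const
  · exact continuousOn_id.sub continuousOn_const

theorem LambdaPi_eq (t δ : ℝ) : LambdaPi y₀ t δ = matIntegral t (t + δ) fun s =>
    colKron ![1, s - t] (proj (y₀ s) * rowKron ![1, s - t] (1 : Matrix (Fin 3) (Fin 3) ℝ)) := by
  have : ∀ r : ℝ, !![1, r; r, r ^ 2] = Matrix.vecMulVec ![1, r] ![1, r] := fun r => by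
    ext i j; fin_cases i <;> fin_cases j <;> simp [Matrix.vecMulVec_apply, pow_two]
  simp only [colKron_mul_rowKron_one, LambdaPi, this]

theorem dotProduct_LambdaPi_mulVec (hy : ContinuousOn y₀ (Ici 0)) {t : ℝ} (ht : 0 ≤ t)
    (hδ : 0 < δ) (u v : Fin 2 × Fin 3 → ℝ) :
    u ⬝ᵥ LambdaPi y₀ t δ *ᵥ v = ∫ s in t..t + δ, (rowKron ![1, s - t] 1 *ᵥ u) ⬝ᵥ
      proj (y₀ s) *ᵥ (rowKron ![1, s - t] (1 : Matrix (Fin 3) (Fin 3) ℝ) *ᵥ v) := by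
  have hc := continuousOn_one_sub t (Ici 0)
  rw [LambdaPi_eq, dotProduct_matIntegral_mulVec (continuousOn_colKron hc
    ((continuousOn_proj hy).matrix_mul (continuousOn_rowKron hc 1))) ht (by linarith)]
  simp only [dotProduct_colKron_mulVec, ← Matrix.mulVec_mulVec]

theorem dotProduct_crossBlock_mulVec (hz : ContinuousOn az (Ici 0)) (hy : ContinuousOn y₀ (Ici 0))
    {t : ℝ} (ht : 0 ≤ t) (hδ : 0 < δ) (u : Fin 2 × Fin 3 → ℝ) (w : Fin 3 × Fin 3 → ℝ) :
    u ⬝ᵥ crossBlock az y₀ t δ *ᵥ w = ∫ s in t..t + δ, (rowKron ![1, s - t] 1 *ᵥ u) ⬝ᵥ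
      proj (y₀ s) *ᵥ (LambdaT az s t *ᵥ w) := by
  rw [crossBlock, dotProduct_matIntegral_mulVec (continuousOn_colKron (continuousOn_one_sub t _)
    ((continuousOn_proj hy).matrix_mul (continuousOn_LambdaT hz ht))) ht (by linarith)]
  simp only [dotProduct_colKron_mulVec, ← Matrix.mulVec_mulVec]

/-- A window on which `Λ_π` is singular carries a nonzero line along the bearing. -/
theorem exists_line_of_det_eq_zero (hy : ContinuousOn y₀ (Ici 0))
    (hy1 : ∀ t, 0 ≤ t → ‖y₀ t‖ = 1) {t : ℝ} (ht : 0 ≤ t) (hδ : 0 < δ)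
    (hdet : (LambdaPi y₀ t δ).det = 0) :
    ∃ a b : Fin 3 → ℝ, (a ≠ 0 ∨ b ≠ 0) ∧ AlongBearing y₀ a b (Icc t (t + δ)) := by
  obtain ⟨u, hu0, hu⟩ := Matrix.exists_mulVec_eq_zero_iff.2 hdet
  set a : Fin 3 → ℝ := fun i => u (0, i)
  set b : Fin 3 → ℝ := fun i => u (1, i)
  have h1 := dotProduct_LambdaPi_mulVec hy ht hδ u u
  rw [hu, dotProduct_zero] at h1
  have h2 : ∫ s in t..t + δ, projSq (y₀ s) (a + (s - t) • b) = 0 := by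
    rw [h1]
    refine intervalIntegral.integral_congr fun s hs => ?_
    rw [uIcc_of_le (by linarith)] at hs
    simp only [rowKron_one_sub_mulVec]
    exact dotProduct_proj_mulVec (hy1 s (ht.trans hs.1)) _ _
  have h3 : ∀ s ∈ Icc t (t + δ), proj (y₀ s) *ᵥ (a + (s - t) • b) = 0 := fun s hs => by
    by_contra hne
    have hpos := intervalIntegral.integral_pos (by linarith : t < t + δ)
      ((continuousOn_projSq hy (continuousOn_line a b t _)).mono fun s hs => ht.trans hs.1)
      (fun s _ => projSq_nonneg _ _)
      ⟨s, hs, (projSq_nonneg _ _).lt_of_ne fun h => hne (projSq_eq_zero_iff.1 h.symm)⟩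
    exact hpos.ne' h2
  refine ⟨a - t • b, b, ?_, fun s hs => ?_⟩
  · by_contra! hcon
    obtain ⟨ha, hb⟩ := hcon
    rw [hb, smul_zero, sub_zero] at ha
    refine hu0 (funext fun ⟨k, i⟩ => ?_)
    fin_cases k
    · exact congrFun ha i
    · exact congrFun hb i
  · rw [← h3 s hs]
    congr 1
    rw [sub_smul]; abel

theorem continuousOn_excitation (hz : ContinuousOn az (Ici 0)) (hy : ContinuousOn y₀ (Ici 0))
    {t : ℝ} (ht : 0 ≤ t) : ContinuousOn (fun s => excitation az y₀ δ s t) (Ici 0) :=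
  (continuousOn_proj hy).matrix_mul ((continuousOn_LambdaT hz ht).sub
    ((continuousOn_rowKron (continuousOn_one_sub t _) 1).matrix_mul continuousOn_const))

/-- **The Schur complement.** When `Λ_π` is nonsingular, `∫ MᵀM` is the least energy over all lines
`u`: the energy is a quadratic function of `u` with minimizer `-ρ w`. -/
theorem excitation_le_energy (hz : ContinuousOn az (Ici 0)) (hy : ContinuousOn y₀ (Ici 0))
    (hy1 : ∀ t, 0 ≤ t → ‖y₀ t‖ = 1) {t : ℝ} (ht : 0 ≤ t) (hδ : 0 < δ)
    (hdet : (LambdaPi y₀ t δ).det ≠ 0) (u : Fin 2 × Fin 3 → ℝ) (w : Fin 3 × Fin 3 → ℝ) :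
    w ⬝ᵥ (matIntegral t (t + δ) fun s => (excitation az y₀ δ s t)ᵀ * excitation az y₀ δ s t) *ᵥ w
      ≤ ∫ s in t..t + δ, projSq (y₀ s) (rowKron ![1, s - t] 1 *ᵥ u + LambdaT az s t *ᵥ w) := by
  have htδ : 0 ≤ t + δ := by linarith
  have hM := continuousOn_excitation (δ := δ) hz hy ht
  have hN : ∀ u : Fin 2 × Fin 3 → ℝ, ContinuousOn
      (fun s => rowKron ![1, s - t] (1 : Matrix (Fin 3) (Fin 3) ℝ) *ᵥ u) (Ici 0) := fun u =>
    (continuousOn_rowKron (continuousOn_one_sub t _) 1).matrix_mulVec continuousOn_const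
  have hT : ContinuousOn (fun s => LambdaT az s t *ᵥ w) (Ici 0) :=
    (continuousOn_LambdaT hz ht).matrix_mulVec continuousOn_const
  have hp := continuousOn_proj hy
  set J : (Fin 2 × Fin 3 → ℝ) → ℝ := fun u =>
    ∫ s in t..t + δ, projSq (y₀ s) (rowKron ![1, s - t] 1 *ᵥ u + LambdaT az s t *ᵥ w) with hJ
  have hJeq : ∀ u, J u = u ⬝ᵥ LambdaPi y₀ t δ *ᵥ u + 2 * (u ⬝ᵥ crossBlock az y₀ t δ *ᵥ w)
      + ∫ s in t..t + δ, projSq (y₀ s) (LambdaT az s t *ᵥ w) := fun u => by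
    have i1 := intervalIntegrable_of_continuousOn_Ici
      ((hN u).dotProduct (hp.matrix_mulVec (hN u))) ht htδ
    have i2 := intervalIntegrable_of_continuousOn_Ici
      ((hN u).dotProduct (hp.matrix_mulVec hT)) ht htδ
    have i3 := intervalIntegrable_of_continuousOn_Ici (continuousOn_projSq hy hT) ht htδ
    rw [dotProduct_LambdaPi_mulVec hy ht hδ, dotProduct_crossBlock_mulVec hz hy ht hδ,
      ← intervalIntegral.integral_const_mul, ← intervalIntegral.integral_add i1 (i2.const_mul 2),
      ← intervalIntegral.integral_add (i1.add (i2.const_mul 2)) i3]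
    refine intervalIntegral.integral_congr fun s hs => ?_
    rw [uIcc_of_le (by linarith)] at hs
    have h1 := hy1 s (ht.trans hs.1)
    simp only [projSq, dotProduct_proj_mulVec h1, Matrix.mulVec_add, add_dotProduct,
      dotProduct_add]
    rw [dotProduct_mulVec_comm_of_isSymm (isSymm_proj _) (LambdaT az s t *ᵥ w)]
    ring
  have hsymm : ∀ u v, u ⬝ᵥ LambdaPi y₀ t δ *ᵥ v = v ⬝ᵥ LambdaPi y₀ t δ *ᵥ u := fun u v => by
    rw [dotProduct_LambdaPi_mulVec hy ht hδ, dotProduct_LambdaPi_mulVec hy ht hδ]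
    exact intervalIntegral.integral_congr fun s _ =>
      dotProduct_mulVec_comm_of_isSymm (isSymm_proj _) _ _
  have hnonneg : ∀ u, 0 ≤ u ⬝ᵥ LambdaPi y₀ t δ *ᵥ u := fun u => by
    rw [dotProduct_LambdaPi_mulVec hy ht hδ]
    refine intervalIntegral.integral_nonneg (by linarith) fun s hs => ?_
    rw [← dotProduct_proj_mulVec (hy1 s (ht.trans hs.1))]
    exact dotProduct_self_nonneg' _
  set u₀ := -(rho az y₀ t δ *ᵥ w) with hu₀
  have hmin : w ⬝ᵥ (matIntegral t (t + δ) fun s =>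
      (excitation az y₀ δ s t)ᵀ * excitation az y₀ δ s t) *ᵥ w = J u₀ := by
    rw [dotProduct_matIntegral_mulVec (hM.matrix_transpose.matrix_mul hM) ht htδ]
    refine intervalIntegral.integral_congr fun s _ => ?_
    simp only [← Matrix.mulVec_mulVec, dotProduct_transpose_mulVec, projSq]
    have : excitation az y₀ δ s t *ᵥ w
        = proj (y₀ s) *ᵥ (rowKron ![1, s - t] 1 *ᵥ u₀ + LambdaT az s t *ᵥ w) := by
      rw [excitation, hu₀, ← Matrix.mulVec_mulVec, Matrix.sub_mulVec, ← Matrix.mulVec_mulVec,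
        Matrix.mulVec_neg, sub_eq_neg_add]
    rw [this]
  have hcross : crossBlock az y₀ t δ *ᵥ w = -(LambdaPi y₀ t δ *ᵥ u₀) := by
    rw [hu₀, Matrix.mulVec_neg, neg_neg, rho, Matrix.mulVec_mulVec, ← Matrix.mul_assoc,
      Matrix.mul_nonsing_inv _ (isUnit_iff_ne_zero.2 hdet), Matrix.one_mul]
  have h := hnonneg (u - u₀)
  rw [Matrix.mulVec_sub, sub_dotProduct, dotProduct_sub, dotProduct_sub, hsymm u₀ u] at h
  rw [hmin]
  change J u₀ ≤ J u
  rw [hJeq, hJeq, hcross]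
  simp only [dotProduct_neg]
  linarith

/-- **Uniform observability in terms of the displacement.** Over a sufficiently long window the
energy of the displacement seen across the bearing controls the initial position `a`, the initial
velocity `b` and the parameter `w`. -/
theorem exists_energy_lower (hz : ContinuousOn az (Ici 0)) {K : ℝ}
    (hK : ∀ t, 0 ≤ t → ‖az t‖ ≤ K) (hy : ContinuousOn y₀ (Ici 0))
    (hy1 : ∀ t, 0 ≤ t → ‖y₀ t‖ = 1) (hδ : 0 < δ) {κ : ℝ} (hκ : 0 < κ)
    (hPE : BearingExcited y₀ δ κ)
    (hSchur : ∀ t, 0 ≤ t → ∀ w, κ * (w ⬝ᵥ w) ≤ w ⬝ᵥ (matIntegral t (t + δ) fun s =>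
      (excitation az y₀ δ s t)ᵀ * excitation az y₀ δ s t) *ᵥ w) :
    ∃ L g : ℝ, 0 < L ∧ 0 < g ∧ ∀ t, 0 ≤ t → ∀ (a b : Fin 3 → ℝ) (w : Fin 3 × Fin 3 → ℝ),
      g * (a ⬝ᵥ a + b ⬝ᵥ b + w ⬝ᵥ w)
        ≤ ∫ s in t..t + L, projSq (y₀ s) (a + (s - t) • b + LambdaT az s t *ᵥ w) := by
  obtain ⟨N, c, hc, hline⟩ := hPE.exists_line_lower hδ hκ hy hy1
  set L : ℝ := N * δ + δ with hL
  have hL0 : 0 < L := by positivity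
  set kΛ : ℝ := Fintype.card (Fin 3) * Fintype.card (Fin 3 × Fin 3) * (L * K * L) ^ 2 with hkΛ
  have hkΛ0 : 0 ≤ kΛ := by positivity
  set X : ℝ := L * kΛ / κ with hX
  have hX0 : 0 ≤ X := by positivity
  refine ⟨L, min (c / 2) κ / (2 * (1 + X)), hL0, by positivity, fun t ht a b w => ?_⟩
  have htL : 0 ≤ t + L := by linarith
  set E := ∫ s in t..t + L, projSq (y₀ s) (a + (s - t) • b + LambdaT az s t *ᵥ w) with hE
  have hcont : ContinuousOn
      (fun s => projSq (y₀ s) (a + (s - t) • b + LambdaT az s t *ᵥ w)) (Ici 0) :=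
    continuousOn_projSq hy ((continuousOn_line a b t _).add
      ((continuousOn_LambdaT hz ht).matrix_mulVec continuousOn_const))
  -- the parameter `w` is seen from a window on which `Λ_π` is nonsingular
  have hw : κ * (w ⬝ᵥ w) ≤ E := by
    obtain ⟨j, hj, hdet⟩ : ∃ j : ℕ, j ≤ 2 * N ∧
        (LambdaPi y₀ (t + j * (δ / 2)) δ).det ≠ 0 := by
      by_contra! hcon
      obtain ⟨p, q, hpq, hl⟩ := hPE.exists_common_line hκ hδ ht (2 * N) fun j hj =>
        exists_line_of_det_eq_zero hy hy1 (by positivity) hδ (hcon j hj)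
      have h1 := hline t ht (p + t • q) q
      have h2 : ∫ s in t..t + L, projSq (y₀ s) (p + t • q + (s - t) • q)
          = ∫ s in t..t + L, (0 : ℝ) := by
        refine intervalIntegral.integral_congr fun s hs => ?_
        rw [uIcc_of_le (by linarith)] at hs
        have e : p + t • q + (s - t) • q = p + s • q := by rw [sub_smul]; abel
        simp only [e]
        refine projSq_eq_zero_iff.2 (hl s ⟨hs.1, hs.2.trans ?_⟩)
        push_cast
        rw [hL]; linarith
      rw [h2, intervalIntegral.integral_zero] at h1
      have hq : q ≠ 0 := by rintro rfl; simp at hpq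
      nlinarith [dotProduct_self_pos hq, dotProduct_self_nonneg' (p + t • q)]
    set r := t + j * (δ / 2) with hr
    have hjδ : (j : ℝ) * (δ / 2) ≤ N * δ := by
      have : (j : ℝ) ≤ 2 * N := by exact_mod_cast hj
      nlinarith
    have hjδ0 : 0 ≤ (j : ℝ) * (δ / 2) := by positivity
    have hr0 : 0 ≤ r := by positivity
    -- position and velocity at the beginning `r` of that window
    set a' := a + (r - t) • b + LambdaT az r t *ᵥ w with ha'
    set b' := b + rowKron (targetVelocity az r t) (1 : Matrix (Fin 3) (Fin 3) ℝ) *ᵥ w with hb'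
    have hrestart : ∀ s, 0 ≤ s → a + (s - t) • b + LambdaT az s t *ᵥ w
        = a' + (s - r) • b' + LambdaT az s r *ᵥ w := fun s hs => by
      simp only [ha', hb', LambdaT_eq, targetDisplacement_add hz hr0 hs ht, rowKron_one_mulVec]
      ext i
      simp only [Pi.add_apply, Pi.smul_apply, smul_eq_mul, add_mul, Finset.sum_add_distrib,
        mul_assoc, ← Finset.mul_sum]
      ring
    refine (hSchur r hr0 w).trans ((excitation_le_energy hz hy hy1 hr0 hδ hdet
      (fun p => ![a', b'] p.1 p.2) w).trans ?_)
    have h1 : ∫ s in r..r + δ, projSq (y₀ s) (rowKron ![1, s - r] 1 *ᵥ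
          (fun p : Fin 2 × Fin 3 => ![a', b'] p.1 p.2) + LambdaT az s r *ᵥ w)
        = ∫ s in r..r + δ, projSq (y₀ s) (a + (s - t) • b + LambdaT az s t *ᵥ w) := by
      refine intervalIntegral.integral_congr fun s hs => ?_
      rw [uIcc_of_le (by linarith)] at hs
      simp only [hrestart s (hr0.trans hs.1), rowKron_one_sub_mulVec]
      rfl
    rw [h1]
    exact integral_le_of_subinterval hcont (fun s => projSq_nonneg _ _) ht (by linarith)
      (by linarith) (by linarith)
  -- given `w`, the line is seen from the whole window
  have hab : c / 2 * (a ⬝ᵥ a + b ⬝ᵥ b) - L * kΛ * (w ⬝ᵥ w) ≤ E := by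
    have i1 := intervalIntegrable_of_continuousOn_Ici
      (continuousOn_projSq hy (continuousOn_line a b t _)) ht htL
    have h := intervalIntegral.integral_mono_on (by linarith : t ≤ t + L)
      ((i1.const_mul (1 / 2)).sub (intervalIntegrable_const (c := kΛ * (w ⬝ᵥ w))))
      (intervalIntegrable_of_continuousOn_Ici hcont ht htL) fun s hs => by
        have hs0 := ht.trans hs.1
        refine le_trans ?_ (half_projSq_sub_le (hy1 s hs0) _ _)
        have h1 := mulVec_dotProduct_self_le (fun i j => abs_LambdaT_le hK hs0 ht
          (by rw [abs_of_nonneg (sub_nonneg.2 hs.1)]; linarith [hs.2] : |s - t| ≤ L) i j) w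
        linarith
    rw [intervalIntegral.integral_sub (i1.const_mul _) intervalIntegrable_const,
      intervalIntegral.integral_const_mul, intervalIntegral.integral_const, smul_eq_mul] at h
    have h1 := hline t ht a b
    have e : (t + L - t) * (kΛ * (w ⬝ᵥ w)) = L * kΛ * (w ⬝ᵥ w) := by ring
    linarith
  have hXw : L * kΛ * (w ⬝ᵥ w) ≤ X * E := by
    calc L * kΛ * (w ⬝ᵥ w) = X * (κ * (w ⬝ᵥ w)) := by rw [hX]; field_simp
      _ ≤ X * E := by gcongr
  have haa := dotProduct_self_nonneg' a
  have hbb := dotProduct_self_nonneg' b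
  have hww := dotProduct_self_nonneg' w
  have hE0 : 0 ≤ E := (mul_nonneg hκ.le hww).trans hw
  rw [div_mul_eq_mul_div, div_le_iff₀ (by positivity)]
  have hm1 : min (c / 2) κ * (a ⬝ᵥ a + b ⬝ᵥ b) ≤ c / 2 * (a ⬝ᵥ a + b ⬝ᵥ b) := by
    gcongr; exact min_le_left _ _
  have hm2 : min (c / 2) κ * (w ⬝ᵥ w) ≤ κ * (w ⬝ᵥ w) := by gcongr; exact min_le_right _ _
  nlinarith [mul_nonneg hX0 hE0]

end Energy

/-! ### Change of coordinates -/

section Conjugation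

theorem HasMatDerivWithinAt.kronecker_const {l m p q : Type*} {X : ℝ → Matrix l m ℝ}
    {X' : Matrix l m ℝ} {s : Set ℝ} {t : ℝ} (hX : HasMatDerivWithinAt X X' s t)
    (Y : Matrix p q ℝ) : HasMatDerivWithinAt (fun τ => X τ ⊗ₖ Y) (X' ⊗ₖ Y) s t :=
  fun i j => (hX i.1 j.1).mul_const _

theorem HasMatDerivWithinAt.const_kronecker {l m p q : Type*} {X : ℝ → Matrix l m ℝ}
    {X' : Matrix l m ℝ} {s : Set ℝ} {t : ℝ} (Y : Matrix p q ℝ)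
    (hX : HasMatDerivWithinAt X X' s t) : HasMatDerivWithinAt (fun τ => Y ⊗ₖ X τ) (Y ⊗ₖ X') s t :=
  fun i j => (hX i.2 j.2).const_mul _

variable {n : Type*} [Fintype n] [DecidableEq n] {A F K S S' T W W' P : ℝ → Matrix n n ℝ}

/-- The Riccati equation under the time-varying orthogonal change of coordinates `x ↦ T x`, where
`Ṫ = T K` with `K` skew-symmetric: `T P Tᵀ` solves the equation with the coefficients
`T (A + K) Tᵀ`, `T S Tᵀ` and `T W Tᵀ`. -/
theorem IsRiccatiSolutionOn.conj {s : Set ℝ} (hP : IsRiccatiSolutionOn A S W P s)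
    (hT : ∀ t ∈ s, HasMatDerivWithinAt T (T t * K t) s t)
    (hTT : ∀ t ∈ s, (T t)ᵀ * T t = 1)
    (hF : ∀ t ∈ s, F t = T t * (A t + K t) * (T t)ᵀ)
    (hS : ∀ t ∈ s, S' t = T t * S t * (T t)ᵀ) (hW : ∀ t ∈ s, W' t = T t * W t * (T t)ᵀ) :
    IsRiccatiSolutionOn F S' W' (fun t => T t * P t * (T t)ᵀ) s := by
  intro t ht
  refine (((hT t ht).mul (hP t ht)).mul (hT t ht).transpose).congr_deriv ?_
  have e : ∀ X : Matrix n n ℝ, (T t)ᵀ * (T t * X) = X := fun X => by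
    rw [← Matrix.mul_assoc, hTT t ht, Matrix.one_mul]
  simp only [riccatiField, hF t ht, hS t ht, hW t ht, Matrix.transpose_mul, Matrix.transpose_add,
    Matrix.transpose_transpose, Matrix.mul_assoc, e]
  simp only [Matrix.mul_add, Matrix.add_mul, Matrix.mul_sub, Matrix.sub_mul, Matrix.mul_assoc]
  abel

end Conjugation

/-! ### The transition matrix in the rotated frame -/

section Transition

/-- The transition matrix of `Ā`. -/
noncomputable def phi (az : ℝ → R3) (s t : ℝ) : Matrix (Fin 5) (Fin 5) ℝ :=
  !![1, s - t, targetDisplacement az s t 0, targetDisplacement az s t 1, targetDisplacement az s t 2;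
     0, 1, targetVelocity az s t 0, targetVelocity az s t 1, targetVelocity az s t 2;
     0, 0, 1, 0, 0;
     0, 0, 0, 1, 0;
     0, 0, 0, 0, 1]

variable {az : ℝ → R3}

theorem phi_self (t : ℝ) : phi az t t = 1 := by
  ext i j
  fin_cases i <;> fin_cases j <;>
    simp [phi, targetDisplacement_self, targetVelocity_self]

theorem phi_mul_phi (hz : ContinuousOn az (Ici 0)) {s t : ℝ} (hs : 0 ≤ s) (ht : 0 ≤ t) :
    phi az s t * phi az t s = 1 := by
  have h : ∀ j, targetDisplacement az s t j
      = -targetDisplacement az t s j + (s - t) * targetVelocity az s t j := fun j => by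
    have := congrFun (targetDisplacement_add hz hs ht ht) j
    simp only [targetDisplacement_self, Pi.add_apply, Pi.smul_apply, smul_eq_mul,
      Pi.zero_apply] at this
    linarith
  have hv : ∀ j, targetVelocity az t s j = -targetVelocity az s t j := fun j => by
    rw [targetVelocity_swap]; rfl
  ext i j
  fin_cases i <;> fin_cases j <;>
    simp [phi, Matrix.mul_apply, Fin.sum_univ_five, h, hv] <;> ring

theorem phi_hasDeriv_left (hz : ContinuousOn az (Ici 0)) {s t : ℝ} (hs : 0 ≤ s) (ht : 0 ≤ t) :
    HasMatDerivWithinAt (fun σ => phi az σ t) (Abar (az s) * phi az s t) (Ici 0) s := by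
  have hd := targetDisplacement_hasDeriv_left hz hs ht
  have hv := targetVelocity_hasDeriv_left hz hs ht
  have hi : HasDerivWithinAt (fun σ : ℝ => σ - t) 1 (Ici 0) s :=
    (hasDerivWithinAt_id s _).sub_const t
  have h1 := hasDerivWithinAt_const s (Ici (0 : ℝ)) (1 : ℝ)
  have h0 := hasDerivWithinAt_const s (Ici (0 : ℝ)) (0 : ℝ)
  intro i j
  fin_cases i <;> fin_cases j <;>
    simp [phi, Abar, Matrix.mul_apply, Fin.sum_univ_five, hi, hd, hv, h0, h1]

theorem phi_hasDeriv_right (hz : ContinuousOn az (Ici 0)) {s t : ℝ} (hs : 0 ≤ s) (ht : 0 ≤ t) :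
    HasMatDerivWithinAt (fun σ => phi az t σ) (-(phi az t s * Abar (az s))) (Ici 0) s := by
  have hd := targetDisplacement_hasDeriv_right hz hs ht
  have hv := targetVelocity_hasDeriv_right hz hs ht
  have hi : HasDerivWithinAt (fun σ : ℝ => t - σ) (-1) (Ici 0) s :=
    (hasDerivWithinAt_id s _).const_sub t
  have h1 := hasDerivWithinAt_const s (Ici (0 : ℝ)) (1 : ℝ)
  have h0 := hasDerivWithinAt_const s (Ici (0 : ℝ)) (0 : ℝ)
  intro i j
  fin_cases i <;> fin_cases j <;>
    simp [phi, Abar, hi, hd, hv, h0, h1]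

theorem abs_phi_le {K L : ℝ} (hK : ∀ t, 0 ≤ t → ‖az t‖ ≤ K) {s t : ℝ} (hs : 0 ≤ s) (ht : 0 ≤ t)
    (hst : |s - t| ≤ L) (i j : Fin 5) : |phi az s t i j| ≤ 1 + L + K * L + L * K * L := by
  have hK0 : 0 ≤ K := (norm_nonneg _).trans (hK 0 le_rfl)
  have hL0 : 0 ≤ L := (abs_nonneg _).trans hst
  have h1 : 0 ≤ K * L := by positivity
  have h2 : 0 ≤ L * K * L := by positivity
  have hd : ∀ j, |targetDisplacement az s t j| ≤ 1 + L + K * L + L * K * L := fun j =>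
    (abs_targetDisplacement_le hK hs ht hst j).trans (by linarith)
  have hv : ∀ j, |targetVelocity az s t j| ≤ 1 + L + K * L + L * K * L := fun j =>
    (abs_targetVelocity_le hK hs ht hst j).trans (by linarith)
  have hi : |s - t| ≤ 1 + L + K * L + L * K * L := by linarith
  have h3 : 0 ≤ 1 + L + K * L + L * K * L := by positivity
  have h4 : 1 ≤ 1 + L + K * L + L * K * L := by linarith
  fin_cases i <;> fin_cases j <;> simp [phi, hd, hv, hi, h3, h4]

/-- The system matrix `Ā ⊗ I₃` in the rotated frame, where the angular velocity has disappeared. -/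
def rotatedMatrix (az : ℝ → R3) (t : ℝ) : Matrix Ix Ix ℝ :=
  Abar (az t) ⊗ₖ (1 : Matrix (Fin 3) (Fin 3) ℝ)

/-- The transition matrix of `Ā ⊗ I₃`. -/
noncomputable def rotatedTransition (az : ℝ → R3) (s t : ℝ) : Matrix Ix Ix ℝ :=
  phi az s t ⊗ₖ (1 : Matrix (Fin 3) (Fin 3) ℝ)

theorem isTransition_rotated (hz : ContinuousOn az (Ici 0)) {K : ℝ}
    (hK : ∀ t, 0 ≤ t → ‖az t‖ ≤ K) : IsTransition (rotatedMatrix az) (rotatedTransition az) where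
  self t _ := by simp [rotatedTransition, phi_self]
  mul_eq_one s t hs ht := by
    rw [rotatedTransition, rotatedTransition, ← Matrix.mul_kronecker_mul, phi_mul_phi hz hs ht]
    simp
  hasDeriv_left s t hs ht := by
    refine ((phi_hasDeriv_left hz hs ht).kronecker_const 1).congr_deriv ?_
    rw [rotatedMatrix, rotatedTransition, ← Matrix.mul_kronecker_mul, Matrix.mul_one]
  hasDeriv_right s t hs ht := by
    refine ((phi_hasDeriv_right hz hs ht).kronecker_const 1).congr_deriv ?_
    rw [rotatedMatrix, rotatedTransition, ← Matrix.mul_kronecker_mul, Matrix.mul_one]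
    ext i j; simp
  bounded L := by
    refine ⟨1 + L + K * L + L * K * L, fun s t hs ht hst i j => ?_⟩
    have h := abs_phi_le hK hs ht hst i.1 j.1
    rw [rotatedTransition, Matrix.kroneckerMap_apply, abs_mul, Matrix.one_apply]
    split_ifs
    · simpa using h
    · simpa using (abs_nonneg _).trans h

/-- The output matrix `[1 0 0 0 0] ⊗ π_{y₀}` in the rotated frame, applied to a trajectory. -/
theorem outputMatrix_mulVec_rotatedTransition (y₀ : ℝ → R3) (s t : ℝ) (v : Ix → ℝ) :
    outputMatrix y₀ s *ᵥ (rotatedTransition az s t *ᵥ v)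
      = proj (y₀ s) *ᵥ ((fun i => v (0, i)) + (s - t) • (fun i => v (1, i))
        + LambdaT az s t *ᵥ fun p => v (![2, 3, 4] p.1, p.2)) := by
  rw [outputMatrix, rowKron_mulVec, LambdaT_eq, rowKron_one_mulVec]
  congr 1
  ext i
  simp [rotatedTransition, Matrix.mulVec, dotProduct, Fintype.sum_prod_type, Fin.sum_univ_five,
    Fin.sum_univ_three, phi, Matrix.one_apply]
  ring

theorem dotProduct_self_blocks (v : Ix → ℝ) :
    v ⬝ᵥ v = (fun i => v (0, i)) ⬝ᵥ (fun i => v (0, i)) + (fun i => v (1, i)) ⬝ᵥ (fun i => v (1, i))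
      + (fun p : Fin 3 × Fin 3 => v (![2, 3, 4] p.1, p.2)) ⬝ᵥ
        (fun p : Fin 3 × Fin 3 => v (![2, 3, 4] p.1, p.2)) := by
  simp [dotProduct, Fintype.sum_prod_type, Fin.sum_univ_five, Fin.sum_univ_three]
  ring

end Transition

/-! ### The error system in the rotated frame -/

section RotatedFrame

/-- The orthogonal change of coordinates `I₅ ⊗ Q`. -/
def frame (Q : ℝ → Matrix (Fin 3) (Fin 3) ℝ) (t : ℝ) : Matrix Ix Ix ℝ :=
  (1 : Matrix (Fin 5) (Fin 5) ℝ) ⊗ₖ Q t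

variable {Q : ℝ → Matrix (Fin 3) (Fin 3) ℝ} {Ω : ℝ → R3}

theorem IsAttitude.mul_transpose (hQ : IsAttitude Q Ω) {t : ℝ} (ht : 0 ≤ t) :
    Q t * (Q t)ᵀ = 1 := by
  have h := (Matrix.mem_specialOrthogonalGroup_iff.1 (hQ t ht).1).1
  exact (Matrix.mem_orthogonalGroup_iff _ _).1 h

theorem IsAttitude.transpose_mul (hQ : IsAttitude Q Ω) {t : ℝ} (ht : 0 ≤ t) :
    (Q t)ᵀ * Q t = 1 := mul_eq_one_comm.1 (hQ.mul_transpose ht)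

theorem IsAttitude.continuousOn (hQ : IsAttitude Q Ω) : ContinuousOn Q (Ici 0) :=
  continuousOn_of_hasMatDerivWithinAt fun t ht => (hQ t ht).2

theorem mulVec_dotProduct_mulVec_of_orthogonal {n : Type*} [Fintype n] [DecidableEq n]
    {U : Matrix n n ℝ} (hU : Uᵀ * U = 1) (u v : n → ℝ) : (U *ᵥ u) ⬝ᵥ (U *ᵥ v) = u ⬝ᵥ v := by
  rw [← dotProduct_transpose_mulVec, Matrix.mulVec_mulVec, hU, Matrix.one_mulVec]

theorem IsAttitude.entriesBounded (hQ : IsAttitude Q Ω) : EntriesBounded Q := by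
  refine ⟨1, fun t ht i j => ?_⟩
  have h : ∑ k, Q t i k * Q t i k = 1 := by
    have := congrFun (congrFun (hQ.mul_transpose ht) i) i
    simpa [Matrix.mul_apply] using this
  rw [← sq_le_one_iff_abs_le_one, ← h, pow_two]
  exact Finset.single_le_sum (f := fun k => Q t i k * Q t i k) (fun _ _ => mul_self_nonneg _)
    (Finset.mem_univ j)

theorem norm_eq_sqrt_dotProduct {n : Type*} [Fintype n] (v : EuclideanSpace ℝ n) :
    ‖v‖ = √(v.ofLp ⬝ᵥ v.ofLp) := by
  rw [EuclideanSpace.norm_eq]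
  simp [dotProduct, pow_two]

theorem IsAttitude.norm_rotate (hQ : IsAttitude Q Ω) (v : ℝ → R3) {t : ℝ} (ht : 0 ≤ t) :
    ‖rotate Q v t‖ = ‖v t‖ := by
  rw [norm_eq_sqrt_dotProduct, norm_eq_sqrt_dotProduct, rotate,
    mulVec_dotProduct_mulVec_of_orthogonal (hQ.transpose_mul ht)]

theorem IsAttitude.continuousOn_rotate (hQ : IsAttitude Q Ω) {v : ℝ → R3}
    (hv : ContinuousOn v (Ici 0)) : ContinuousOn (rotate Q v) (Ici 0) :=
  (PiLp.continuous_toLp 2 _).comp_continuousOn (hQ.continuousOn.matrix_mulVec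
    ((PiLp.continuous_ofLp 2 _).comp_continuousOn hv))

theorem IsAttitude.proj_rotate (hQ : IsAttitude Q Ω) (y : ℝ → R3) {t : ℝ} (ht : 0 ≤ t) :
    proj (rotate Q y t) = Q t * proj (y t) * (Q t)ᵀ := by
  rw [proj, proj, rotate, Matrix.mul_sub, Matrix.sub_mul, Matrix.mul_one, hQ.mul_transpose ht,
    Matrix.mul_vecMulVec, Matrix.vecMulVec_mul, Matrix.vecMul_transpose]

theorem skew_transpose (Ω : R3) : (skew Ω)ᵀ = -skew Ω := by
  ext i j
  fin_cases i <;> fin_cases j <;> simp [skew]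

/-- The angular velocity in the state equation. -/
def frameVelocity (Ω : ℝ → R3) (t : ℝ) : Matrix Ix Ix ℝ :=
  (1 : Matrix (Fin 5) (Fin 5) ℝ) ⊗ₖ skew (Ω t)

theorem frameVelocity_transpose (t : ℝ) : (frameVelocity Ω t)ᵀ = -frameVelocity Ω t := by
  ext i j
  simp only [frameVelocity, Matrix.transpose_apply, Matrix.kroneckerMap_apply, Matrix.neg_apply]
  have := congrFun (congrFun (skew_transpose (Ω t)) i.2) j.2
  simp only [Matrix.transpose_apply, Matrix.neg_apply] at this
  rw [this, ← Matrix.transpose_apply 1, Matrix.transpose_one, mul_neg]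

theorem IsAttitude.hasDeriv_frame (hQ : IsAttitude Q Ω) {t : ℝ} (ht : 0 ≤ t) :
    HasMatDerivWithinAt (frame Q) (frame Q t * frameVelocity Ω t) (Ici 0) t := by
  refine (HasMatDerivWithinAt.const_kronecker 1 (hQ t ht).2).congr_deriv ?_
  rw [frame, frameVelocity, ← Matrix.mul_kronecker_mul, Matrix.one_mul]

theorem frame_transpose (t : ℝ) :
    (frame Q t)ᵀ = (1 : Matrix (Fin 5) (Fin 5) ℝ) ⊗ₖ (Q t)ᵀ := by
  ext i j
  simp [frame, Matrix.one_apply, eq_comm]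

theorem IsAttitude.frame_mul_transpose (hQ : IsAttitude Q Ω) {t : ℝ} (ht : 0 ≤ t) :
    frame Q t * (frame Q t)ᵀ = 1 := by
  rw [frame_transpose, frame, ← Matrix.mul_kronecker_mul, hQ.mul_transpose ht]
  simp

theorem IsAttitude.transpose_mul_frame (hQ : IsAttitude Q Ω) {t : ℝ} (ht : 0 ≤ t) :
    (frame Q t)ᵀ * frame Q t = 1 := mul_eq_one_comm.1 (hQ.frame_mul_transpose ht)

theorem IsAttitude.continuousOn_frame (hQ : IsAttitude Q Ω) : ContinuousOn (frame Q) (Ici 0) :=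
  continuousOn_of_hasMatDerivWithinAt fun _ ht => hQ.hasDeriv_frame ht

theorem IsAttitude.entriesBounded_frame (hQ : IsAttitude Q Ω) : EntriesBounded (frame Q) := by
  obtain ⟨K, hK⟩ := hQ.entriesBounded
  refine ⟨K, fun t ht i j => ?_⟩
  have h := hK t ht i.2 j.2
  rw [frame, Matrix.kroneckerMap_apply, abs_mul, Matrix.one_apply]
  split_ifs
  · simpa using h
  · simpa using (abs_nonneg _).trans h

theorem stateMatrix_add_frameVelocity (az : ℝ → R3) (t : ℝ) :
    stateMatrix az Ω t + frameVelocity Ω t = rotatedMatrix az t := by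
  rw [stateMatrix, frameVelocity, rotatedMatrix, sub_add_cancel]

theorem frame_mul_rotatedMatrix (az : ℝ → R3) (t : ℝ) :
    frame Q t * rotatedMatrix az t = rotatedMatrix az t * frame Q t := by
  rw [frame, rotatedMatrix, ← Matrix.mul_kronecker_mul, ← Matrix.mul_kronecker_mul]
  simp

theorem IsAttitude.rotatedMatrix_eq (hQ : IsAttitude Q Ω) (az : ℝ → R3) {t : ℝ} (ht : 0 ≤ t) :
    rotatedMatrix az t = frame Q t * (stateMatrix az Ω t + frameVelocity Ω t) * (frame Q t)ᵀ := by
  rw [stateMatrix_add_frameVelocity, frame_mul_rotatedMatrix, Matrix.mul_assoc,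
    hQ.frame_mul_transpose ht, Matrix.mul_one]

/-- The output matrix in the two frames. -/
theorem IsAttitude.outputMatrix_mul_frame_transpose (hQ : IsAttitude Q Ω) (y : ℝ → R3) {t : ℝ}
    (ht : 0 ≤ t) :
    outputMatrix y t * (frame Q t)ᵀ = (Q t)ᵀ * outputMatrix (rotate Q y) t := by
  have h : (Q t)ᵀ * proj (rotate Q y t) = proj (y t) * (Q t)ᵀ := by
    rw [hQ.proj_rotate y ht, ← Matrix.mul_assoc, ← Matrix.mul_assoc, hQ.transpose_mul ht,
      Matrix.one_mul]
  have key : ∀ X : Matrix (Fin 3) (Fin 3) ℝ, (Q t)ᵀ * rowKron ![1, 0, 0, 0, 0] X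
      = rowKron ![1, 0, 0, 0, 0] ((Q t)ᵀ * X) := fun X => by
    ext i j
    simp [rowKron, Matrix.mul_apply, Finset.mul_sum]
    exact Finset.sum_congr rfl fun _ _ => by ring
  rw [outputMatrix, outputMatrix, key, h, frame_transpose]
  ext i ⟨k, j⟩
  simp only [rowKron, Matrix.mul_apply, Matrix.submatrix_apply, Matrix.kroneckerMap_apply,
    Matrix.replicateRow_apply, id, Fintype.sum_prod_type, Matrix.one_apply]
  rw [Finset.sum_eq_single k (fun b _ hb => by simp [hb]) (by simp)]
  simp [Finset.mul_sum, mul_assoc]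

theorem IsWeight.entriesBounded {n : Type*} [DecidableEq n] {X : ℝ → Matrix n n ℝ}
    (hX : IsWeight X) : EntriesBounded X := hX.bounded

/-- The weight `T X Tᵀ` in orthogonal coordinates is bounded, continuous and uniformly positive
definite. -/
theorem IsWeight.conj {n : Type*} [Fintype n] [DecidableEq n] {X U : ℝ → Matrix n n ℝ}
    (hX : IsWeight X) (hU : ContinuousOn U (Ici 0)) (hUb : EntriesBounded U)
    (hUU : ∀ t, 0 ≤ t → U t * (U t)ᵀ = 1) :
    IsWeight fun t => U t * X t * (U t)ᵀ where
  continuousOn := (hU.matrix_mul hX.continuousOn).matrix_mul hU.matrix_transpose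
  bounded := (hUb.mul hX.entriesBounded).mul hUb.transpose
  uniformlyPosDef := by
    obtain ⟨c, hc, h⟩ := hX.uniformlyPosDef
    refine ⟨c, hc, fun t ht => geScalar_iff.2 ⟨?_, fun v => ?_⟩⟩
    · rw [Matrix.IsSymm, Matrix.transpose_mul, Matrix.transpose_mul, Matrix.transpose_transpose,
        (geScalar_iff.1 (h t ht)).1.eq, Matrix.mul_assoc]
    · have h1 := (geScalar_iff.1 (h t ht)).2 ((U t)ᵀ *ᵥ v)
      rw [mulVec_dotProduct_mulVec_of_orthogonal (by
        rw [Matrix.transpose_transpose, hUU t ht])] at h1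
      rwa [← Matrix.mulVec_mulVec, ← Matrix.mulVec_mulVec, Matrix.dotProduct_mulVec,
        ← Matrix.mulVec_transpose]

/-- The quadratic term `Cᵀ D C` of the Riccati equation in the rotated frame. -/
def rotatedOutputWeight (Q D : ℝ → Matrix (Fin 3) (Fin 3) ℝ) (y : ℝ → R3) (t : ℝ) :
    Matrix Ix Ix ℝ :=
  (outputMatrix (rotate Q y) t)ᵀ * (Q t * D t * (Q t)ᵀ) * outputMatrix (rotate Q y) t

theorem IsAttitude.rotatedOutputWeight_eq (hQ : IsAttitude Q Ω)
    (D : ℝ → Matrix (Fin 3) (Fin 3) ℝ) (y : ℝ → R3) {t : ℝ} (ht : 0 ≤ t) :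
    rotatedOutputWeight Q D y t
      = frame Q t * ((outputMatrix y t)ᵀ * D t * outputMatrix y t) * (frame Q t)ᵀ := by
  have h := hQ.outputMatrix_mul_frame_transpose y ht
  have h' := congrArg Matrix.transpose h
  rw [Matrix.transpose_mul, Matrix.transpose_mul, Matrix.transpose_transpose,
    Matrix.transpose_transpose] at h'
  calc rotatedOutputWeight Q D y t
      = ((outputMatrix (rotate Q y) t)ᵀ * Q t) * D t * ((Q t)ᵀ * outputMatrix (rotate Q y) t) := by
        simp only [rotatedOutputWeight, Matrix.mul_assoc]
    _ = (frame Q t * (outputMatrix y t)ᵀ) * D t * (outputMatrix y t * (frame Q t)ᵀ) := by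
        rw [h, h']
    _ = _ := by simp only [Matrix.mul_assoc]

theorem continuousOn_outputMatrix {y : ℝ → R3} (hy : ContinuousOn y (Ici 0)) :
    ContinuousOn (outputMatrix y) (Ici 0) :=
  continuousOn_matrix.2 fun i j =>
    continuousOn_const.mul (continuousOn_matrix.1 (continuousOn_proj hy) i j.2)

theorem entriesBounded_outputMatrix {y : ℝ → R3} (hy : ∀ t, 0 ≤ t → ‖y t‖ = 1) :
    EntriesBounded (outputMatrix y) := by
  refine ⟨2, fun t ht i j => ?_⟩
  have e : outputMatrix y t i j = (![1, 0, 0, 0, 0] : Fin 5 → ℝ) j.1 * proj (y t) i j.2 := rfl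
  have h1 : |(![1, 0, 0, 0, 0] : Fin 5 → ℝ) j.1| ≤ 1 := by
    obtain ⟨k, -⟩ := j
    fin_cases k <;> simp
  rw [e, abs_mul]
  have h2 := abs_proj_apply_le (hy t ht) i j.2
  nlinarith [abs_nonneg (proj (y t) i j.2)]

variable {y az : ℝ → R3} {D : ℝ → Matrix (Fin 3) (Fin 3) ℝ} {V : ℝ → Matrix Ix Ix ℝ}

/-- The output weight dominates the output. -/
theorem exists_output_le_rotatedOutputWeight (hQ : IsAttitude Q Ω) (hD : IsWeight D) :
    ∃ d : ℝ, 0 < d ∧ ∀ t, 0 ≤ t → ∀ v,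
      d * ((outputMatrix (rotate Q y) t *ᵥ v) ⬝ᵥ (outputMatrix (rotate Q y) t *ᵥ v))
        ≤ v ⬝ᵥ rotatedOutputWeight Q D y t *ᵥ v := by
  obtain ⟨d, hd, h⟩ := (hD.conj hQ.continuousOn hQ.entriesBounded
    fun t ht => hQ.mul_transpose ht).uniformlyPosDef
  refine ⟨d, hd, fun t ht v => ?_⟩
  have h1 := (geScalar_iff.1 (h t ht)).2 (outputMatrix (rotate Q y) t *ᵥ v)
  rwa [rotatedOutputWeight, ← Matrix.mulVec_mulVec, ← Matrix.mulVec_mulVec,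
    dotProduct_transpose_mulVec]

theorem isRiccatiData_rotated (hQ : IsAttitude Q Ω) (hz : ContinuousOn az (Ici 0)) {K : ℝ}
    (hK : ∀ t, 0 ≤ t → ‖az t‖ ≤ K) (hy : ContinuousOn y (Ici 0)) (hy1 : ∀ t, 0 ≤ t → ‖y t‖ = 1)
    (hD : IsWeight D) (hV : IsWeight V) :
    IsRiccatiData (rotatedMatrix az) (rotatedOutputWeight Q D y)
      (fun t => frame Q t * V t * (frame Q t)ᵀ) := by
  have hy0 := hQ.continuousOn_rotate hy
  have hC := continuousOn_outputMatrix hy0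
  have hCb := entriesBounded_outputMatrix fun t ht => (hQ.norm_rotate y ht).trans (hy1 t ht)
  have hD' := hD.conj hQ.continuousOn hQ.entriesBounded fun t ht => hQ.mul_transpose ht
  have hW := hV.conj hQ.continuousOn_frame hQ.entriesBounded_frame
    fun t ht => hQ.frame_mul_transpose ht
  obtain ⟨d, hd, hdS⟩ := exists_output_le_rotatedOutputWeight (y := y) hQ hD
  have hA : ∀ i j, ContinuousOn (fun t => Abar (az t) i j) (Ici 0) := fun i j => by
    have h : ∀ k, ContinuousOn (fun t => -az t k) (Ici 0) := fun k => (continuousOn_coord hz k).neg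
    fin_cases i <;> fin_cases j <;>
      simp [Abar, continuousOn_const, h]
  have hAb : ∀ t, 0 ≤ t → ∀ i j, |Abar (az t) i j| ≤ 1 + K := fun t ht i j => by
    have hK0 : 0 ≤ K := (norm_nonneg _).trans (hK t ht)
    have h : ∀ k, |az t k| ≤ 1 + K := fun k => (abs_coord_le (hK t ht) k).trans (by linarith)
    have h0 : 0 ≤ 1 + K := by positivity
    fin_cases i <;> fin_cases j <;> simp [Abar, h, h0, hK0]
  refine ⟨continuousOn_matrix.2 fun i j => (hA i.1 j.1).mul continuousOn_const,
    (hC.matrix_transpose.matrix_mul hD'.continuousOn).matrix_mul hC, hW.continuousOn,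
    ⟨1 + K, fun t ht i j => ?_⟩, (hCb.transpose.mul hD'.bounded).mul hCb, hW.bounded,
    fun t ht => ?_, fun t ht => ?_, fun t ht v => ?_, ?_⟩
  · have h := hAb t ht i.1 j.1
    rw [rotatedMatrix, Matrix.kroneckerMap_apply, abs_mul, Matrix.one_apply]
    split_ifs
    · simpa using h
    · simpa using (abs_nonneg _).trans h
  · obtain ⟨c, -, hc⟩ := hD'.uniformlyPosDef
    rw [Matrix.IsSymm, rotatedOutputWeight, Matrix.transpose_mul, Matrix.transpose_mul,
      Matrix.transpose_transpose, (geScalar_iff.1 (hc t ht)).1.eq]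
    simp only [Matrix.mul_assoc]
  · obtain ⟨c, -, hc⟩ := hW.uniformlyPosDef
    exact (geScalar_iff.1 (hc t ht)).1
  · exact (mul_nonneg hd.le (dotProduct_self_nonneg' _)).trans (hdS t ht v)
  · obtain ⟨c, hc0, hc⟩ := hW.uniformlyPosDef
    exact ⟨c, hc0, fun t ht => (geScalar_iff.1 (hc t ht)).2⟩

theorem isRiccatiSolution_iff {A P : ℝ → Matrix Ix Ix ℝ} {C : ℝ → Matrix (Fin 3) Ix ℝ} :
    IsRiccatiSolution A C D V P
      ↔ IsRiccatiSolutionOn A (fun t => (C t)ᵀ * D t * C t) V P (Ici 0) := by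
  simp only [IsRiccatiSolution, IsRiccatiSolutionOn, riccatiField, mem_Ici, Matrix.mul_assoc]

/-- A solution of the Riccati equation, seen in the rotated frame. -/
theorem IsAttitude.rotate_solution (hQ : IsAttitude Q Ω) {P : ℝ → Matrix Ix Ix ℝ}
    (hP : IsRiccatiSolution (stateMatrix az Ω) (outputMatrix y) D V P) :
    IsRiccatiSolutionOn (rotatedMatrix az) (rotatedOutputWeight Q D y)
      (fun t => frame Q t * V t * (frame Q t)ᵀ) (fun t => frame Q t * P t * (frame Q t)ᵀ)
      (Ici 0) :=
  (isRiccatiSolution_iff.1 hP).conj (K := frameVelocity Ω) (fun _ ht => hQ.hasDeriv_frame ht)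
    (fun _ ht => hQ.transpose_mul_frame ht)
    (fun _ ht => hQ.rotatedMatrix_eq az ht) (fun _ ht => hQ.rotatedOutputWeight_eq D y ht)
    fun _ _ => rfl

/-- The converse passage, back to the body frame. -/
theorem IsAttitude.rotate_solution_back (hQ : IsAttitude Q Ω) {P : ℝ → Matrix Ix Ix ℝ}
    (hP : IsRiccatiSolutionOn (rotatedMatrix az) (rotatedOutputWeight Q D y)
      (fun t => frame Q t * V t * (frame Q t)ᵀ) P (Ici 0)) :
    IsRiccatiSolution (stateMatrix az Ω) (outputMatrix y) D V
      (fun t => (frame Q t)ᵀ * P t * frame Q t) := by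
  have e : ∀ t, 0 ≤ t → ∀ X : Matrix Ix Ix ℝ,
      X = (frame Q t)ᵀ * (frame Q t * X * (frame Q t)ᵀ) * ((frame Q t)ᵀ)ᵀ := fun t ht X => by
    rw [Matrix.transpose_transpose, Matrix.mul_assoc, Matrix.mul_assoc (frame Q t * X),
      hQ.transpose_mul_frame ht, Matrix.mul_one, ← Matrix.mul_assoc, hQ.transpose_mul_frame ht,
      Matrix.one_mul]
  have h := hP.conj (T := fun t => (frame Q t)ᵀ)
    (K := fun t => -(frame Q t * frameVelocity Ω t * (frame Q t)ᵀ))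
    (F := stateMatrix az Ω) (S' := fun t => (outputMatrix y t)ᵀ * D t * outputMatrix y t) (W' := V)
    (fun t ht => (hQ.hasDeriv_frame ht).transpose.congr_deriv (by
      rw [Matrix.transpose_mul, frameVelocity_transpose, Matrix.mul_neg, ← Matrix.mul_assoc,
        ← Matrix.mul_assoc, hQ.transpose_mul_frame ht, Matrix.one_mul, Matrix.neg_mul]))
    (fun t ht => by rw [Matrix.transpose_transpose, hQ.frame_mul_transpose ht])
    (fun t ht => by
      have h1 : rotatedMatrix az t + -(frame Q t * frameVelocity Ω t * (frame Q t)ᵀ)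
          = frame Q t * stateMatrix az Ω t * (frame Q t)ᵀ := by
        rw [hQ.rotatedMatrix_eq az ht, Matrix.mul_add, Matrix.add_mul, add_neg_cancel_right]
      rw [h1]
      exact e t ht _)
    (fun t ht => by rw [hQ.rotatedOutputWeight_eq D y ht]; exact e t ht _)
    (fun t ht => e t ht _)
  simp only [Matrix.transpose_transpose] at h
  exact isRiccatiSolution_iff.2 h

/-- The transition matrix of the error system in the body frame. -/
noncomputable def bodyTransition (Q : ℝ → Matrix (Fin 3) (Fin 3) ℝ) (az : ℝ → R3) (s t : ℝ) :
    Matrix Ix Ix ℝ :=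
  (frame Q s)ᵀ * rotatedTransition az s t * frame Q t

theorem IsAttitude.isStateTransition (hQ : IsAttitude Q Ω)
    (hΦ : IsTransition (rotatedMatrix az) (rotatedTransition az)) :
    IsStateTransition (stateMatrix az Ω) (bodyTransition Q az) := by
  refine fun t ht => ⟨?_, fun s hs => ?_⟩
  · rw [bodyTransition, hΦ.self t ht, Matrix.mul_one, hQ.transpose_mul_frame ht]
  · refine (((hQ.hasDeriv_frame hs).transpose.mul (hΦ.hasDeriv_left s t hs ht)).mul_const
      (frame Q t)).congr_deriv ?_
    have h : stateMatrix az Ω s = rotatedMatrix az s - frameVelocity Ω s := by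
      rw [← stateMatrix_add_frameVelocity (Ω := Ω), add_sub_cancel_right]
    have h1 : (frame Q s)ᵀ * rotatedMatrix az s = rotatedMatrix az s * (frame Q s)ᵀ := by
      rw [frame_transpose, rotatedMatrix, ← Matrix.mul_kronecker_mul, ← Matrix.mul_kronecker_mul]
      simp
    rw [← Matrix.mul_assoc ((frame Q s)ᵀ), h1, Matrix.transpose_mul, frameVelocity_transpose,
      bodyTransition, h]
    simp only [Matrix.sub_mul, Matrix.add_mul, Matrix.neg_mul, Matrix.mul_assoc]
    abel

/-- The integrands of the Gramians in the two frames. -/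
theorem IsAttitude.gramIntegrand_eq (hQ : IsAttitude Q Ω) {s t : ℝ} (hs : 0 ≤ s) :
    gramIntegrand (bodyTransition Q az) (outputMatrix y) t s
      = (frame Q t)ᵀ * gramIntegrand (rotatedTransition az) (outputMatrix (rotate Q y)) t s
        * frame Q t := by
  have h := hQ.outputMatrix_mul_frame_transpose y hs
  have h' := congrArg Matrix.transpose h
  rw [Matrix.transpose_mul, Matrix.transpose_mul, Matrix.transpose_transpose,
    Matrix.transpose_transpose] at h'
  have hQQ : ∀ X : Matrix (Fin 3) Ix ℝ, Q s * ((Q s)ᵀ * X) = X := fun X => by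
    rw [← Matrix.mul_assoc, hQ.mul_transpose hs, Matrix.one_mul]
  calc gramIntegrand (bodyTransition Q az) (outputMatrix y) t s
      = (frame Q t)ᵀ * (rotatedTransition az s t)ᵀ * (frame Q s * (outputMatrix y s)ᵀ)
          * (outputMatrix y s * (frame Q s)ᵀ) * rotatedTransition az s t * frame Q t := by
        simp only [gramIntegrand, bodyTransition, Matrix.transpose_mul, Matrix.transpose_transpose,
          Matrix.mul_assoc]
    _ = _ := by
        rw [h, h']
        simp only [gramIntegrand, Matrix.mul_assoc, hQQ]

/-- Uniform observability in the rotated frame gives uniform observability in the body frame. -/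
theorem IsAttitude.uniformlyObservable (hQ : IsAttitude Q Ω)
    (hΦ : IsTransition (rotatedMatrix az) (rotatedTransition az)) (hy : ContinuousOn y (Ici 0))
    {L g : ℝ} (hL : 0 < L) (hg : 0 < g)
    (hobs : ∀ t, 0 ≤ t → ∀ v, g * (v ⬝ᵥ v) ≤ v ⬝ᵥ matIntegral t (t + L)
      (gramIntegrand (rotatedTransition az) (outputMatrix (rotate Q y)) t) *ᵥ v) :
    UniformlyObservable (stateMatrix az Ω) (outputMatrix y) := by
  refine ⟨bodyTransition Q az, hQ.isStateTransition hΦ, L, g / L, hL, by positivity,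
    fun t ht => ?_⟩
  have htL : 0 ≤ t + L := by linarith
  have e : gramian (bodyTransition Q az) (outputMatrix y) t L
      = (1 / L) • matIntegral t (t + L) fun s => (frame Q t)ᵀ *
        gramIntegrand (rotatedTransition az) (outputMatrix (rotate Q y)) t s * frame Q t := by
    ext i j
    simp only [gramian, Matrix.smul_apply, matIntegral, Matrix.of_apply]
    congr 1
    refine intervalIntegral.integral_congr fun s hs => ?_
    rw [uIcc_of_le (by linarith)] at hs
    exact congrFun (congrFun (hQ.gramIntegrand_eq (az := az) (y := y) (t := t)
      (ht.trans hs.1)) i) j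
  have hG := hΦ.continuousOn_gramIntegrand
    (continuousOn_outputMatrix (hQ.continuousOn_rotate hy)) ht
  rw [e, geScalar_iff]
  constructor
  · refine Matrix.IsSymm.smul ?_ _
    ext i j
    simp only [Matrix.transpose_apply, matIntegral, Matrix.of_apply]
    refine intervalIntegral.integral_congr fun s _ => ?_
    have h : ∀ X : Matrix Ix Ix ℝ, Xᵀ = X → X j i = X i j :=
      fun X hX => congrFun (congrFun hX i) j
    refine h _ ?_
    simp only [gramIntegrand, Matrix.transpose_mul, Matrix.transpose_transpose, Matrix.mul_assoc]
  · intro v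
    have h := hobs t ht (frame Q t *ᵥ v)
    rw [mulVec_dotProduct_mulVec_of_orthogonal (hQ.transpose_mul_frame ht),
      dotProduct_matIntegral_mulVec hG ht htL] at h
    rw [Matrix.smul_mulVec, dotProduct_smul, dotProduct_matIntegral_mulVec
      ((continuousOn_const.matrix_mul hG).matrix_mul continuousOn_const) ht htL, smul_eq_mul,
      div_mul_eq_mul_div, one_div, inv_mul_eq_div]
    refine div_le_div_of_nonneg_right (h.trans (le_of_eq ?_)) hL.le
    refine intervalIntegral.integral_congr fun s _ => ?_
    simp only [← Matrix.mulVec_mulVec, dotProduct_transpose_mulVec]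

/-- The quadratic form of the Gramian is the energy of the displacement across the bearing. -/
theorem dotProduct_gramIntegrand_mulVec {y₀ : ℝ → R3} (s t : ℝ) (v : Ix → ℝ) :
    v ⬝ᵥ gramIntegrand (rotatedTransition az) (outputMatrix y₀) t s *ᵥ v
      = projSq (y₀ s) ((fun i => v (0, i)) + (s - t) • (fun i => v (1, i))
        + LambdaT az s t *ᵥ fun p => v (![2, 3, 4] p.1, p.2)) := by
  rw [projSq, ← outputMatrix_mulVec_rotatedTransition, gramIntegrand]
  simp only [← Matrix.mulVec_mulVec, dotProduct_transpose_mulVec]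

/-- Solutions of the error system, seen in the rotated frame. -/
theorem IsAttitude.hasDeriv_frame_mulVec (hQ : IsAttitude Q Ω) {P : ℝ → Matrix Ix Ix ℝ}
    {x : ℝ → EuclideanSpace ℝ Ix} {t₀ t : ℝ} (ht₀ : 0 ≤ t₀) (ht : t₀ ≤ t)
    (hx : HasDerivWithinAt x (errorField (stateMatrix az Ω) (outputMatrix y) D P t (x t))
      (Ici t₀) t) :
    HasDerivWithinAt (fun t => frame Q t *ᵥ (x t).ofLp)
      (rotatedMatrix az t *ᵥ (frame Q t *ᵥ (x t).ofLp) - (frame Q t * P t * (frame Q t)ᵀ) *ᵥ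
        (rotatedOutputWeight Q D y t *ᵥ (frame Q t *ᵥ (x t).ofLp))) (Ici t₀) t := by
  have ht0 : 0 ≤ t := ht₀.trans ht
  have hx' : HasDerivWithinAt (fun t => (x t).ofLp)
      (errorField (stateMatrix az Ω) (outputMatrix y) D P t (x t)).ofLp (Ici t₀) t :=
    (PiLp.continuousLinearEquiv 2 ℝ (fun _ : Ix => ℝ)).toContinuousLinearMap.hasFDerivAt
      |>.comp_hasDerivWithinAt t hx
  refine (((hQ.hasDeriv_frame ht0).mono (Ici_subset_Ici.2 ht₀)).mulVec hx').congr_deriv ?_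
  have e : ∀ X : Matrix Ix Ix ℝ, (frame Q t)ᵀ * (frame Q t * X) = X := fun X => by
    rw [← Matrix.mul_assoc, hQ.transpose_mul_frame ht0, Matrix.one_mul]
  have h1 : frame Q t * (stateMatrix az Ω t + frameVelocity Ω t)
      = rotatedMatrix az t * frame Q t := by
    rw [stateMatrix_add_frameVelocity, frame_mul_rotatedMatrix]
  rw [hQ.rotatedOutputWeight_eq D y ht0, errorField]
  simp only [Matrix.mulVec_mulVec, Matrix.mulVec_sub, Matrix.mul_assoc, e,
    hQ.transpose_mul_frame ht0, Matrix.mul_one]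
  rw [← h1, Matrix.mul_add, Matrix.add_mulVec]
  abel

end RotatedFrame

end BearingObserver

open BearingObserver

theorem lemma2
    -- angular velocities of the body and of the target, acceleration of the target, bearing
    (Ω ωT aT y : ℝ → R3)
    -- attitude of the body, auxiliary attitude
    (QB Z : ℝ → Matrix (Fin 3) (Fin 3) ℝ)
    (hQB : IsAttitude QB Ω)
    (hZ : IsAttitude Z ωT) (hZ0 : Z 0 = 1)
    (haT_cont : ContinuousOn aT (Set.Ici 0))
    (haT_bdd : ∃ K : ℝ, ∀ t, 0 ≤ t → ‖aT t‖ ≤ K)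
    (hy_cont : ContinuousOn y (Set.Ici 0))
    (hy_unit : ∀ t, 0 ≤ t → ‖y t‖ = 1)
    -- weights of the Riccati equation
    (D : ℝ → Matrix (Fin 3) (Fin 3) ℝ) (V : ℝ → Matrix Ix Ix ℝ)
    (hD : IsWeight D) (hV : IsWeight V)
    -- the two excitation conditions
    (δ μ : ℝ) (hδ : 0 < δ) (hμ : 0 < μ)
    (hPE : ∀ t, 0 ≤ t →
      GeScalar ((1 / δ) • matIntegral t (t + δ) fun s => proj (rotate QB y s)) μ)
    (hSchur : ∀ t, 0 ≤ t →
      GeScalar ((1 / δ) • matIntegral t (t + δ) fun s =>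
        (excitation (rotate Z aT) (rotate QB y) δ s t)ᵀ *
          excitation (rotate Z aT) (rotate QB y) δ s t) μ) :
    UniformlyObservable (stateMatrix (rotate Z aT) Ω) (outputMatrix y) ∧
    (∀ P₀ : Matrix Ix Ix ℝ, P₀.PosDef →
      ∃ P, P 0 = P₀ ∧
        IsRiccatiSolution (stateMatrix (rotate Z aT) Ω) (outputMatrix y) D V P) ∧
    (∀ P : ℝ → Matrix Ix Ix ℝ, (P 0).PosDef →
      IsRiccatiSolution (stateMatrix (rotate Z aT) Ω) (outputMatrix y) D V P →
      GloballyExponentiallyStable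
        (errorField (stateMatrix (rotate Z aT) Ω) (outputMatrix y) D P)) := by
  obtain ⟨K, hK⟩ := haT_bdd
  have hz : ContinuousOn (rotate Z aT) (Set.Ici 0) := hZ.continuousOn_rotate haT_cont
  have hzK : ∀ t, 0 ≤ t → ‖rotate Z aT t‖ ≤ K := fun t ht =>
    (hZ.norm_rotate aT ht).le.trans (hK t ht)
  have hy0 : ContinuousOn (rotate QB y) (Set.Ici 0) := hQB.continuousOn_rotate hy_cont
  have hy1 : ∀ t, 0 ≤ t → ‖rotate QB y t‖ = 1 := fun t ht =>
    (hQB.norm_rotate y ht).trans (hy_unit t ht)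
  -- removing the factor `1 / δ` from the two excitation conditions
  have hscale : ∀ {n : Type} [Fintype n] [DecidableEq n] {X : Matrix n n ℝ},
      GeScalar ((1 / δ) • X) μ → ∀ v, δ * μ * (v ⬝ᵥ v) ≤ v ⬝ᵥ X *ᵥ v := fun {n} _ _ {X} h v => by
    have h1 := (geScalar_iff.1 h).2 v
    rw [Matrix.smul_mulVec, dotProduct_smul, smul_eq_mul, div_mul_eq_mul_div, one_mul,
      le_div_iff₀ hδ] at h1
    linarith
  have hexc : BearingExcited (rotate QB y) δ (δ * μ) := fun t ht v => by
    have h1 := hscale (hPE t ht) v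
    rw [dotProduct_matIntegral_mulVec (continuousOn_proj hy0) ht (by linarith)] at h1
    refine h1.trans (le_of_eq (intervalIntegral.integral_congr fun s hs => ?_))
    rw [Set.uIcc_of_le (by linarith)] at hs
    exact (dotProduct_proj_mulVec (hy1 s (ht.trans hs.1)) v v).symm
  obtain ⟨L, g, hL, hg, henergy⟩ := exists_energy_lower hz hzK hy0 hy1 hδ (mul_pos hδ hμ) hexc
    fun t ht => hscale (hSchur t ht)
  have hΦ := isTransition_rotated hz hzK
  have hC := continuousOn_outputMatrix hy0
  have hobs : ∀ t, 0 ≤ t → ∀ v, g * (v ⬝ᵥ v) ≤ v ⬝ᵥ matIntegral t (t + L)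
      (gramIntegrand (rotatedTransition (rotate Z aT)) (outputMatrix (rotate QB y)) t) *ᵥ v :=
    fun t ht v => by
      rw [dotProduct_matIntegral_mulVec (hΦ.continuousOn_gramIntegrand hC ht) ht (by linarith),
        dotProduct_self_blocks]
      simp only [dotProduct_gramIntegrand_mulVec]
      exact henergy t ht _ _ _
  have hdata := isRiccatiData_rotated hQB hz hzK hy_cont hy_unit hD hV
  have hconj : ∀ P₀ : Matrix Ix Ix ℝ, P₀.PosDef →
      (frame QB 0 * P₀ * (frame QB 0)ᵀ).PosDef := fun P₀ hP₀ => by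
    have hinj : Function.Injective (frame QB 0).vecMul := by
      rw [Matrix.vecMul_injective_iff_isUnit]
      exact IsUnit.of_mul_eq_one _ (hQB.frame_mul_transpose le_rfl)
    simpa using hP₀.mul_mul_conjTranspose_same hinj
  refine ⟨hQB.uniformlyObservable hΦ hy_cont hL hg hobs, fun P₀ hP₀ => ?_, fun P hP₀ hP => ?_⟩
  · obtain ⟨P, h0, hP⟩ := hdata.exists_solution hΦ (hconj P₀ hP₀)
    refine ⟨_, ?_, hQB.rotate_solution_back hP⟩
    simp only [h0]
    rw [← Matrix.mul_assoc, ← Matrix.mul_assoc, hQB.transpose_mul_frame le_rfl, Matrix.one_mul,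
      Matrix.mul_assoc, hQB.transpose_mul_frame le_rfl, Matrix.mul_one]
  · have hP' := hQB.rotate_solution hP
    have hpos := hconj _ hP₀
    have hsymm₀ := Matrix.isHermitian_iff_isSymm.1 hpos.isHermitian
    obtain ⟨d, hd, hdS⟩ := exists_output_le_rotatedOutputWeight (y := y) hQB hD
    obtain ⟨p₁, hp₁, hlow⟩ := hdata.exists_lower_bound hpos
    obtain ⟨p₂, hp₂, hup⟩ := hdata.exists_upper_bound hΦ hC (entriesBounded_outputMatrix hy1) hd hdS
      hL hg hobs hsymm₀
    obtain ⟨c, hc, hdecay⟩ := hdata.exists_exponential_decay hP'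
      (fun t ht => hdata.isSymm (hP'.mono Set.Icc_subset_Ici_self) hsymm₀ t ⟨ht, le_rfl⟩) hp₁ hp₂
      (fun t ht => hlow t _ rfl (hP'.mono Set.Icc_subset_Ici_self) t ⟨ht, le_rfl⟩) (hup _ rfl hP')
    refine ⟨fun t _ => by simp [errorField], √(p₂ / p₁), c / 2, by positivity, by positivity,
      fun t₀ ht₀ x hx t ht => ?_⟩
    have h := hdecay t₀ ht₀ (fun t => frame QB t *ᵥ (x t).ofLp)
      (fun s hs => hQB.hasDeriv_frame_mulVec ht₀ hs (hx s hs)) t ht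
    simp only [mulVec_dotProduct_mulVec_of_orthogonal (hQB.transpose_mul_frame ht₀),
      mulVec_dotProduct_mulVec_of_orthogonal (hQB.transpose_mul_frame (ht₀.trans ht))] at h
    have hexp : Real.exp (-(c * (t - t₀))) = Real.exp (-(c / 2) * (t - t₀)) ^ 2 := by
      rw [← Real.exp_nat_mul]; congr 1; push_cast; ring
    rw [norm_eq_sqrt_dotProduct, norm_eq_sqrt_dotProduct]
    refine (Real.sqrt_le_sqrt h).trans (le_of_eq ?_)
    rw [Real.sqrt_mul (by positivity), Real.sqrt_mul (by positivity), hexp,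
      Real.sqrt_sq (Real.exp_pos _).le]
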